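/- **Model.** Consider the directed line with nodes $v_0\to v_1\to\dots\to v_{n-1}$, buffer size $B$ and link capacity $c$. A request $(a,b,t)$ is a packet input at node $a$ in step $t$ with destination $b$; we consider finite request sequences $R$, listed in order of input times, with $a<b$ for every request. In every step each packet in the network is dropped, stored at its node, or forwarded to the next node; in a step at most $B$ packets are stored at a node and at most $c$ are sent over a link; a packet is removed (delivered) when it reaches its destination. An online algorithm determines the actions of step $t$ from the requests input by step $t$. A packet is accepted if it is not dropped in the step in which it is input; the algorithm is nonpreemptive if every accepted packet is delivered. $|\mathrm{ALG}(R)|$ is the number of delivered packets. **Fractional routings.** The space-time grid $G^{st}$ has vertices $(v_i,t)$, store edges $(v_i,t)\to(v_i,t+1)$ of capacity $B$ and forward edges $(v_i,t)\to(v_{i+1},t+1)$ of capacity $c$. A fractional routing of $R$ assigns to each request $(a,b,t)$ finitely many paths in $G^{st}$ from $(a,t)$ to vertices of the row of $b$, with nonnegative weights of sum at most $1$, such that the total weight of the paths through each edge is at most its capacity. Its throughput is the sum of all weights; $|f^*_{G^{st}}(R)|$ is the maximum (supremum) throughput. **The algorithm.** Logarithms are to base 2. Let $B'=\lfloor B/5\rfloor$,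 $c'=\lfloor c/5\rfloor$, $p_{\max}=2n(1+B/c)$, $k=\log(1+3p_{\max})$, $\ell_h=2\lceil 3k/c'\rceil$, $\ell_v=2\lceil 3k/B'\rceil$. Embed $(v_i,t)$ in the plane at $(t-i,i)$, so that store edges go east and forward edges go north. The four tilings $T$ partition the plane into $\ell_h\times\ell_v$ tiles with corners at $(\phi_x+p\ell_h,\phi_y+q\ell_v)$, $p,q\in\mathbb Z$, for the offsets $(\phi_x,\phi_y)\in\{-\ell_h/2,0\}\times\{-\ell_v/2,0\}$; each tile has four quadrants SW, SE, NW, NE. The sketch graph of $T$ has the tiles as vertices and an edge from each tile to its east and to its north neighbour, of unit capacity. There are five tracks, one for near requests and one for each tiling, each with capacity $B'$ on store edges and $c'$ on forward edges. In step $t$ the new requests are sorted by distance $b-a$, for each source only the first $B'+c'$ are kept, and these are processed in order: * A request with $b-a\le\ell_v$ (near) is accepted iff fewer than $c'$ accepted near requests use the forward edge out of $(a,t)$; it is then always forwarded, never stored. * Any other request (far) is handled in the tiling $T$ for which $(a,t)$ lies in a SW quadrant. It is accepted iff both (i) and (ii) succeed, where the loads count the requests accepted so far in tiling $T$: (i)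 path packing: among the sketch paths of length at most $p_{\max}$ from the tile of $(a,t)$ to a tile meeting the row of $b$, a lightest one for the edge weights $(2^{\mathrm{load}(e)}-1)/p_{\max}$ has weight less than $1$; it becomes the sketch path of the request; (ii) initial routing: the straight path east, or else the straight path north, from $(a,t)$ out of the SW quadrant has on all its edges fewer than $B'$ (respectively $c'$) initial paths. * Detailed routing: in each vertex, an accepted far packet wants to go in the direction of its initial path in a SW quadrant, east in a NW quadrant, north in a SE quadrant, and in the direction of the next edge of its sketch path in a NE quadrant (north in the last tile of its sketch path). Of the packets of one tiling that want to go in the same direction, as many do so as the track capacity admits, those which go straight having precedence over those which turn; the others go in the other direction. **Theorem.** There is an absolute constant $C>0$ such that for all integers $n,B,c$ with $B,c\in[5,\log n]$, this deterministic online algorithm respects all capacity constraints and is nonpreemptive on every request sequence $R$, and $$|f^*_{G^{st}}(R)|\le C\log n\cdot|\mathrm{ALG}(R)| .$$ In particular $|\mathrm{OPT}(R)|\le C\log n\cdot|\mathrm{ALG}(R)|$, where $\mathrm{OPT}(R)$ is a largest set of requests of $R$ that can be delivered by an (offline) schedule within the capacity constraints; that is, the algorithm is $O(\log n)$-competitive.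 -/

import Mathlib

/-! # Online packet routing on a directed line

Part 1: the store-and-forward model, schedules, online algorithms, throughput.
Part 2: the space-time grid and fractional routings in it.
Part 3: the routing algorithm. -/

noncomputable section

namespace PacketRouting

/-! ## 1. The model -/

/-- The directed line `v_0 → v_1 → ... → v_{n-1}` with buffer size `B` and link capacity `c`. -/
structure Network where
  n : ℕ
  B : ℕ
  c : ℕ

/-- A request `(a, b, t)`: a packet input at node `a` at step `t` with destination `b`. -/
structure Request (N : Network) where
  src : Fin N.n
  dst : Fin N.n
  time : ℕ

/-- A (finite) sequence of requests: the requests are listed in the order in which they are input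
(any number of them may be input in the same step, even with equal source and destination), and the
destination of each packet lies strictly downstream of its source.
The packet of the `i`-th request is called packet `i`. -/
def IsRequestSequence {N : Network} (R : List (Request N)) : Prop :=
  R.Pairwise (fun r s => r.time ≤ s.time) ∧ ∀ r ∈ R, r.src < r.dst

/-- What can be done in one step with a packet that is in the network. -/
inductive Action
  | drop
  | store
  | forward
  deriving DecidableEq

/-- The situation of a packet in step `t`, after the packets of step `t` have been input and the
packets that reached their destination have been removed. -/
inductive Status
  | waiting
  | inNetwork (v : ℕ)
  | delivered
  | dropped
  deriving DecidableEq

/-- The status of the packet of `r` when it gets to node `v`. -/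
def Request.arrive {N : Network} (r : Request N) (v : ℕ) : Status :=
  if v = (r.dst : ℕ) then .delivered else .inNetwork v

/-- The status in each step of the packet of `r`, if action `act t` is taken on it in step `t`
(the actions count only while the packet is in the network). -/
def Request.status {N : Network} (r : Request N) (act : ℕ → Action) : ℕ → Status
  | 0 => if r.time = 0 then r.arrive r.src else .waiting
  | t + 1 =>
    match r.status act t with
    | .waiting => if r.time = t + 1 then r.arrive r.src else .waiting
    | .inNetwork v =>
      match act t with
      | .drop => .dropped
      | .store => r.arrive v
      | .forward => r.arrive (v + 1)
    | .delivered => .delivered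
    | .dropped => .dropped

/-- A schedule: `S t i` is the action taken in step `t` on packet `i`. -/
abbrev Schedule := ℕ → ℕ → Action

variable {N : Network}

/-- The number of packets at node `v` in step `t` on which action `a` is taken. -/
def numActing (R : List (Request N)) (S : Schedule) (a : Action) (v t : ℕ) : ℕ :=
  (Finset.univ.filter fun i : Fin R.length =>
    (R.get i).status (fun s => S s i) t = .inNetwork v ∧ S t i = a).card

/-- The link and buffer capacity constraints (there is no link out of the last node). -/
def Feasible (R : List (Request N)) (S : Schedule) : Prop :=
  ∀ v t : ℕ,
    numActing R S .forward v t ≤ (if v + 1 < N.n then N.c else 0) ∧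
    numActing R S .store v t ≤ N.B

/-- Packet `i` reaches its destination. -/
def Delivered (R : List (Request N)) (S : Schedule) (i : Fin R.length) : Prop :=
  ∃ t, (R.get i).status (fun s => S s i) t = .delivered

/-- Packet `i` is dropped in the step in which it is input. -/
def Rejected (R : List (Request N)) (S : Schedule) (i : Fin R.length) : Prop :=
  (R.get i).status (fun s => S s i) ((R.get i).time + 1) = .dropped

/-- Every accepted packet reaches its destination. -/
def Nonpreemptive (R : List (Request N)) (S : Schedule) : Prop :=
  ∀ i : Fin R.length, ¬ Rejected R S i → Delivered R S i

open scoped Classical in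
/-- The number of packets that are delivered to their destination. -/
def throughput (R : List (Request N)) (S : Schedule) : ℕ :=
  (Finset.univ.filter fun i : Fin R.length => Delivered R S i).card

/-- A deterministic centralized online algorithm: from the list of the requests received so far and
the number of the current step, it computes the action on each packet in the current step. -/
abbrev OnlineAlgorithm (N : Network) := List (Request N) → ℕ → ℕ → Action

/-- The requests that have been input by step `t`. If `R` is a request sequence, this is an initial
segment of `R`, so that packets keep their numbers. -/
def received (R : List (Request N)) (t : ℕ) : List (Request N) :=
  R.filter fun r => r.time ≤ t

/-- The schedule that the algorithm produces on input `R`. -/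
def OnlineAlgorithm.schedule (A : OnlineAlgorithm N) (R : List (Request N)) : Schedule :=
  fun t i => A (received R t) t i

/-! ## 2. The space-time grid and fractional routings -/

/-- The two kinds of edges of the space-time grid:
`store` is `(v, t) → (v, t + 1)` and `forward` is `(v, t) → (v + 1, t + 1)`.
In the axis-parallel embedding `(v, t) ↦ (t - v, v)`, `store` goes one unit east and `forward` goes
one unit north. The same type serves for the edges of the sketch graphs (east and north). -/
inductive Move
  | store
  | forward
  deriving DecidableEq

/-- The node reached from node `v` by a move. -/
def Move.node (v : ℕ) : Move → ℕ
  | .store => v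
  | .forward => v + 1

/-- An edge of the space-time grid, given by its tail `(v, t)` and its kind. -/
abbrev STEdge := (ℕ × ℕ) × Move

/-- The edges of the path in the space-time grid that starts in `(v, t)` and makes the given
moves. -/
def pathEdges (v t : ℕ) : List Move → List STEdge
  | [] => []
  | m :: w => ((v, t), m) :: pathEdges (m.node v) (t + 1) w

/-- The moves `w` lead from the source vertex `(a, t)` of the request to the row of its
destination `b`. -/
def Request.IsRoute (r : Request N) (w : List Move) : Prop :=
  (r.src : ℕ) + w.count .forward = r.dst

/-- The capacity of an edge of the space-time grid. -/
def Network.capacity (N : Network) (e : STEdge) : ℕ :=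
  match e.2 with
  | .store => N.B
  | .forward => N.c

/-- A fractional routing of `R` in the space-time grid: `flow i w` is the fraction of request `i`
that is served by the path with moves `w`. -/
structure FractionalRouting (R : List (Request N)) where
  flow : Fin R.length → (List Move →₀ ℝ)
  nonneg : ∀ i w, 0 ≤ flow i w
  isRoute : ∀ i w, flow i w ≠ 0 → (R.get i).IsRoute w
  amount_le_one : ∀ i, ((flow i).sum fun _ x => x) ≤ 1

/-- The total load of an edge. -/
def FractionalRouting.load {R : List (Request N)} (f : FractionalRouting R) (e : STEdge) : ℝ :=
  (∑ i, (f.flow i).sum fun w x =>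
    if e ∈ pathEdges (R.get i).src (R.get i).time w then x else 0) / N.capacity e

/-- `f` is a `β`-packing. -/
def FractionalRouting.IsPacking {R : List (Request N)} (f : FractionalRouting R) (β : ℝ) : Prop :=
  ∀ e, f.load e ≤ β

/-- The throughput of a fractional routing: the sum of the flow amounts of all requests. -/
def FractionalRouting.throughput {R : List (Request N)} (f : FractionalRouting R) : ℝ :=
  ∑ i, (f.flow i).sum fun _ x => x

/-! ## 3. The algorithm -/

namespace Network

/-! ### Parameters -/

/-- The buffer capacity of a track. -/
def trackB (N : Network) : ℕ := N.B / 5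

/-- The link capacity of a track. -/
def trackC (N : Network) : ℕ := N.c / 5

/-- The capacity that a track has on the edges of each kind. -/
def trackCap (N : Network) : Move → ℕ
  | .store => N.trackB
  | .forward => N.trackC

/-- The bound on the path lengths. -/
def pmax (N : Network) : ℝ := 2 * N.n * (1 + N.B / N.c)

def k (N : Network) : ℝ := Real.logb 2 (1 + 3 * N.pmax)

/-- Half the length of a tile. -/
def halfH (N : Network) : ℕ := ⌈3 * N.k / N.trackC⌉₊

/-- Half the height of a tile. -/
def halfV (N : Network) : ℕ := ⌈3 * N.k / N.trackB⌉₊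

/-- The length of a tile. For each track, the capacities along a horizontal side of a quadrant add
up to at least `3k`. -/
def tileH (N : Network) : ℕ := 2 * N.halfH

/-- The height of a tile. For each track, the capacities along a vertical side of a quadrant add up
to at least `3k`. -/
def tileV (N : Network) : ℕ := 2 * N.halfV

end Network

/-! ### Tilings and sketch graphs -/

/-- The four tilings: the components tell whether the tiling is shifted by half a tile in the
horizontal and in the vertical direction. -/
abbrev Tiling := Bool × Bool

namespace Network

def offsetX (N : Network) (T : Tiling) : ℤ := if T.1 then -(N.halfH : ℤ) else 0

def offsetY (N : Network) (T : Tiling) : ℤ := if T.2 then -(N.halfV : ℤ) else 0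

/-- The (vertical) index of the tiles that meet row `v`. -/
def tileRow (N : Network) (T : Tiling) (v : ℕ) : ℤ := ((v : ℤ) - N.offsetY T) / N.tileV

/-- The index of the tile that contains the vertex `(v, t)`, embedded in `(t - v, v)`. -/
def tile (N : Network) (T : Tiling) (v t : ℕ) : ℤ × ℤ :=
  (((t : ℤ) - v - N.offsetX T) / N.tileH, N.tileRow T v)

/-- The horizontal position of `(v, t)` in its tile. -/
def localX (N : Network) (T : Tiling) (v t : ℕ) : ℤ := ((t : ℤ) - v - N.offsetX T) % N.tileH

/-- The vertical position of `(v, t)` in its tile. -/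
def localY (N : Network) (T : Tiling) (v : ℕ) : ℤ := ((v : ℤ) - N.offsetY T) % N.tileV

/-- `(v, t)` is in the east half of its tile. -/
def InEast (N : Network) (T : Tiling) (v t : ℕ) : Prop := (N.halfH : ℤ) ≤ N.localX T v t

/-- `(v, t)` is in the north half of its tile. -/
def InNorth (N : Network) (T : Tiling) (v : ℕ) : Prop := (N.halfV : ℤ) ≤ N.localY T v

/-- `(v, t)` is in the south-west quadrant of its tile. -/
def InSW (N : Network) (T : Tiling) (v t : ℕ) : Prop := ¬ N.InEast T v t ∧ ¬ N.InNorth T v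

open scoped Classical in
/-- The tiling in which `(v, t)` is in the south-west quadrant of a tile. -/
def swTiling (N : Network) (v t : ℕ) : Tiling :=
  ([(false, false), (false, true), (true, false), (true, true)].find?
    fun T => decide (N.InSW T v t)).getD (false, false)

end Network

/-- An edge of a sketch graph, given by its tail and its direction. -/
abbrev SketchEdge := (ℤ × ℤ) × Move

/-- The tile next to tile `s` in the given direction. -/
def Move.nextTile (s : ℤ × ℤ) : Move → ℤ × ℤ
  | .store => (s.1 + 1, s.2)
  | .forward => (s.1, s.2 + 1)

/-- The edges of the path in the sketch graph that starts in tile `s` and makes the given moves. -/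
def sketchEdges (s : ℤ × ℤ) : List Move → List SketchEdge
  | [] => []
  | m :: w => (s, m) :: sketchEdges (m.nextTile s) w

/-! ### Accepted requests -/

/-- What the algorithm fixes about a request when it accepts it: a near request goes straight to its
destination; a far request is handled in one of the four tilings, has a sketch path and leaves the
south-west quadrant in which it starts in the direction `init`. -/
inductive Route
  | near
  | far (T : Tiling) (sketch : List Move) (init : Move)
  deriving DecidableEq

/-- An accepted request: packet number, request and route. -/
structure Entry (N : Network) where
  idx : ℕ
  req : Request N
  route : Route

/-- The source tile of a request. -/
def Request.sourceTile (r : Request N) (T : Tiling) : ℤ × ℤ := N.tile T r.src r.time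

/-! ### Near requests -/

def Request.IsNear (r : Request N) : Prop := (r.dst : ℕ) - r.src ≤ N.tileV

/-- The moves of a packet that is never stored. -/
def Request.straight (r : Request N) : List Move := List.replicate ((r.dst : ℕ) - r.src) .forward

/-- The number of accepted near requests that are routed along `e`. -/
def nearLoad (acc : List (Entry N)) (e : STEdge) : ℕ :=
  acc.countP fun a =>
    match a.route with
    | .near => decide (e ∈ pathEdges a.req.src a.req.time a.req.straight)
    | .far _ _ _ => false

/-! ### Online path packing in a sketch graph -/

/-- The number of accepted requests of tiling `T` whose sketch path uses `e`. All edges of a sketch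
graph have capacity one, so this is the load of `e`. -/
def sketchLoad (acc : List (Entry N)) (T : Tiling) (e : SketchEdge) : ℕ :=
  acc.countP fun a =>
    match a.route with
    | .near => false
    | .far T' p _ => decide (T' = T ∧ e ∈ sketchEdges (a.req.sourceTile T) p)

/-- The legal sketch paths: from the source tile to a tile that meets the row of the destination, of
length at most `p_max`. -/
def Request.IsSketchPath (r : Request N) (T : Tiling) (p : List Move) : Prop :=
  N.tileRow T r.src + p.count .forward = N.tileRow T r.dst ∧ (p.length : ℝ) ≤ N.pmax

/-- The weight of a sketch path; the weight of an edge is exponential in its load. -/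
def sketchWeight (acc : List (Entry N)) (T : Tiling) (r : Request N) (p : List Move) : ℝ :=
  ((sketchEdges (r.sourceTile T) p).map fun e =>
    ((2 : ℝ) ^ sketchLoad acc T e - 1) / N.pmax).sum

def IsLightest (acc : List (Entry N)) (T : Tiling) (r : Request N) (p : List Move) : Prop :=
  r.IsSketchPath T p ∧
    ∀ q, r.IsSketchPath T q → sketchWeight acc T r p ≤ sketchWeight acc T r q

open scoped Classical in
/-- The path packing algorithm: a lightest legal path, or `none` (reject) if its weight is not less
than one. -/
def ipp (acc : List (Entry N)) (T : Tiling) (r : Request N) : Option (List Move) :=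
  if h : ∃ p, IsLightest acc T r p ∧ sketchWeight acc T r p < 1 then some h.choose else none

/-! ### Initial routing -/

/-- The straight path in the given direction that leads from the source out of the south-west
quadrant. -/
def Request.initPath (r : Request N) (T : Tiling) : Move → List Move
  | .store => List.replicate (N.halfH - N.localX T r.src r.time).toNat .store
  | .forward => List.replicate (N.halfV - N.localY T r.src).toNat .forward

/-- The number of accepted requests of tiling `T` whose initial path uses `e`. -/
def initLoad (acc : List (Entry N)) (T : Tiling) (e : STEdge) : ℕ :=
  acc.countP fun a =>
    match a.route with
    | .near => false
    | .far T' _ d => decide (T' = T ∧ e ∈ pathEdges a.req.src a.req.time (a.req.initPath T d))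

/-- The straight path in direction `d` has free capacity in the track of `T`. -/
def InitFree (acc : List (Entry N)) (T : Tiling) (r : Request N) (d : Move) : Prop :=
  ∀ e ∈ pathEdges r.src r.time (r.initPath T d), initLoad acc T e < N.trackCap d

open scoped Classical in
/-- Initial routing: the direction of a free straight path, or `none` (reject). -/
def initialRoute (acc : List (Entry N)) (T : Tiling) (r : Request N) : Option Move :=
  if InitFree acc T r .store then some .store
  else if InitFree acc T r .forward then some .forward
  else none

/-! ### Admission -/

/-- The requests of step `t` with their packet numbers, sorted by source-destination distance. -/
def newRequests (H : List (Request N)) (t : ℕ) : List (Request N × ℕ) :=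
  (H.zipIdx.filter fun p => p.1.time = t).mergeSort fun p q =>
    decide ((p.1.dst : ℕ) - p.1.src ≤ (q.1.dst : ℕ) - q.1.src)

/-- Of the new requests, only the first `B' + c'` from each source are kept. -/
def filteredRequests (H : List (Request N)) (t : ℕ) : List (Request N × ℕ) :=
  (newRequests H t).filter fun p =>
    p.2 ∈ (((newRequests H t).filter fun q => q.1.src = p.1.src).take
      (N.trackB + N.trackC)).map Prod.snd

open scoped Classical in
/-- The treatment of one request, given the list of the requests accepted before. -/
def processRequest (acc : List (Entry N)) (p : Request N × ℕ) : List (Entry N) :=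
  if p.1.IsNear then
    if nearLoad acc ((p.1.src, p.1.time), .forward) < N.trackC then acc ++ [⟨p.2, p.1, .near⟩]
    else acc
  else
    let T := N.swTiling p.1.src p.1.time
    match ipp acc T p.1, initialRoute acc T p.1 with
    | some sketch, some init => acc ++ [⟨p.2, p.1, .far T sketch init⟩]
    | _, _ => acc

/-- The requests accepted before step `t`. -/
def accepted (H : List (Request N)) : ℕ → List (Entry N)
  | 0 => []
  | t + 1 => (filteredRequests H t).foldl processRequest (accepted H t)

/-! ### Detailed routing -/

/-- The location of a packet: its node and its last move; `none` if it is not in the network. -/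
abbrev Location := Option (ℕ × Option Move)

open scoped Classical in
/-- The direction in which an accepted packet should leave the quadrant in which it is in `(v, t)`:
as fixed by initial routing in a south-west quadrant, east in a north-west quadrant, north in a
south-east quadrant, and as given by its sketch path in a north-east quadrant (north in the last
tile). -/
def Entry.want (a : Entry N) (v t : ℕ) : Move :=
  match a.route with
  | .near => .forward
  | .far T p d =>
    if N.InSW T v t then d
    else if ¬ N.InEast T v t then .store
    else if ¬ N.InNorth T v then .forward
    else
      let s := N.tile T v t
      let s₀ := a.req.sourceTile T
      p.getD ((s.1 - s₀.1) + (s.2 - s₀.2)).toNat .forward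

def Entry.InTiling (a : Entry N) (T : Tiling) : Prop :=
  match a.route with
  | .near => False
  | .far T' _ _ => T' = T

def Move.other : Move → Move
  | .store => .forward
  | .forward => .store

open scoped Classical in
/-- Those of the accepted requests of tiling `T` that are in `(v, t)` and want to go in direction
`m`; the ones that have just moved in this direction come first. -/
def queue (acc : List (Entry N)) (loc : Entry N → Location) (T : Tiling) (m : Move) (v t : ℕ) :
    List (Entry N) :=
  let wanting := acc.filter fun b =>
    decide (b.InTiling T ∧ (loc b).map Prod.fst = some v ∧ b.want v t = m)
  (wanting.filter fun b => decide (loc b = some (v, some m))) ++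
    (wanting.filter fun b => decide (loc b ≠ some (v, some m)))

/-- Crossbar routing in the vertex `(v, t)`: a near packet is forwarded; a far packet moves in the
direction in which it wants to go if there is capacity in its track, where packets that go straight
have precedence over packets that turn, and in the other direction otherwise. -/
def crossbar (acc : List (Entry N)) (loc : Entry N → Location) (v t : ℕ) (a : Entry N) : Move :=
  match a.route with
  | .near => .forward
  | .far T _ _ =>
    let m := a.want v t
    if a.idx ∈ ((queue acc loc T m v t).take (N.trackCap m)).map Entry.idx then m else m.other

/-- The locations in step `t` of the accepted packets. -/
def location (acc : List (Entry N)) : ℕ → Entry N → Location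
  | 0, a => if a.req.time = 0 then some (a.req.src, none) else none
  | t + 1, a =>
    if a.req.time = t + 1 then some (a.req.src, none)
    else
      match location acc t a with
      | none => none
      | some (v, _) =>
        let m := crossbar acc (location acc t) v t a
        if m.node v = (a.req.dst : ℕ) then none else some (m.node v, some m)

def Move.toAction : Move → Action
  | .store => .store
  | .forward => .forward

/-- The routing algorithm: packets that are not accepted when they are input are dropped at once;
the accepted ones move as detailed routing says. -/
def routingAlgorithm (N : Network) : OnlineAlgorithm N := fun H t i =>
  let acc := accepted H (t + 1)
  match acc.find? fun a => a.idx = i with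
  | none => .drop
  | some a =>
    match location acc t a with
    | none => .drop
    | some (v, _) => (crossbar acc (location acc t) v t a).toAction

end PacketRouting

end

noncomputable section

namespace PacketRouting

variable {N : Network}

/-! ## Coordinates and quadrants -/

/-! Feasibility and competitiveness are separate arguments; both rest on the exponential weights,
which keep every sketch edge at load at most `k` and keep the total sketch weight linear in the
number of accepted requests.

Feasibility. A south-west quadrant contains only packets that start there and are still on their
initial paths, because tiles are entered from the west into the north-west quadrant and from the
south into the south-east one; initial routing bounds their number, so none is deflected. In any
other quadrant every packet has just moved, hence came over one of two edges whose capacity was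
respected: what does not fit in one direction fits in the other, and a packet going straight keeps
its direction. The danger is that a packet leaves a quadrant on the wrong side. If it wants `m` but
drifts sideways across the whole quadrant, then on every line it crosses the track was filled by
other packets that wanted and got `m`. They are distinct, and quadrants are so long that there are
at least `3k` of them (`exists_blocking_finset`). But the packets of a quadrant that share a wish
are covered by three sketch edges, so there are at most `3k`, the drifting one included
(`card_le_of_sameQuadrant`). Hence packets follow their sketch paths
(`capRespected_and_allOnTrack`). A finite sketch path bounds the sum of the coordinates, which is
the time, so every accepted packet arrives. Five tracks of a fifth of the capacity each fit
together.

Competitiveness. The optimal flow is split by the fate of the requests. Accepted requests carry at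
most one unit each. Requests blocked at their source carry at most `B + c` per source vertex, and
double counting shows that such sources, weighted by `B + c`, are `O(log n)` per accepted request
(`card_mul_le_of_locally_blocked`). Requests refused by path packing are handled by LP duality, with
edge prices on the grid: the edges between two tiles inherit the weight of the sketch edge. Each
acceptance raises the total sketch weight by at most 2, and a tile side has capacity `O(log n)`, so
the prices total `O(log n)` per accepted request.

Refusal speaks only about sketch paths of length at most `p_max`, whereas the flow may use
arbitrarily long paths. A second price deals with these: store edges in heavy columns cost `c/(nB)`.
A path that stores more than about `nB/c` times has either collected cross weight 1/2 already, or at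
each of its stores a shortcut straight north would be a legal sketch path of weight at least 1, of
which the column contributes at least 1/2. Then all these stores lie in heavy columns and together
cost at least 1 (`one_le_sum_price`). Heavy columns are few, since each holds weight 1/2, and each
costs only `O(log n)`. -/

@[simp] theorem Move.other_other (m : Move) : m.other.other = m := by cases m <;> rfl

theorem Move.other_ne (m : Move) : m.other ≠ m := by cases m <;> simp [Move.other]

theorem Move.eq_or_eq_other (m d : Move) : m = d ∨ m = d.other := by
  cases m <;> cases d <;> simp [Move.other]

/-- The coordinate that grows along the moves of the given kind, in the embedding
`(v, t) ↦ (t - v, v)`. -/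
def coord : Move → ℕ → ℕ → ℤ
  | .store, v, t => (t : ℤ) - v
  | .forward, v, _ => v

theorem coord_node_self (m : Move) (v t : ℕ) : coord m (m.node v) (t + 1) = coord m v t + 1 := by
  cases m <;> simp [coord, Move.node]; ring

theorem coord_node_other (m : Move) (v t : ℕ) :
    coord m.other (m.node v) (t + 1) = coord m.other v t := by
  cases m <;> simp [coord, Move.node, Move.other]

theorem coord_le_coord_node (m d : Move) (v t : ℕ) :
    coord m v t ≤ coord m (d.node v) (t + 1) := by
  rcases Move.eq_or_eq_other m d with rfl | rfl
  · rw [coord_node_self]; omega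
  · rw [coord_node_other]

theorem coord_store_add_forward (v t : ℕ) : coord .store v t + coord .forward v t = t := by
  simp [coord]

namespace Network

/-- Half the extent of a tile in the given direction. -/
def half (N : Network) : Move → ℕ
  | .store => N.halfH
  | .forward => N.halfV

/-- The offset of a tiling in the given direction. -/
def offset (N : Network) (T : Tiling) : Move → ℤ
  | .store => N.offsetX T
  | .forward => N.offsetY T

/-- The index of the tile of `(v, t)` in the given direction. -/
def tileIdx (N : Network) (T : Tiling) (m : Move) (v t : ℕ) : ℤ :=
  (coord m v t - N.offset T m) / (2 * N.half m : ℕ)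

/-- The position of `(v, t)` in its tile in the given direction. -/
def posIn (N : Network) (T : Tiling) (m : Move) (v t : ℕ) : ℤ :=
  (coord m v t - N.offset T m) % (2 * N.half m : ℕ)

/-- `(v, t)` lies in the upper half of its tile in the given direction. -/
def Hi (N : Network) (T : Tiling) (m : Move) (v t : ℕ) : Prop :=
  (N.half m : ℤ) ≤ N.posIn T m v t

theorem inEast_iff (T : Tiling) (v t : ℕ) : N.InEast T v t ↔ N.Hi T .store v t := Iff.rfl

theorem inNorth_iff (T : Tiling) (v t : ℕ) : N.InNorth T v ↔ N.Hi T .forward v t := Iff.rfl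

theorem inSW_iff (T : Tiling) (v t : ℕ) :
    N.InSW T v t ↔ ¬ N.Hi T .store v t ∧ ¬ N.Hi T .forward v t := Iff.rfl

theorem inSW_iff_forall (T : Tiling) (v t : ℕ) : N.InSW T v t ↔ ∀ m, ¬ N.Hi T m v t := by
  rw [inSW_iff]
  exact ⟨fun h m => by cases m <;> simp [h.1, h.2], fun h => ⟨h _, h _⟩⟩

theorem inSW_iff_other (T : Tiling) (m : Move) (v t : ℕ) :
    N.InSW T v t ↔ ¬ N.Hi T m v t ∧ ¬ N.Hi T m.other v t := by
  rw [inSW_iff]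
  cases m <;> simp [Move.other, and_comm]

theorem tile_eq (T : Tiling) (v t : ℕ) :
    N.tile T v t = (N.tileIdx T .store v t, N.tileIdx T .forward v t) := rfl

/-- The two vertices lie in the same quadrant of the same tile. -/
def SameQuadrant (N : Network) (T : Tiling) (v t v' t' : ℕ) : Prop :=
  ∀ m, N.tileIdx T m v t = N.tileIdx T m v' t' ∧ (N.Hi T m v t ↔ N.Hi T m v' t')

theorem SameQuadrant.refl (T : Tiling) (v t : ℕ) : N.SameQuadrant T v t v t :=
  fun _ => ⟨rfl, Iff.rfl⟩

theorem SameQuadrant.symm {T : Tiling} {v t v' t' : ℕ} (h : N.SameQuadrant T v t v' t') :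
    N.SameQuadrant T v' t' v t :=
  fun m => ⟨(h m).1.symm, (h m).2.symm⟩

theorem SameQuadrant.trans {T : Tiling} {v t v' t' v'' t'' : ℕ}
    (h : N.SameQuadrant T v t v' t') (h' : N.SameQuadrant T v' t' v'' t'') :
    N.SameQuadrant T v t v'' t'' :=
  fun m => ⟨(h m).1.trans (h' m).1, (h m).2.trans (h' m).2⟩

theorem SameQuadrant.tile {T : Tiling} {v t v' t' : ℕ} (h : N.SameQuadrant T v t v' t') :
    N.tile T v t = N.tile T v' t' := by
  rw [tile_eq, tile_eq, (h .store).1, (h .forward).1]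

theorem posIn_lt (h : ∀ m, 0 < N.half m) (T : Tiling) (m : Move) (v t : ℕ) :
    N.posIn T m v t < 2 * N.half m := by
  have := Int.emod_lt_of_pos (coord m v t - N.offset T m)
    (b := ((2 * N.half m : ℕ) : ℤ)) (by have := h m; positivity)
  unfold posIn; push_cast at this ⊢; exact this

theorem posIn_nonneg (h : ∀ m, 0 < N.half m) (T : Tiling) (m : Move) (v t : ℕ) :
    0 ≤ N.posIn T m v t :=
  Int.emod_nonneg _ (by have := h m; positivity)

theorem posIn_add_mul_tileIdx (T : Tiling) (m : Move) (v t : ℕ) :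
    N.posIn T m v t + 2 * N.half m * N.tileIdx T m v t = coord m v t - N.offset T m := by
  have := Int.emod_add_mul_ediv (coord m v t - N.offset T m) ((2 * N.half m : ℕ) : ℤ)
  unfold posIn tileIdx; push_cast at this ⊢; exact this

theorem tileIdx_posIn_of_eq (h : ∀ m, 0 < N.half m) {T : Tiling} {m : Move} {v t : ℕ} {q r : ℤ}
    (hr : 0 ≤ r) (hr' : r < 2 * N.half m)
    (e : r + 2 * N.half m * q = coord m v t - N.offset T m) :
    N.tileIdx T m v t = q ∧ N.posIn T m v t = r := by
  have hp : (0 : ℤ) < (2 * N.half m : ℕ) := by have := h m; positivity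
  have := (Int.ediv_emod_unique (a := coord m v t - N.offset T m) (r := r) (q := q) hp).2
    ⟨by push_cast; exact e, hr, by push_cast; exact hr'⟩
  exact this

theorem tileIdx_node_other (T : Tiling) (m : Move) (v t : ℕ) :
    N.tileIdx T m.other (m.node v) (t + 1) = N.tileIdx T m.other v t := by
  simp [tileIdx, coord_node_other]

theorem posIn_node_other (T : Tiling) (m : Move) (v t : ℕ) :
    N.posIn T m.other (m.node v) (t + 1) = N.posIn T m.other v t := by
  simp [posIn, coord_node_other]

theorem hi_node_other (T : Tiling) (m : Move) (v t : ℕ) :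
    N.Hi T m.other (m.node v) (t + 1) ↔ N.Hi T m.other v t := by
  simp [Hi, posIn_node_other]

theorem node_self_cases (h : ∀ m, 0 < N.half m) (T : Tiling) (m : Move) (v t : ℕ) :
    (N.tileIdx T m (m.node v) (t + 1) = N.tileIdx T m v t ∧
      N.posIn T m (m.node v) (t + 1) = N.posIn T m v t + 1) ∨
    (N.tileIdx T m (m.node v) (t + 1) = N.tileIdx T m v t + 1 ∧
      N.posIn T m (m.node v) (t + 1) = 0 ∧ N.posIn T m v t = 2 * N.half m - 1) := by
  have h1 := posIn_lt h T m v t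
  have h2 := posIn_nonneg h T m v t
  have h3 := posIn_add_mul_tileIdx (N := N) T m v t
  have h4 := coord_node_self m v t
  have := h m
  by_cases hc : N.posIn T m v t + 1 < 2 * N.half m
  · left
    exact tileIdx_posIn_of_eq h (by omega) hc (by rw [h4]; linarith)
  · right
    have e : N.posIn T m v t = 2 * N.half m - 1 := by omega
    have := tileIdx_posIn_of_eq h (T := T) (m := m) (v := m.node v) (t := t + 1)
      (q := N.tileIdx T m v t + 1) (r := 0) le_rfl (by omega) (by rw [h4]; linarith)
    exact ⟨this.1, this.2, e⟩

/-- The distance of `(v, t)` from the lower side of its quadrant. -/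
def quadPos (N : Network) (T : Tiling) (m : Move) (v t : ℕ) : ℤ :=
  N.posIn T m v t % N.half m

theorem quadPos_cases (h : ∀ m, 0 < N.half m) (T : Tiling) (m : Move) (v t : ℕ) :
    (N.Hi T m v t ∧ N.quadPos T m v t = N.posIn T m v t - N.half m) ∨
    (¬ N.Hi T m v t ∧ N.quadPos T m v t = N.posIn T m v t) := by
  have h1 := posIn_lt h T m v t
  have h2 := posIn_nonneg h T m v t
  unfold quadPos Hi
  by_cases hc : (N.half m : ℤ) ≤ N.posIn T m v t
  · refine .inl ⟨hc, ?_⟩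
    rw [← Int.sub_emod_right, Int.emod_eq_of_lt (by omega) (by omega)]
  · exact .inr ⟨hc, Int.emod_eq_of_lt h2 (by omega)⟩

/-- A move stays in the quadrant, or goes from the lower to the upper half of the tile, or
goes to the next tile. -/
theorem move_cases (h : ∀ m, 0 < N.half m) (T : Tiling) (m : Move) (v t : ℕ) :
    (N.SameQuadrant T v t (m.node v) (t + 1) ∧
      N.quadPos T m (m.node v) (t + 1) = N.quadPos T m v t + 1) ∨
    (N.quadPos T m v t = N.half m - 1 ∧ N.quadPos T m (m.node v) (t + 1) = 0 ∧
      ((¬ N.Hi T m v t ∧ N.Hi T m (m.node v) (t + 1) ∧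
        N.tile T (m.node v) (t + 1) = N.tile T v t) ∨
       (N.Hi T m v t ∧ ¬ N.Hi T m (m.node v) (t + 1) ∧
        N.tile T (m.node v) (t + 1) = m.nextTile (N.tile T v t)))) := by
  have h1 := posIn_lt h T m v t
  have h2 := posIn_nonneg h T m v t
  have hh := h m
  have ht : ∀ x, N.tileIdx T m (m.node v) (t + 1) = x →
      N.tile T (m.node v) (t + 1) =
        match m with
        | .store => (x, (N.tile T v t).2)
        | .forward => ((N.tile T v t).1, x) := by
    intro x hx
    have := tileIdx_node_other (N := N) T m v t
    cases m <;> simp_all [tile_eq, Move.other]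
  rcases node_self_cases h T m v t with ⟨e1, e2⟩ | ⟨e1, e2, e3⟩
  · rcases quadPos_cases h T m v t with ⟨q1, q2⟩ | ⟨q1, q2⟩ <;>
    rcases quadPos_cases h T m (m.node v) (t + 1) with ⟨q3, q4⟩ | ⟨q3, q4⟩
    · refine .inl ⟨fun d => ?_, by omega⟩
      rcases Move.eq_or_eq_other d m with rfl | rfl
      · simp [e1, q1, q3]
      · simp [tileIdx_node_other, hi_node_other]
    · unfold Hi at q1 q3; omega
    · refine .inr ⟨by unfold Hi at q1 q3; omega, by unfold Hi at q1 q3; omega, .inl ⟨q1, q3, ?_⟩⟩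
      rw [ht _ e1]; cases m <;> rfl
    · refine .inl ⟨fun d => ?_, by omega⟩
      rcases Move.eq_or_eq_other d m with rfl | rfl
      · simp [e1, q1, q3]
      · simp [tileIdx_node_other, hi_node_other]
  · have q1 : N.Hi T m v t := by unfold Hi; omega
    have q3 : ¬ N.Hi T m (m.node v) (t + 1) := by unfold Hi; omega
    have q2 := quadPos_cases h T m v t
    have q4 := quadPos_cases h T m (m.node v) (t + 1)
    simp only [q1, q3, not_true, not_false_iff, true_and, false_and, or_false, false_or] at q2 q4
    refine .inr ⟨by omega, by omega, .inr ⟨q1, q3, ?_⟩⟩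
    rw [ht _ e1]; cases m <;> rfl

end Network

/-! ## Walks in the sketch graph -/

/-- The tile that the moves `w` lead to from tile `s`. -/
def walk (s : ℤ × ℤ) (w : List Move) : ℤ × ℤ := w.foldl Move.nextTile s

@[simp] theorem walk_nil (s : ℤ × ℤ) : walk s [] = s := rfl

@[simp] theorem walk_cons (s : ℤ × ℤ) (m : Move) (w : List Move) :
    walk s (m :: w) = walk (m.nextTile s) w := rfl

theorem walk_append (s : ℤ × ℤ) (w w' : List Move) : walk s (w ++ w') = walk (walk s w) w' :=
  List.foldl_append

theorem walk_eq (s : ℤ × ℤ) (w : List Move) :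
    walk s w = (s.1 + w.count .store, s.2 + w.count .forward) := by
  induction w generalizing s with
  | nil => simp
  | cons m w ih =>
    rw [walk_cons, ih]
    cases m <;> simp [Move.nextTile] <;> ring

theorem count_store_add_forward (w : List Move) : w.count .store + w.count .forward = w.length := by
  induction w with
  | nil => rfl
  | cons m w ih => cases m <;> simp <;> omega

/-- Each move raises the sum of the tile indices by one. The number of sketch moves already made can
thus be read off from the current tile, which is how `Entry.want` finds the next one. -/
theorem walk_sub (s : ℤ × ℤ) (w : List Move) :
    ((walk s w).1 - s.1) + ((walk s w).2 - s.2) = w.length := by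
  rw [walk_eq, ← count_store_add_forward w]; push_cast; ring

theorem sketchEdges_append (s : ℤ × ℤ) (w w' : List Move) :
    sketchEdges s (w ++ w') = sketchEdges s w ++ sketchEdges (walk s w) w' := by
  induction w generalizing s with
  | nil => rfl
  | cons m w ih => simp [sketchEdges, ih]

theorem mem_sketchEdges_of_getElem? {s : ℤ × ℤ} {w : List Move} {j : ℕ} {m : Move}
    (h : w[j]? = some m) : (walk s (w.take j), m) ∈ sketchEdges s w := by
  obtain ⟨hj, e⟩ := List.getElem?_eq_some_iff.1 h
  have : w = w.take j ++ m :: w.drop (j + 1) := by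
    rw [← e, ← List.drop_eq_getElem_cons hj, List.take_append_drop]
  rw [(congrArg (sketchEdges s) this).trans (sketchEdges_append _ _ _)]
  simp [sketchEdges]

/-- The tile from which `s` is reached by the given move. -/
def Move.prevTile (s : ℤ × ℤ) : Move → ℤ × ℤ
  | .store => (s.1 - 1, s.2)
  | .forward => (s.1, s.2 - 1)

theorem Move.nextTile_eq_iff (m : Move) (s s' : ℤ × ℤ) : m.nextTile s = s' ↔ s = m.prevTile s' := by
  cases m <;> simp [Move.nextTile, Move.prevTile, Prod.ext_iff] <;> omega

theorem walk_take_succ {s : ℤ × ℤ} {w : List Move} {j : ℕ} {m : Move} (h : w[j]? = some m) :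
    walk s (w.take (j + 1)) = m.nextTile (walk s (w.take j)) := by
  rw [List.take_add_one, h, walk_append]; rfl

theorem mem_sketchEdges_prev {s : ℤ × ℤ} {w : List Move} {j : ℕ} {m : Move} (hj : 0 < j)
    (h : w[j - 1]? = some m) : (m.prevTile (walk s (w.take j)), m) ∈ sketchEdges s w := by
  have := walk_take_succ (s := s) h
  rw [Nat.sub_add_cancel hj, eq_comm, Move.nextTile_eq_iff] at this
  rw [← this]
  exact mem_sketchEdges_of_getElem? h

/-! ## Locations -/

theorem location_eq_none_of_lt {acc : List (Entry N)} {t : ℕ} {a : Entry N} (h : t < a.req.time) :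
    location acc t a = none := by
  induction t with
  | zero => simp [location, h.ne']
  | succ t ih => simp [location, h.ne', ih (by omega)]

theorem location_time (acc : List (Entry N)) (a : Entry N) :
    location acc a.req.time a = some ((a.req.src : ℕ), none) := by
  generalize h : a.req.time = t
  cases t <;> simp [location, h]

theorem location_succ {acc : List (Entry N)} {t : ℕ} {a : Entry N} {v : ℕ} {o : Option Move}
    (h : location acc t a = some (v, o)) :
    location acc (t + 1) a =
      if (crossbar acc (location acc t) v t a).node v = (a.req.dst : ℕ) then none
      else some ((crossbar acc (location acc t) v t a).node v,
        some (crossbar acc (location acc t) v t a)) := by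
  have ht : a.req.time ≠ t + 1 := by
    intro e
    rw [location_eq_none_of_lt (by omega)] at h
    simp at h
  simp [location, ht, h]

theorem location_some_cases {acc : List (Entry N)} {t : ℕ} {a : Entry N} {v : ℕ} {o : Option Move}
    (h : location acc t a = some (v, o)) :
    (a.req.time = t ∧ v = a.req.src ∧ o = none) ∨
    ∃ s v' o', t = s + 1 ∧ location acc s a = some (v', o') ∧
      v = (crossbar acc (location acc s) v' s a).node v' ∧
      o = some (crossbar acc (location acc s) v' s a) ∧ v ≠ a.req.dst := by
  by_cases ht : a.req.time = t
  · subst ht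
    rw [location_time] at h
    simp only [Option.some.injEq, Prod.mk.injEq] at h
    exact .inl ⟨rfl, h.1.symm, h.2.symm⟩
  · right
    cases t with
    | zero => simp [location, ht] at h
    | succ s =>
      cases hl : location acc s a with
      | none => simp [location, ht, hl] at h
      | some q =>
        obtain ⟨v', o'⟩ := q
        rw [location_succ hl] at h
        split_ifs at h with hd
        simp only [Option.some.injEq, Prod.mk.injEq] at h
        exact ⟨s, v', o', rfl, hl, h.1.symm, h.2.symm, h.1 ▸ hd⟩

theorem time_le_of_location {acc : List (Entry N)} {t : ℕ} {a : Entry N} {q : ℕ × Option Move}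
    (h : location acc t a = some q) : a.req.time ≤ t := by
  by_contra hc
  rw [location_eq_none_of_lt (by omega)] at h
  simp at h

/-- A move advances by at most one node and a packet is removed on reaching its destination, so the
destination cannot be jumped over. -/
theorem lt_dst_of_location {acc : List (Entry N)} {a : Entry N} (hsd : a.req.src < a.req.dst)
    {t v : ℕ} {o : Option Move} (h : location acc t a = some (v, o)) : v < a.req.dst := by
  induction t generalizing v o with
  | zero =>
    rcases location_some_cases h with ⟨-, rfl, -⟩ | ⟨s, _, _, hs, _⟩
    · exact hsd
    · omega
  | succ t ih =>
    rcases location_some_cases h with ⟨-, rfl, -⟩ | ⟨s, v', o', hs, hl, e, -, hd⟩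
    · exact hsd
    · obtain rfl : t = s := by omega
      have := ih hl
      have h2 : v ≤ v' + 1 := by
        rw [e]; cases crossbar acc (location acc t) v' t a <;> simp [Move.node]
      omega

theorem coord_le_of_location {acc : List (Entry N)} {a : Entry N} (m : Move) {t t' v v' : ℕ}
    {o o' : Option Move} (htt : t ≤ t') (h : location acc t a = some (v, o))
    (h' : location acc t' a = some (v', o')) : coord m v t ≤ coord m v' t' := by
  induction t', htt using Nat.le_induction generalizing v' o' with
  | base => rw [h] at h'; simp_all
  | succ t' htt ih =>
    rcases location_some_cases h' with ⟨e, -, -⟩ | ⟨s, v'', o'', hs, hl, e, -, -⟩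
    · have := time_le_of_location h
      omega
    · obtain rfl : t' = s := by omega
      rw [e]
      exact (ih hl).trans (coord_le_coord_node _ _ _ _)

/-- A packet that moved in direction `m` has left the current line. -/
theorem coord_lt_of_moved {acc : List (Entry N)} {a : Entry N} {m : Move} {t t' v v' : ℕ}
    {o o' : Option Move} (htt : t < t') (h : location acc t a = some (v, o))
    (hm : crossbar acc (location acc t) v t a = m)
    (h' : location acc t' a = some (v', o')) : coord m v t < coord m v' t' := by
  cases hn : location acc (t + 1) a with
  | none =>
    -- A packet that has left the network does not return, so presence at `t'` rules out delivery
    -- right after step `t`.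
    exfalso
    have : ∀ s, t + 1 ≤ s → location acc s a = none := by
      intro s hs
      induction s, hs using Nat.le_induction with
      | base => exact hn
      | succ s hs ih =>
        have := time_le_of_location h
        simp [location, ih, show a.req.time ≠ s + 1 by omega]
    rw [this t' htt] at h'
    simp at h'
  | some q =>
    obtain ⟨v'', o''⟩ := q
    have h1 := coord_le_of_location m (show t + 1 ≤ t' from htt) hn h'
    rw [location_succ h, hm] at hn
    split_ifs at hn
    simp only [Option.some.injEq, Prod.mk.injEq] at hn
    rw [← hn.1, coord_node_self] at h1
    omega

/-! ## The crossbar -/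

theorem Entry.inTiling_iff {a : Entry N} {T : Tiling} :
    a.InTiling T ↔ ∃ p d, a.route = .far T p d := by
  unfold Entry.InTiling
  cases h : a.route <;> simp

open scoped Classical in
theorem mem_queue {acc : List (Entry N)} {loc : Entry N → Location} {T : Tiling} {m : Move}
    {v t : ℕ} {b : Entry N} :
    b ∈ queue acc loc T m v t ↔
      b ∈ acc ∧ b.InTiling T ∧ (∃ o, loc b = some (v, o)) ∧ b.want v t = m := by
  have : (loc b).map Prod.fst = some v ↔ ∃ o, loc b = some (v, o) := by
    cases h : loc b with
    | none => simp
    | some q => obtain ⟨v', o⟩ := q; simp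
  simp only [queue, List.mem_append, List.mem_filter, decide_eq_true_eq, this]
  tauto

open scoped Classical in
theorem queue_perm (acc : List (Entry N)) (loc : Entry N → Location) (T : Tiling) (m : Move)
    (v t : ℕ) : (queue acc loc T m v t).Perm (acc.filter fun b =>
      decide (b.InTiling T ∧ (loc b).map Prod.fst = some v ∧ b.want v t = m)) := by
  have := List.filter_append_perm (fun b => decide (loc b = some (v, some m)))
    (acc.filter fun b => decide (b.InTiling T ∧ (loc b).map Prod.fst = some v ∧ b.want v t = m))
  simpa [queue] using this

theorem nodup_of_idx {acc : List (Entry N)} (h : (acc.map Entry.idx).Nodup) : acc.Nodup :=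
  List.Nodup.of_map _ h

theorem eq_of_idx_eq {acc : List (Entry N)} (h : (acc.map Entry.idx).Nodup) {a b : Entry N}
    (ha : a ∈ acc) (hb : b ∈ acc) (e : a.idx = b.idx) : a = b :=
  List.inj_on_of_nodup_map h ha hb e

theorem queue_nodup {acc : List (Entry N)} (h : (acc.map Entry.idx).Nodup)
    (loc : Entry N → Location) (T : Tiling) (m : Move) (v t : ℕ) :
    (queue acc loc T m v t).Nodup :=
  (queue_perm acc loc T m v t).nodup_iff.2 ((nodup_of_idx h).filter _)

/-- The algorithm compares packet numbers; these are distinct among accepted requests, so the test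
is membership of the entry itself. -/
theorem crossbar_far {acc : List (Entry N)} (h : (acc.map Entry.idx).Nodup)
    {loc : Entry N → Location} {T : Tiling} {v t : ℕ} {a : Entry N} (ha : a ∈ acc)
    (hT : a.InTiling T) [Decidable
      (a ∈ (queue acc loc T (a.want v t) v t).take (N.trackCap (a.want v t)))] :
    crossbar acc loc v t a =
      if a ∈ (queue acc loc T (a.want v t) v t).take (N.trackCap (a.want v t)) then a.want v t
      else (a.want v t).other := by
  obtain ⟨p, d, hr⟩ := Entry.inTiling_iff.1 hT
  have : a.idx ∈ ((queue acc loc T (a.want v t) v t).take (N.trackCap (a.want v t))).map Entry.idx ↔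
      a ∈ (queue acc loc T (a.want v t) v t).take (N.trackCap (a.want v t)) := by
    constructor
    · intro hi
      obtain ⟨b, hb, e⟩ := List.mem_map.1 hi
      have := eq_of_idx_eq h (mem_queue.1 (List.mem_of_mem_take hb)).1 ha e
      exact this ▸ hb
    · exact List.mem_map_of_mem
  unfold crossbar
  rw [hr]
  simp only [this]

/-- A packet that goes straight is not deflected. -/
theorem mem_take_queue_of_straight {acc : List (Entry N)} {loc : Entry N → Location} {T : Tiling}
    {m : Move} {v t : ℕ} {a : Entry N} (ha : a ∈ queue acc loc T m v t)
    (hs : loc a = some (v, some m)) {S : Finset (Entry N)} {q : ℕ} (hq : S.card ≤ q)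
    (hn : acc.Nodup)
    (hS : ∀ b ∈ acc, b.InTiling T → loc b = some (v, some m) → b ∈ S) :
    a ∈ (queue acc loc T m v t).take q := by
  classical
  set W := acc.filter fun b =>
    decide (b.InTiling T ∧ (loc b).map Prod.fst = some v ∧ b.want v t = m) with hW
  set Q₁ := W.filter fun b => decide (loc b = some (v, some m)) with hQ₁
  have hQ : queue acc loc T m v t = Q₁ ++ W.filter fun b => decide (loc b ≠ some (v, some m)) := by
    simp only [queue, hQ₁, hW]
  -- All packets that go straight lie in `S`, so this first block of the queue is not cut by `take
  -- q`.
  have h1 : Q₁.length ≤ q := by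
    rw [← List.toFinset_card_of_nodup ((hn.filter _).filter _)]
    refine (Finset.card_le_card fun b hb => ?_).trans hq
    simp only [List.mem_toFinset, List.mem_filter, decide_eq_true_eq] at hb
    exact hS b hb.1.1 hb.1.2.1 hb.2
  have h2 : a ∈ Q₁ := by
    rw [mem_queue] at ha
    simp only [hQ₁, hW, List.mem_filter, decide_eq_true_eq, hs]
    simp [ha]
  rw [hQ, List.take_append]
  exact List.mem_append_left _ (by rwa [List.take_of_length_le h1])

/-! ## Detailed routing -/

/-- The properties of the list of accepted requests on which detailed routing relies. -/
structure Admissible (acc : List (Entry N)) : Prop where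
  nodup : (acc.map Entry.idx).Nodup
  src_lt : ∀ a ∈ acc, a.req.src < a.req.dst
  far_sw : ∀ a ∈ acc, ∀ T p d, a.route = .far T p d → N.InSW T a.req.src a.req.time
  far_sketch : ∀ a ∈ acc, ∀ T p d, a.route = .far T p d →
    N.tileRow T a.req.src + p.count .forward = N.tileRow T a.req.dst
  far_ne_nil : ∀ a ∈ acc, ∀ T p d, a.route = .far T p d → p ≠ []
  sketchLoad_le : ∀ T e, (sketchLoad acc T e : ℝ) ≤ N.k
  initLoad_le : ∀ T e, initLoad acc T e ≤ N.trackCap e.2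
  nearLoad_le : ∀ e, nearLoad acc e ≤ N.trackC

/-- The tiles are large enough for the tracks. -/
structure Network.Roomy (N : Network) : Prop where
  half_pos : ∀ m, 0 < N.half m
  room : ∀ m, 3 * N.k ≤ (N.half m.other * N.trackCap m : ℕ)

theorem mem_pathEdges_replicate {v t L : ℕ} {d : Move} {e : STEdge} :
    e ∈ pathEdges v t (List.replicate L d) ↔ ∃ i < L, e = ((d.node^[i] v, t + i), d) := by
  induction L generalizing v t with
  | zero => simp [pathEdges]
  | succ L ih =>
    simp only [List.replicate_succ, pathEdges, List.mem_cons, ih]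
    constructor
    · rintro (rfl | ⟨i, hi, rfl⟩)
      · exact ⟨0, by omega, rfl⟩
      · exact ⟨i + 1, by omega, by simp [Nat.add_assoc, Nat.add_comm 1]⟩
    · rintro ⟨i, hi, rfl⟩
      cases i with
      | zero => exact .inl rfl
      | succ i => exact .inr ⟨i, by omega, by simp [Nat.add_assoc, Nat.add_comm 1]⟩

theorem Request.initPath_eq (r : Request N) (T : Tiling) (d : Move) :
    r.initPath T d =
      List.replicate (N.half d - N.posIn T d r.src r.time).toNat d := by
  cases d <;> rfl

/-! ### Blocking packets, and the sketch edges that bound their number. -/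

section

variable {acc : List (Entry N)}

open scoped Classical in
/-- The packets of tiling `T` that are in `(v, t)`. -/
def atVertex (acc : List (Entry N)) (T : Tiling) (v t : ℕ) : Finset (Entry N) :=
  acc.toFinset.filter fun b => b.InTiling T ∧ ∃ o, location acc t b = some (v, o)

open scoped Classical in
/-- The packets of tiling `T` that leave `(v, t)` in direction `m`. -/
def movers (acc : List (Entry N)) (T : Tiling) (m : Move) (v t : ℕ) : Finset (Entry N) :=
  (atVertex acc T v t).filter fun b => crossbar acc (location acc t) v t b = m

theorem mem_atVertex {T : Tiling} {v t : ℕ} {b : Entry N} :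
    b ∈ atVertex acc T v t ↔ b ∈ acc ∧ b.InTiling T ∧ ∃ o, location acc t b = some (v, o) := by
  classical
  simp [atVertex]

theorem mem_movers {T : Tiling} {m : Move} {v t : ℕ} {b : Entry N} :
    b ∈ movers acc T m v t ↔ (b ∈ acc ∧ b.InTiling T ∧ ∃ o, location acc t b = some (v, o)) ∧
      crossbar acc (location acc t) v t b = m := by
  classical
  simp [movers, mem_atVertex]

/-- In step `t` the capacities of the tracks of the tilings are respected. -/
def CapRespected (acc : List (Entry N)) (t : ℕ) : Prop :=
  ∀ T m v, (movers acc T m v t).card ≤ N.trackCap m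

/-- There is room for the packets that go straight. -/
theorem exists_straight_finset {t : ℕ} (hcap : ∀ s < t, CapRespected acc s) (T : Tiling) (m : Move)
    (v : ℕ) : ∃ S : Finset (Entry N), S.card ≤ N.trackCap m ∧
      ∀ b ∈ acc, b.InTiling T → location acc t b = some (v, some m) → b ∈ S := by
  -- A packet whose last move was `m` came over the only edge entering the vertex in direction `m`,
  -- so it was among the movers at the tail `v'` one step earlier.
  have key : ∀ s v', t = s + 1 → (∀ v'', m.node v'' = v → v'' = v') →
      ∃ S : Finset (Entry N), S.card ≤ N.trackCap m ∧
      ∀ b ∈ acc, b.InTiling T → location acc t b = some (v, some m) → b ∈ S := by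
    rintro s v' rfl hv'
    refine ⟨movers acc T m v' s, hcap s (by omega) T m v', fun b hb hT hl => ?_⟩
    rcases location_some_cases hl with ⟨-, -, h⟩ | ⟨s', v'', o'', hs, hl', e, h, -⟩
    · simp at h
    · obtain rfl : s = s' := by omega
      simp only [Option.some.injEq] at h
      rw [← h] at e
      obtain rfl := hv' v'' e.symm
      exact mem_movers.2 ⟨⟨hb, hT, o'', hl'⟩, h.symm⟩
  cases t with
  | zero =>
    refine ⟨∅, by simp, fun b hb hT hl => ?_⟩
    rcases location_some_cases hl with ⟨-, -, h⟩ | ⟨s', v'', o'', hs, _⟩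
    · simp at h
    · omega
  | succ s =>
    cases m with
    | store => exact key s v rfl (by simp [Move.node])
    -- For `v = 0` the truncated subtraction is harmless: no forward move ends in node 0.
    | forward => exact key s (v - 1) rfl (by simp only [Move.node]; omega)

/-- Wishes depend on the position only through the quadrant. They stay fixed while a packet crosses
a quadrant, so the blocking argument can follow it back in time. -/
theorem Entry.want_congr {a : Entry N} {T : Tiling} (hT : a.InTiling T) {v t v' t' : ℕ}
    (h : N.SameQuadrant T v t v' t') : a.want v t = a.want v' t' := by
  obtain ⟨p, d, hr⟩ := Entry.inTiling_iff.1 hT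
  have h1 : N.InEast T v t ↔ N.InEast T v' t' := (h .store).2
  have h2 : N.InNorth T v ↔ N.InNorth T v' := (h .forward).2
  simp only [Entry.want, hr, Network.InSW, h.tile]
  by_cases e : N.InEast T v t <;> by_cases n : N.InNorth T v <;>
    simp [e, n, h1.symm, h2.symm]

theorem Entry.want_sw {a : Entry N} {T : Tiling} {p : List Move} {d : Move}
    (hr : a.route = .far T p d) {v t : ℕ} (h : N.InSW T v t) : a.want v t = d := by
  simp [Entry.want, hr, h]

theorem Entry.want_mixed {a : Entry N} {T : Tiling} (hT : a.InTiling T) {m : Move} {v t : ℕ}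
    (h : ¬ N.Hi T m v t) (h' : N.Hi T m.other v t) : a.want v t = m := by
  obtain ⟨p, d, hr⟩ := Entry.inTiling_iff.1 hT
  cases m <;> simp only [Move.other] at h' <;>
    simp [Entry.want, hr, Network.inSW_iff, Network.inEast_iff, Network.inNorth_iff T v t, h, h']

theorem Entry.want_ne {a : Entry N} {T : Tiling} {p : List Move} {d : Move}
    (hr : a.route = .far T p d) {v t j : ℕ} (hj : j ≤ p.length) (h : ∀ m, N.Hi T m v t)
    (ht : N.tile T v t = walk (a.req.sourceTile T) (p.take j)) :
    a.want v t = p.getD j .forward := by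
  have := walk_sub (a.req.sourceTile T) (p.take j)
  simp only [Entry.want, hr, Network.inSW_iff, Network.inEast_iff, Network.inNorth_iff T v t, h,
    not_true, false_and, if_false, ht, this, List.length_take, min_eq_left hj, Int.toNat_natCast]

/-- Only a packet that has just been input has no last move, and far requests start in a south-west
quadrant of their tiling. Elsewhere every packet has come over one of two edges. -/
theorem inSW_of_location_none (hacc : Admissible acc) {a : Entry N} (ha : a ∈ acc) {T : Tiling}
    (hT : a.InTiling T) {v t : ℕ} (h : location acc t a = some (v, none)) : N.InSW T v t := by
  obtain ⟨p, d, hr⟩ := Entry.inTiling_iff.1 hT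
  rcases location_some_cases h with ⟨rfl, rfl, -⟩ | ⟨_, _, _, _, _, _, h, _⟩
  · exact hacc.far_sw a ha T p d hr
  · simp at h

/-- If a packet is deflected from direction `m`, then so it was since it entered its quadrant, and
each time the track was used up by other packets. -/
theorem exists_blocking_finset (hacc : Admissible acc) (hN : ∀ m, 0 < N.half m)
    {a : Entry N} (ha : a ∈ acc) {T : Tiling} (hT : a.InTiling T) {m : Move} {t v : ℕ}
    {o : Option Move} (hcap : ∀ s < t, CapRespected acc s) (hsw : ¬ N.InSW T v t)
    (hloc : location acc t a = some (v, o)) (hw : a.want v t = m)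
    (hdef : crossbar acc (location acc t) v t a = m.other) :
    ∃ D : Finset (Entry N), (N.quadPos T m.other v t + 1) * N.trackCap m ≤ D.card ∧
      ∀ b ∈ D, b ∈ acc ∧ b.InTiling T ∧ ∃ t' ≤ t, ∃ v' o', location acc t' b = some (v', o') ∧
        N.SameQuadrant T v t v' t' ∧ b.want v' t' = m ∧ coord m v' t' = coord m v t ∧
        crossbar acc (location acc t') v' t' b = m := by
  classical
  induction t generalizing v o with
  | zero =>
    rcases location_some_cases hloc with ⟨-, -, rfl⟩ | ⟨s', v'', o'', hs, _⟩
    · exact absurd (inSW_of_location_none hacc ha hT hloc) hsw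
    · omega
  | succ t ih =>
    set Q := queue acc (location acc (t + 1)) T m v (t + 1) with hQ
    have haQ : a ∈ Q := mem_queue.2 ⟨ha, hT, ⟨o, hloc⟩, hw⟩
    have hcb : ∀ b ∈ acc, b.InTiling T → b.want v (t + 1) = m →
        crossbar acc (location acc (t + 1)) v (t + 1) b =
          if b ∈ Q.take (N.trackCap m) then m else m.other := by
      rintro b hb hbT rfl
      exact crossbar_far hacc.nodup hb hbT
    -- The deflected packet found the first `trackCap m` places of the queue taken; their holders,
    -- `D₀`, are the blockers in this vertex.
    have hnot : a ∉ Q.take (N.trackCap m) := by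
      intro h
      rw [hcb a ha hT hw, if_pos h] at hdef
      exact m.other_ne hdef.symm
    have hlen : N.trackCap m ≤ Q.length := by
      by_contra hc
      rw [List.take_of_length_le (by omega)] at hnot
      exact hnot haQ
    have hQn : (Q.take (N.trackCap m)).Nodup := (queue_nodup hacc.nodup _ T m v (t + 1)).take
    set D₀ := (Q.take (N.trackCap m)).toFinset with hD₀
    have hD₀c : D₀.card = N.trackCap m := by
      rw [hD₀, List.toFinset_card_of_nodup hQn, List.length_take, min_eq_left hlen]
    have hD₀m : ∀ b ∈ D₀, b ∈ acc ∧ b.InTiling T ∧ ∃ o', location acc (t + 1) b = some (v, o') ∧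
        b.want v (t + 1) = m ∧ crossbar acc (location acc (t + 1)) v (t + 1) b = m := by
      intro b hb
      rw [hD₀, List.mem_toFinset] at hb
      obtain ⟨h1, h2, ⟨o', h3⟩, h4⟩ := mem_queue.1 (List.mem_of_mem_take hb)
      exact ⟨h1, h2, o', h3, h4, by rw [hcb b h1 h2 h4, if_pos hb]⟩
    have hDall : ∀ b ∈ D₀, b ∈ acc ∧ b.InTiling T ∧ ∃ t' ≤ t + 1, ∃ v' o',
        location acc t' b = some (v', o') ∧
        N.SameQuadrant T v (t + 1) v' t' ∧ b.want v' t' = m ∧ coord m v' t' = coord m v (t + 1) ∧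
        crossbar acc (location acc t') v' t' b = m := by
      intro b hb
      obtain ⟨h1, h2, o', h3, h4, h5⟩ := hD₀m b hb
      exact ⟨h1, h2, t + 1, le_rfl, v, o', h3, .refl T v (t + 1), h4, rfl, h5⟩
    rcases location_some_cases hloc with ⟨-, -, rfl⟩ | ⟨s', v'', o'', hs, hl, e, ho, -⟩
    · exact absurd (inSW_of_location_none hacc ha hT hloc) hsw
    obtain rfl : t = s' := by omega
    -- A last move in direction `m` would make the packet go straight, with precedence. So it moved
    -- sideways in the previous step as well.
    have hmo : crossbar acc (location acc t) v'' t a = m.other := by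
      rcases Move.eq_or_eq_other (crossbar acc (location acc t) v'' t a) m with h | h
      · exfalso
        rw [h] at ho
        obtain ⟨S, hS, hS'⟩ := exists_straight_finset hcap T m v
        exact hnot (mem_take_queue_of_straight haQ (ho ▸ hloc) hS (nodup_of_idx hacc.nodup) hS')
      · exact h
    rw [hmo] at e
    -- Either the previous vertex lies in the same quadrant, where the packet was deflected too and
    -- the induction hypothesis applies, or the quadrant has just been entered and `D₀` alone
    -- suffices.
    rcases Network.move_cases hN T m.other v'' t with ⟨hq, hp⟩ | ⟨-, hp, -⟩
    · rw [← e] at hq hp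
      have hsw' : ¬ N.InSW T v'' t := by
        rw [Network.inSW_iff] at hsw ⊢
        rwa [(hq .store).2, (hq .forward).2]
      obtain ⟨D, hD, hD'⟩ := ih (fun s hs => hcap s (by omega)) hsw' hl
        ((Entry.want_congr hT hq).trans hw) hmo
      have hco : coord m v'' t = coord m v (t + 1) := by
        have := coord_node_other m.other v'' t
        rw [Move.other_other, ← e] at this
        exact this.symm
      refine ⟨D ∪ D₀, ?_, ?_⟩
      · rw [Finset.card_union_of_disjoint, hD₀c, hp]
        · push_cast
          linarith
        -- Earlier blockers have moved in direction `m`, so their `m`-coordinate now exceeds that of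
        -- the deflected packet, which has not changed.
        · rw [Finset.disjoint_left]
          intro b hb hb0
          obtain ⟨-, -, t', ht', v', o', h1, -, -, h2, h3⟩ := hD' b hb
          obtain ⟨-, -, o₁, h4, -⟩ := hD₀m b hb0
          have := coord_lt_of_moved (show t' < t + 1 by omega) h1 h3 h4
          omega
      · intro b hb
        rcases Finset.mem_union.1 hb with hb | hb
        · obtain ⟨h1, h2, t', ht', v', o', h3, h4, h5, h6, h7⟩ := hD' b hb
          exact ⟨h1, h2, t', by omega, v', o', h3, hq.symm.trans h4, h5, h6.trans hco, h7⟩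
        · exact hDall b hb
    · rw [← e] at hp
      exact ⟨D₀, by rw [hp, hD₀c]; simp, hDall⟩

/-- The packet of `a` is in `(v, t)` in accordance with its sketch path and initial path. -/
def OnTrack (a : Entry N) (v t : ℕ) : Prop :=
  ∀ T p d, a.route = .far T p d → ∃ j ≤ p.length,
    N.tile T v t = walk (a.req.sourceTile T) (p.take j) ∧
    (N.InSW T v t → j = 0 ∧ ∃ i, v = d.node^[i] a.req.src ∧ t = a.req.time + i ∧
      N.posIn T d v t = N.posIn T d a.req.src a.req.time + i) ∧
    ∀ m, ¬ N.Hi T m v t → N.Hi T m.other v t → j = 0 ∨ p[j - 1]? = some m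

/-- In step `t` all packets are on track. -/
def AllOnTrack (acc : List (Entry N)) (t : ℕ) : Prop :=
  ∀ a ∈ acc, ∀ v o, location acc t a = some (v, o) → OnTrack a v t

/-- The sketch path of `b` uses `e`. -/
def UsesEdge (b : Entry N) (T : Tiling) (e : SketchEdge) : Prop :=
  ∃ p d, b.route = .far T p d ∧ e ∈ sketchEdges (b.req.sourceTile T) p

open scoped Classical in
/-- The requests whose sketch path uses `e`. -/
def users (acc : List (Entry N)) (T : Tiling) (e : SketchEdge) : Finset (Entry N) :=
  acc.toFinset.filter fun b => UsesEdge b T e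

theorem countP_eq_card_filter {α : Type*} [DecidableEq α] {l : List α} (hl : l.Nodup)
    (p : α → Bool) (q : α → Prop) [DecidablePred q] (h : ∀ a, p a = true ↔ q a) :
    l.countP p = (l.toFinset.filter q).card := by
  rw [List.countP_eq_length_filter, ← List.toFinset_card_of_nodup (hl.filter p)]
  congr 1
  ext a
  simp [h]

theorem card_users (hacc : (acc.map Entry.idx).Nodup) (T : Tiling) (e : SketchEdge) :
    (users acc T e).card = sketchLoad acc T e := by
  classical
  unfold sketchLoad users
  rw [countP_eq_card_filter (nodup_of_idx hacc) _ (fun b => UsesEdge b T e)]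
  intro a
  unfold UsesEdge
  cases h : a.route with
  | near => simp
  | far T' p d => grind

/-- Each such packet has a sketch path through one of three edges at the tile, and each edge has
load at most `k`. This is the source of the factor 3 in the tile size. In a north-east quadrant the
edges are the outgoing one in direction `m` and, for packets in their last tile, the two incoming
ones. In a mixed quadrant they are the incoming edge through which that quadrant is entered from
outside and, for packets that started in this tile, the two outgoing ones. -/
theorem card_le_of_sameQuadrant (hacc : Admissible acc) {T : Tiling} {v t : ℕ} {m : Move}
    (hsw : ¬ N.InSW T v t) (D : Finset (Entry N))
    (hD : ∀ b ∈ D, b ∈ acc ∧ b.InTiling T ∧ ∃ v' t', OnTrack b v' t' ∧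
        N.SameQuadrant T v t v' t' ∧ b.want v' t' = m) :
    (D.card : ℝ) ≤ 3 * N.k := by
  classical
  have key : ∃ e₁ e₂ e₃, D ⊆ users acc T e₁ ∪ users acc T e₂ ∪ users acc T e₃ := by
    set s := N.tile T v t with hs
    have hu : ∀ b ∈ acc, ∀ p d e, b.route = .far T p d → e ∈ sketchEdges (b.req.sourceTile T) p →
        b ∈ users acc T e := fun b hb p d e hr he => by
      simp only [users, Finset.mem_filter, List.mem_toFinset]
      exact ⟨hb, p, d, hr, he⟩
    by_cases hne : ∀ m, N.Hi T m v t
    · refine ⟨(s, m), (Move.prevTile s .store, .store), (Move.prevTile s .forward, .forward),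
        fun b hb => ?_⟩
      obtain ⟨hb, hT, v', t', hon, hq, hw⟩ := hD b hb
      obtain ⟨p, d, hr⟩ := Entry.inTiling_iff.1 hT
      obtain ⟨j, hj, htile, -, -⟩ := hon T p d hr
      rw [Entry.want_ne hr hj (fun m => ((hq m).2).1 (hne m)) htile] at hw
      rw [← hq.tile, ← hs] at htile
      rcases hj.lt_or_eq with hj | rfl
      · have : p[j]? = some m := by
          rw [List.getD_eq_getElem?_getD, List.getElem?_eq_getElem hj] at hw
          rw [List.getElem?_eq_getElem hj]
          simpa using hw
        have := mem_sketchEdges_of_getElem? (s := b.req.sourceTile T) this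
        rw [← htile] at this
        simp [hu b hb p d _ hr this]
      -- In its last tile the packet has no outgoing edge. Since its sketch path is nonempty, it is
      -- charged to the edge by which it came.
      · have hp : 0 < p.length := List.length_pos_iff.2 (hacc.far_ne_nil b hb T p d hr)
        have hlt : p.length - 1 < p.length := by omega
        have := mem_sketchEdges_prev (s := b.req.sourceTile T) hp (List.getElem?_eq_getElem hlt)
        rw [← htile] at this
        generalize p[p.length - 1] = m' at this
        cases m' <;> simp [hu b hb p d _ hr this]
    · obtain ⟨m₀, hm₀⟩ := not_forall.1 hne
      have hm₀' : N.Hi T m₀.other v t := by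
        by_contra h
        exact hsw ((Network.inSW_iff_other T m₀ v t).2 ⟨hm₀, h⟩)
      refine ⟨(s, .store), (s, .forward), (Move.prevTile s m₀, m₀), fun b hb => ?_⟩
      obtain ⟨hb, hT, v', t', hon, hq, hw⟩ := hD b hb
      obtain ⟨p, d, hr⟩ := Entry.inTiling_iff.1 hT
      obtain ⟨j, hj, htile, -, h⟩ := hon T p d hr
      rw [← hq.tile, ← hs] at htile
      have h := h m₀ (fun h => hm₀ (((hq _).2).2 h)) (((hq _).2).1 hm₀')
      -- For `j = 0` the packet is still in its source tile and is charged to the first edge of its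
      -- sketch path.
      rcases Nat.eq_zero_or_pos j with rfl | hjp
      · have hp : 0 < p.length := List.length_pos_iff.2 (hacc.far_ne_nil b hb T p d hr)
        have := mem_sketchEdges_of_getElem? (s := b.req.sourceTile T) (List.getElem?_eq_getElem hp)
        rw [← htile] at this
        generalize p[0] = m' at this
        cases m' <;> simp [hu b hb p d _ hr this]
      · have := mem_sketchEdges_prev (s := b.req.sourceTile T) hjp (h.resolve_left (by omega))
        rw [← htile] at this
        simp [hu b hb p d _ hr this]
  obtain ⟨e₁, e₂, e₃, h⟩ := key
  have h1 : D.card ≤ sketchLoad acc T e₁ + sketchLoad acc T e₂ + sketchLoad acc T e₃ := by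
    rw [← card_users hacc.nodup, ← card_users hacc.nodup, ← card_users hacc.nodup]
    refine (Finset.card_le_card h).trans ((Finset.card_union_le _ _).trans ?_)
    gcongr
    exact Finset.card_union_le _ _
  have h2 : (D.card : ℝ) ≤ sketchLoad acc T e₁ + sketchLoad acc T e₂ + sketchLoad acc T e₃ := by
    exact_mod_cast h1
  linarith [hacc.sketchLoad_le T e₁, hacc.sketchLoad_le T e₂, hacc.sketchLoad_le T e₃]

end

/-! ### The routing invariant: tracks are never overfull and packets stay on track. -/

section

variable {acc : List (Entry N)}

theorem length_queue (hacc : (acc.map Entry.idx).Nodup) (T : Tiling) (m : Move) (v t : ℕ)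
    [DecidablePred fun b : Entry N => b.want v t = m] :
    (queue acc (location acc t) T m v t).length =
      ((atVertex acc T v t).filter fun b => b.want v t = m).card := by
  classical
  rw [← List.toFinset_card_of_nodup (queue_nodup hacc _ T m v t)]
  congr 1
  ext b
  simp [mem_queue, mem_atVertex, and_assoc]

/-- No packet leaves its quadrant in the direction that it does not want. -/
theorem quadPos_ne_of_deflected (hacc : Admissible acc) (hN : N.Roomy)
    {a : Entry N} (ha : a ∈ acc) {T : Tiling} (hT : a.InTiling T) {m : Move} {t v : ℕ}
    {o : Option Move} (hcap : ∀ s < t, CapRespected acc s) (hon : ∀ s ≤ t, AllOnTrack acc s)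
    (hsw : ¬ N.InSW T v t)
    (hloc : location acc t a = some (v, o)) (hw : a.want v t = m)
    (hdef : crossbar acc (location acc t) v t a = m.other) :
    N.quadPos T m.other v t ≠ N.half m.other - 1 := by
  classical
  intro hq
  obtain ⟨D, hD, hD'⟩ :=
    exists_blocking_finset hacc hN.half_pos ha hT hcap hsw hloc hw hdef
  -- The deflected packet has not gained in the `m`-coordinate, so it is not one of its own
  -- blockers. This extra packet makes the final inequality strict.
  have haD : a ∉ D := by
    intro h
    obtain ⟨-, -, t', ht', v', o', h1, -, -, h2, h3⟩ := hD' a h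
    rcases ht'.lt_or_eq with ht' | rfl
    · have := coord_lt_of_moved ht' h1 h3 hloc
      omega
    · rw [hloc] at h1
      simp only [Option.some.injEq, Prod.mk.injEq] at h1
      rw [← h1.1, hdef] at h3
      exact m.other_ne h3
  have h1 := card_le_of_sameQuadrant hacc hsw (m := m) (insert a D) (by
    intro b hb
    rcases Finset.mem_insert.1 hb with rfl | hb
    · exact ⟨ha, hT, v, t, hon t le_rfl b ha v o hloc, .refl T v t, hw⟩
    · obtain ⟨h1, h2, t', ht', v', o', h3, h4, h5, -, -⟩ := hD' b hb
      exact ⟨h1, h2, v', t', hon t' ht' b h1 v' o' h3, h4, h5⟩)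
  rw [Finset.card_insert_of_notMem haD] at h1
  have h2 := hN.room m
  rw [hq, sub_add_cancel] at hD
  have h3 : (N.half m.other * N.trackCap m : ℕ) ≤ D.card := by exact_mod_cast hD
  have h4 : ((N.half m.other * N.trackCap m : ℕ) : ℝ) ≤ D.card := by exact_mod_cast h3
  push_cast at h1 h2 h4
  linarith

theorem mem_initPath_of_onTrack {a : Entry N} {T : Tiling} {p : List Move} {d : Move}
    (hr : a.route = .far T p d) {v t : ℕ} (h : OnTrack a v t) (hsw : N.InSW T v t) :
    ((v, t), d) ∈ pathEdges a.req.src a.req.time (a.req.initPath T d) := by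
  obtain ⟨j, -, -, h, -⟩ := h T p d hr
  obtain ⟨-, i, rfl, rfl, hp⟩ := h hsw
  rw [Request.initPath_eq, mem_pathEdges_replicate]
  have := (Network.inSW_iff_forall T _ _).1 hsw d
  unfold Network.Hi at this
  exact ⟨i, by omega, rfl⟩

/-- All packets here started in this very quadrant and are still on their initial paths, whose load
was bounded at admission. -/
theorem card_want_le_of_inSW (hacc : Admissible acc) {t : ℕ} (hon : AllOnTrack acc t) {T : Tiling}
    {v : ℕ} (hsw : N.InSW T v t) (m : Move) [DecidablePred fun b : Entry N => b.want v t = m] :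
    ((atVertex acc T v t).filter fun b => b.want v t = m).card ≤ N.trackCap m := by
  classical
  refine le_trans ?_ (hacc.initLoad_le T ((v, t), m))
  unfold initLoad
  rw [countP_eq_card_filter (nodup_of_idx hacc.nodup) _ (fun b => ∃ p d, b.route = .far T p d ∧
    ((v, t), m) ∈ pathEdges b.req.src b.req.time (b.req.initPath T d))]
  · refine Finset.card_le_card fun b hb => ?_
    simp only [Finset.mem_filter, mem_atVertex] at hb
    obtain ⟨⟨hb, hT, o, hl⟩, hw⟩ := hb
    obtain ⟨p, d, hr⟩ := Entry.inTiling_iff.1 hT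
    rw [Entry.want_sw hr hsw] at hw
    subst hw
    simp only [Finset.mem_filter, List.mem_toFinset]
    exact ⟨hb, p, d, hr, mem_initPath_of_onTrack hr (hon b hb v o hl) hsw⟩
  · intro b
    cases h : b.route with
    | near => simp
    | far T' p d => grind

/-- In a south-west quadrant no packet is deflected. -/
theorem crossbar_of_inSW (hacc : Admissible acc) {t : ℕ} (hon : AllOnTrack acc t) {T : Tiling}
    {v : ℕ} (hsw : N.InSW T v t) {a : Entry N} (ha : a ∈ acc) (hT : a.InTiling T)
    {o : Option Move} (hloc : location acc t a = some (v, o)) :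
    crossbar acc (location acc t) v t a = a.want v t := by
  classical
  rw [crossbar_far hacc.nodup ha hT, if_pos]
  rw [List.take_of_length_le]
  · exact mem_queue.2 ⟨ha, hT, ⟨o, hloc⟩, rfl⟩
  · rw [length_queue hacc.nodup]
    exact card_want_le_of_inSW hacc hon hsw _

theorem onTrack_source (a : Entry N) :
    OnTrack a a.req.src a.req.time :=
  fun _ _ _ _ => ⟨0, by omega, rfl, fun _ => ⟨rfl, 0, rfl, rfl, by simp⟩, fun _ _ _ => .inl rfl⟩

theorem OnTrack.of_sameQuadrant {a : Entry N} {T : Tiling} (hT : a.InTiling T) {v t v' t' : ℕ}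
    (h : OnTrack a v t) (hsw : ¬ N.InSW T v t) (hq : N.SameQuadrant T v t v' t') :
    OnTrack a v' t' := by
  obtain ⟨p, d, hr⟩ := Entry.inTiling_iff.1 hT
  intro T' p' d' hr'
  obtain ⟨rfl, rfl, rfl⟩ : T = T' ∧ p = p' ∧ d = d' := by simpa [hr] using hr'
  obtain ⟨j, hj, h1, -, h3⟩ := h T p d hr
  refine ⟨j, hj, hq.tile ▸ h1, fun h => absurd ?_ hsw, fun m hm hm' => ?_⟩
  · rw [Network.inSW_iff] at h ⊢
    rwa [(hq .store).2, (hq .forward).2]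
  · exact h3 m (by rwa [(hq m).2]) (by rwa [(hq m.other).2])

/-- Undeflected moves follow the sketch path by the definition of `want`; deflected moves stay in
the quadrant by `quadPos_ne_of_deflected`. No move enters a south-west quadrant from outside. -/
theorem allOnTrack_succ (hacc : Admissible acc) (hN : N.Roomy) {t : ℕ}
    (hcap : ∀ s < t, CapRespected acc s) (hon : ∀ s ≤ t, AllOnTrack acc s) :
    AllOnTrack acc (t + 1) := by
  intro a ha v₁ o₁ hl₁
  rcases location_some_cases hl₁ with ⟨e1, rfl, -⟩ | ⟨s, v, o, hs, hl, e, -, hd⟩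
  · rw [← e1]
    exact onTrack_source a
  obtain rfl : t = s := by omega
  intro T p d hr
  have hT : a.InTiling T := Entry.inTiling_iff.2 ⟨p, d, hr⟩
  have hon' := hon t le_rfl a ha v o hl
  obtain ⟨j, hj, h1, h2, h3⟩ := hon' T p d hr
  have hlt := lt_dst_of_location (hacc.src_lt a ha) hl₁
  by_cases hsw : N.InSW T v t
  · rw [crossbar_of_inSW hacc (hon t le_rfl) hsw ha hT hl, Entry.want_sw hr hsw] at e
    obtain ⟨rfl, i, hi1, hi2, hi3⟩ := h2 hsw
    have hlo := (Network.inSW_iff_forall T v t).1 hsw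
    subst e
    rcases Network.move_cases hN.half_pos T d v t with ⟨hq, hp⟩ | ⟨-, -, ⟨-, hh, ht⟩ | ⟨hh, -⟩⟩
    · refine ⟨0, by omega, hq.tile ▸ h1, fun hsw' => ⟨rfl, i + 1, ?_, by omega, ?_⟩,
        fun _ _ _ => .inl rfl⟩
      · rw [Function.iterate_succ_apply', ← hi1]
      · have h4 := Network.quadPos_cases hN.half_pos T d v t
        have h5 := Network.quadPos_cases hN.half_pos T d (d.node v) (t + 1)
        have h6 : ¬ N.Hi T d (d.node v) (t + 1) := by rw [← (hq d).2]; exact hlo d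
        simp only [hlo d, h6, false_and, not_false_iff, true_and, false_or] at h4 h5
        push_cast
        omega
    · exact ⟨0, by omega, ht ▸ h1, fun hsw' => absurd hh ((Network.inSW_iff_forall T _ _).1 hsw' d),
        fun _ _ _ => .inl rfl⟩
    · exact absurd hh (hlo d)
  · set m := a.want v t with hw
    rcases Move.eq_or_eq_other (crossbar acc (location acc t) v t a) m with hc | hc
    · rw [hc] at e
      subst e
      rcases Network.move_cases hN.half_pos T m v t with
        ⟨hq, hp⟩ | ⟨-, -, ⟨hlo, hh, ht⟩ | ⟨hh, hlo, ht⟩⟩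
      · exact hon'.of_sameQuadrant hT hsw hq T p d hr
      -- From a mixed quadrant, the upper half in direction `m` is the north-east quadrant of the
      -- same tile; the index `j` is unchanged.
      · have hoth : N.Hi T m.other v t := by
          by_contra h
          exact hsw ((Network.inSW_iff_other T m v t).2 ⟨hlo, h⟩)
        have hall : ∀ m', N.Hi T m' (m.node v) (t + 1) := by
          intro m'
          rcases Move.eq_or_eq_other m' m with rfl | rfl
          · exact hh
          · exact (Network.hi_node_other T m v t).2 hoth
        exact ⟨j, hj, ht ▸ h1, fun h => absurd hh ((Network.inSW_iff_forall T _ _).1 h m),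
          fun m' h _ => absurd (hall m') h⟩
      -- A tile is left only from its north-east quadrant: in a mixed quadrant the wish points into
      -- the tile, so a packet already high in direction `m` that wants `m` must be high in the
      -- other direction too.
      · have hoth : N.Hi T m.other v t := by
          by_contra h
          have := Entry.want_mixed hT (m := m.other) (v := v) (t := t) h (by simpa using hh)
          exact m.other_ne (this ▸ hw)
        have hall : ∀ m', N.Hi T m' v t := by
          intro m'
          rcases Move.eq_or_eq_other m' m with rfl | rfl
          · exact hh
          · exact hoth
        have hoth' := (Network.hi_node_other T m v t).2 hoth
        have hwj := Entry.want_ne hr hj hall h1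
        rw [← hw] at hwj
        rcases hj.lt_or_eq with hj | rfl
        · have hpj : p[j]? = some m := by
            rw [hwj, List.getD_eq_getElem?_getD, List.getElem?_eq_getElem hj]
            simp
          refine ⟨j + 1, hj, ?_, fun h => absurd hoth' ((Network.inSW_iff_forall T _ _).1 h _), ?_⟩
          · rw [ht, h1, walk_take_succ hpj]
          · intro m' hm' _
            rcases Move.eq_or_eq_other m' m with rfl | rfl
            · exact .inr hpj
            · exact absurd hoth' hm'
        -- In the last tile the wish defaults to north, and leaving the tile would carry the packet
        -- above the row of its destination, which it has not yet reached.
        · exfalso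
          have hmf : m = .forward := by simpa using hwj
          rw [List.take_length, walk_eq] at h1
          rw [hmf, h1] at ht
          have hrow : N.tileRow T (Move.node v .forward) =
              N.tileRow T a.req.src + p.count .forward + 1 := congrArg Prod.snd ht
          rw [hacc.far_sketch a ha T p d hr] at hrow
          rw [hmf] at hlt
          have : N.tileRow T (Move.node v .forward) ≤ N.tileRow T a.req.dst := by
            unfold Network.tileRow
            apply Int.ediv_le_ediv
            · have := hN.half_pos .forward
              simp only [Network.half] at this
              simp only [Network.tileV]
              positivity
            · omega
          omega
    · have hne := quadPos_ne_of_deflected hacc hN ha hT hcap hon hsw hl hw.symm hc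
      rw [hc] at e
      subst e
      rcases Network.move_cases hN.half_pos T m.other v t with ⟨hq, hp⟩ | ⟨h, -⟩
      · exact hon'.of_sameQuadrant hT hsw hq T p d hr
      · exact absurd h hne

/-- Outside south-west quadrants at most `trackCap m + trackCap m.other` packets are present. The
overflow of one direction therefore fits into the free places of the other. -/
theorem capRespected_of_allOnTrack (hacc : Admissible acc) {t : ℕ}
    (hcap : ∀ s < t, CapRespected acc s) (hon : AllOnTrack acc t) : CapRespected acc t := by
  classical
  intro T m v
  by_cases hsw : N.InSW T v t
  · refine le_trans (Finset.card_le_card fun b hb => ?_) (card_want_le_of_inSW hacc hon hsw m)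
    obtain ⟨⟨hb, hT, o, hl⟩, hc⟩ := mem_movers.1 hb
    rw [crossbar_of_inSW hacc hon hsw hb hT hl] at hc
    exact Finset.mem_filter.2 ⟨mem_atVertex.2 ⟨hb, hT, o, hl⟩, hc⟩
  · set W : Move → Finset (Entry N) := fun d => (atVertex acc T v t).filter fun b => b.want v t = d
    set G : Move → Finset (Entry N) := fun d =>
      ((queue acc (location acc t) T d v t).take (N.trackCap d)).toFinset
    have hG : ∀ d, (G d).card = min (N.trackCap d) (W d).card := by
      intro d
      simp only [G, W]
      rw [List.toFinset_card_of_nodup ((queue_nodup hacc.nodup _ T d v t).take), List.length_take,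
        length_queue hacc.nodup]
    have hGW : ∀ d, G d ⊆ W d := by
      intro d b hb
      simp only [G, List.mem_toFinset] at hb
      have := mem_queue.1 (List.mem_of_mem_take hb)
      exact Finset.mem_filter.2 ⟨mem_atVertex.2 ⟨this.1, this.2.1, this.2.2.1⟩, this.2.2.2⟩
    have hsub : movers acc T m v t ⊆ G m ∪ (W m.other \ G m.other) := by
      intro b hb
      obtain ⟨⟨hb, hT, o, hl⟩, hc⟩ := mem_movers.1 hb
      have hat : b ∈ atVertex acc T v t := mem_atVertex.2 ⟨hb, hT, o, hl⟩
      have hcf := crossbar_far (loc := location acc t) (v := v) (t := t) hacc.nodup hb hT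
      rw [hc] at hcf
      rcases Move.eq_or_eq_other (b.want v t) m with hw | hw
      · rw [hw] at hcf
        split_ifs at hcf with h
        · exact Finset.mem_union_left _ (List.mem_toFinset.2 h)
        · exact absurd hcf.symm m.other_ne
      · rw [hw] at hcf
        split_ifs at hcf with h
        · exact absurd hcf.symm m.other_ne
        · refine Finset.mem_union_right _ (Finset.mem_sdiff.2 ⟨Finset.mem_filter.2 ⟨hat, hw⟩, ?_⟩)
          simpa [G] using h
    -- Every packet here arrived over one of the two incoming edges, which were not overfull in the
    -- previous step.
    have htot : (W m).card + (W m.other).card ≤ N.trackCap m + N.trackCap m.other := by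
      obtain ⟨S, hS, hS'⟩ := exists_straight_finset hcap T m v
      obtain ⟨S₁, hS₁, hS₁'⟩ := exists_straight_finset hcap T m.other v
      rw [← Finset.card_union_of_disjoint]
      · refine le_trans (Finset.card_le_card (t := S ∪ S₁) fun b hb => ?_)
          ((Finset.card_union_le _ _).trans (add_le_add hS hS₁))
        have hat : b ∈ atVertex acc T v t := by
          rcases Finset.mem_union.1 hb with h | h <;> exact (Finset.mem_filter.1 h).1
        obtain ⟨hba, hT, o, hl⟩ := mem_atVertex.1 hat
        cases o with
        | none => exact absurd (inSW_of_location_none hacc hba hT hl) hsw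
        | some d =>
          rcases Move.eq_or_eq_other d m with rfl | rfl
          · exact Finset.mem_union_left _ (hS' b hba hT hl)
          · exact Finset.mem_union_right _ (hS₁' b hba hT hl)
      · rw [Finset.disjoint_left]
        intro b hb hb'
        have h1 := (Finset.mem_filter.1 hb).2
        have h2 := (Finset.mem_filter.1 hb').2
        exact m.other_ne (h2.symm.trans h1)
    have h1 := (Finset.card_le_card hsub).trans (Finset.card_union_le _ _)
    rw [Finset.card_sdiff_of_subset (hGW _), hG, hG] at h1
    omega

/-- Detailed routing respects the capacities of the tracks, and all packets follow their sketch
paths. -/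
theorem capRespected_and_allOnTrack (hacc : Admissible acc) (hN : N.Roomy) (t : ℕ) :
    CapRespected acc t ∧ AllOnTrack acc t := by
  induction t using Nat.strong_induction_on with
  | _ t ih =>
    have hon : AllOnTrack acc t := by
      cases t with
      | zero =>
        intro a ha v o hl
        rcases location_some_cases hl with ⟨e1, rfl, -⟩ | ⟨s, _, _, hs, _⟩
        · rw [← e1]
          exact onTrack_source a
        · omega
      | succ t =>
        exact allOnTrack_succ hacc hN (fun s hs => (ih s (by omega)).1)
          fun s hs => (ih s (by omega)).2
    exact ⟨capRespected_of_allOnTrack hacc (fun s hs => (ih s hs).1) hon, hon⟩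

/-- Near packets are always forwarded. -/
theorem location_near {a : Entry N} (hr : a.route = .near) {t v : ℕ} {o : Option Move}
    (h : location acc t a = some (v, o)) : v + a.req.time = a.req.src + t := by
  induction t generalizing v o with
  | zero =>
    rcases location_some_cases h with ⟨e, rfl, -⟩ | ⟨s, _, _, hs, _⟩
    · omega
    · omega
  | succ t ih =>
    rcases location_some_cases h with ⟨e, rfl, -⟩ | ⟨s, v', o', hs, hl, e, -, -⟩
    · omega
    · obtain rfl : t = s := by omega
      have := ih hl
      simp only [crossbar, hr, Move.node] at e
      omega

/-- Every accepted packet reaches its destination. -/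
theorem exists_location_eq_none (hacc : Admissible acc) (hN : N.Roomy) {a : Entry N}
    (ha : a ∈ acc) : ∃ t ≥ a.req.time, location acc t a = none := by
  by_contra! hc
  cases hr : a.route with
  | near =>
    obtain ⟨q, hq⟩ := Option.ne_none_iff_exists'.1 (hc (a.req.time + N.n) (by omega))
    have h1 := location_near hr hq
    have h2 := lt_dst_of_location (hacc.src_lt a ha) hq
    have := a.req.dst.2
    omega
  | far T p d =>
    -- The two coordinates of a vertex add up to the time, and a packet on track is at most
    -- `p.length` tiles beyond its source tile in each direction; `S` exceeds the largest sum of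
    -- coordinates this allows.
    set S : ℤ := (2 * N.half .store) * ((a.req.sourceTile T).1 + p.length + 1) + N.offset T .store +
      ((2 * N.half .forward) * ((a.req.sourceTile T).2 + p.length + 1) + N.offset T .forward)
    obtain ⟨q, hq⟩ := Option.ne_none_iff_exists'.1 (hc (a.req.time + S.toNat) (by omega))
    obtain ⟨v, o⟩ := q
    obtain ⟨j, hj, ht, -⟩ := (capRespected_and_allOnTrack hacc hN _).2 a ha v o hq T p d hr
    have hS : S ≤ (a.req.time + S.toNat : ℕ) := by omega
    generalize a.req.time + S.toNat = t' at *
    rw [Network.tile_eq, walk_eq] at ht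
    simp only [Prod.mk.injEq] at ht
    have hs := coord_store_add_forward v t'
    have bound : ∀ m, coord m v t' <
        2 * N.half m * (N.tileIdx T m v t' + 1) + N.offset T m := by
      intro m
      have h1 := Network.posIn_lt hN.half_pos T m v t'
      have h2 := Network.posIn_add_mul_tileIdx (N := N) T m v t'
      linarith
    have hidx : ∀ m, N.tileIdx T m v t' ≤
        (match m with
          | .store => (a.req.sourceTile T).1
          | .forward => (a.req.sourceTile T).2) + p.length := by
      intro m
      have h1 : (p.take j).count m ≤ p.length := List.count_le_length.trans (by simp)
      cases m <;> simp only <;> omega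
    have h1 := bound .store
    have h2 := bound .forward
    have h3 : 2 * (N.half .store : ℤ) * (N.tileIdx T .store v t' + 1) ≤
        2 * N.half .store * ((a.req.sourceTile T).1 + p.length + 1) := by
      have := hidx .store
      gcongr
    have h4 : 2 * (N.half .forward : ℤ) * (N.tileIdx T .forward v t' + 1) ≤
        2 * N.half .forward * ((a.req.sourceTile T).2 + p.length + 1) := by
      have := hidx .forward
      gcongr
    simp only [S] at hS
    linarith

end

/-! ## Admission -/

theorem finite_setOf_length_le (M : ℝ) : {p : List Move | (p.length : ℝ) ≤ M}.Finite := by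
  have : Finite Move := Finite.of_surjective (fun b : Bool => if b then Move.store else .forward)
    fun m => by cases m; exacts [⟨true, rfl⟩, ⟨false, rfl⟩]
  refine (List.finite_length_le Move ⌊M⌋₊).subset fun p hp => ?_
  exact Nat.le_floor hp

/-- The length bound leaves finitely many legal paths, so the minimum is attained and `ipp` fails
only when all of them are too heavy. -/
theorem exists_isLightest (acc : List (Entry N)) (T : Tiling) (r : Request N)
    {p : List Move} (hp : r.IsSketchPath T p) : ∃ q, IsLightest acc T r q := by
  have hfin : {p | r.IsSketchPath T p}.Finite :=
    (finite_setOf_length_le N.pmax).subset fun p hp => hp.2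
  obtain ⟨q, hq, h⟩ := Set.exists_min_image _ (sketchWeight acc T r) hfin ⟨p, hp⟩
  exact ⟨q, hq, h⟩

theorem one_le_sketchWeight_of_ipp_eq_none {acc : List (Entry N)} {T : Tiling} {r : Request N}
    (h : ipp acc T r = none) {p : List Move} (hp : r.IsSketchPath T p) :
    1 ≤ sketchWeight acc T r p := by
  obtain ⟨q, hq⟩ := exists_isLightest acc T r hp
  unfold ipp at h
  split_ifs at h with h'
  push Not at h'
  exact (h' q hq).trans (hq.2 p hp)

theorem of_ipp_eq_some {acc : List (Entry N)} {T : Tiling} {r : Request N} {p : List Move}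
    (h : ipp acc T r = some p) : r.IsSketchPath T p ∧ sketchWeight acc T r p < 1 := by
  unfold ipp at h
  split_ifs at h with h'
  have := h'.choose_spec
  simp only [Option.some.injEq] at h
  rw [h] at this
  exact ⟨this.1.1, this.2⟩

/-- The conditions under which a request is accepted with the given route. -/
def Grants (acc : List (Entry N)) (r : Request N) : Route → Prop
  | .near => r.IsNear ∧ nearLoad acc ((r.src, r.time), .forward) < N.trackC
  | .far T p d => ¬ r.IsNear ∧ T = N.swTiling r.src r.time ∧ r.IsSketchPath T p ∧
      sketchWeight acc T r p < 1 ∧ InitFree acc T r d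

/-- The conditions under which a request is rejected. -/
def Refuses (acc : List (Entry N)) (r : Request N) : Prop :=
  N.trackC ≤ nearLoad acc ((r.src, r.time), .forward) ∨
  (¬ r.IsNear ∧ ∀ p, r.IsSketchPath (N.swTiling r.src r.time) p →
      1 ≤ sketchWeight acc (N.swTiling r.src r.time) r p) ∨
  ∀ d, ¬ InitFree acc (N.swTiling r.src r.time) r d

theorem processRequest_cases (acc : List (Entry N)) (p : Request N × ℕ) :
    (processRequest acc p = acc ∧ Refuses acc p.1) ∨
    ∃ ρ, processRequest acc p = acc ++ [⟨p.2, p.1, ρ⟩] ∧ Grants acc p.1 ρ := by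
  unfold processRequest
  by_cases hn : p.1.IsNear
  · rw [if_pos hn]
    by_cases hl : nearLoad acc ((p.1.src, p.1.time), .forward) < N.trackC
    · rw [if_pos hl]
      exact .inr ⟨_, rfl, hn, hl⟩
    · rw [if_neg hl]
      exact .inl ⟨rfl, .inl (not_lt.1 hl)⟩
  · rw [if_neg hn]
    simp only
    generalize hT : N.swTiling p.1.src p.1.time = T
    cases hi : ipp acc T p.1 with
    | none =>
      refine .inl ⟨by simp, .inr (.inl ⟨hn, ?_⟩)⟩
      rw [hT]
      exact fun q hq => one_le_sketchWeight_of_ipp_eq_none hi hq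
    | some q =>
      have hq := of_ipp_eq_some hi
      by_cases h1 : InitFree acc T p.1 .store
      · have : initialRoute acc T p.1 = some .store := by simp [initialRoute, h1]
        simp only [this]
        exact .inr ⟨_, rfl, hn, hT.symm, hq.1, hq.2, h1⟩
      · by_cases h2 : InitFree acc T p.1 .forward
        · have : initialRoute acc T p.1 = some .forward := by simp [initialRoute, h1, h2]
          simp only [this]
          exact .inr ⟨_, rfl, hn, hT.symm, hq.1, hq.2, h2⟩
        · have : initialRoute acc T p.1 = none := by simp [initialRoute, h1, h2]
          simp only [this]
          refine .inl ⟨trivial, .inr (.inr fun d => ?_)⟩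
          rw [hT]
          cases d <;> assumption

/-! ### Growth of loads and weights as requests are accepted. -/

theorem sketchLoad_append (acc ext : List (Entry N)) (T : Tiling) (e : SketchEdge) :
    sketchLoad (acc ++ ext) T e = sketchLoad acc T e + sketchLoad ext T e := List.countP_append

theorem initLoad_append (acc ext : List (Entry N)) (T : Tiling) (e : STEdge) :
    initLoad (acc ++ ext) T e = initLoad acc T e + initLoad ext T e := List.countP_append

theorem nearLoad_append (acc ext : List (Entry N)) (e : STEdge) :
    nearLoad (acc ++ ext) e = nearLoad acc e + nearLoad ext e := List.countP_append

theorem sketchLoad_singleton_near (i : ℕ) (r : Request N) (T : Tiling) (e : SketchEdge) :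
    sketchLoad [⟨i, r, .near⟩] T e = 0 := by simp [sketchLoad]

theorem initLoad_singleton_near (i : ℕ) (r : Request N) (T : Tiling) (e : STEdge) :
    initLoad [⟨i, r, .near⟩] T e = 0 := by simp [initLoad]

theorem nearLoad_singleton_far (i : ℕ) (r : Request N) (T : Tiling) (p : List Move) (d : Move)
    (e : STEdge) : nearLoad [⟨i, r, .far T p d⟩] e = 0 := by simp [nearLoad]

theorem sketchLoad_singleton_far (i : ℕ) (r : Request N) (T T' : Tiling) (p : List Move) (d : Move)
    (e : SketchEdge) : sketchLoad [⟨i, r, .far T' p d⟩] T e =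
      if T' = T ∧ e ∈ sketchEdges (r.sourceTile T) p then 1 else 0 := by
  simp [sketchLoad, List.countP_singleton]

theorem initLoad_singleton_far (i : ℕ) (r : Request N) (T T' : Tiling) (p : List Move) (d : Move)
    (e : STEdge) : initLoad [⟨i, r, .far T' p d⟩] T e =
      if T' = T ∧ e ∈ pathEdges r.src r.time (r.initPath T d) then 1 else 0 := by
  simp [initLoad, List.countP_singleton]

theorem nearLoad_singleton_near (i : ℕ) (r : Request N) (e : STEdge) :
    nearLoad [⟨i, r, .near⟩] e =
      if e ∈ pathEdges r.src r.time r.straight then 1 else 0 := by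
  simp [nearLoad, List.countP_singleton]

theorem sketchWeight_mono (hp : 0 ≤ N.pmax) (acc ext : List (Entry N)) (T : Tiling) (r : Request N)
    (p : List Move) : sketchWeight acc T r p ≤ sketchWeight (acc ++ ext) T r p := by
  unfold sketchWeight
  apply List.sum_le_sum
  intro e _
  rw [sketchLoad_append]
  gcongr
  · norm_num
  · omega

/-- Loads only grow, so a refusal remains justified by the final loads. The competitive analysis can
then use one set of weights for all requests. -/
theorem Refuses.append (hp : 0 ≤ N.pmax) {acc : List (Entry N)} {r : Request N}
    (h : Refuses acc r) (ext : List (Entry N)) : Refuses (acc ++ ext) r := by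
  rcases h with h | h | h
  · left
    rw [nearLoad_append]
    omega
  · exact .inr (.inl ⟨h.1, fun p hpp => (h.2 p hpp).trans (sketchWeight_mono hp _ _ _ _ _)⟩)
  · refine .inr (.inr fun d hd => h d fun e he => ?_)
    have := hd e he
    rw [initLoad_append] at this
    omega

/-- The requests accepted when the given requests are processed in order. -/
def processAll (L : List (Request N × ℕ)) : List (Entry N) := L.foldl processRequest []

theorem processAll_concat (L : List (Request N × ℕ)) (p : Request N × ℕ) :
    processAll (L ++ [p]) = processRequest (processAll L) p := by
  simp [processAll]

theorem processAll_isPrefix_append (L M : List (Request N × ℕ)) :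
    processAll L <+: processAll (L ++ M) := by
  induction M using List.reverseRecOn with
  | nil => simp
  | append_singleton M p ih =>
    rw [← List.append_assoc, processAll_concat]
    rcases processRequest_cases (processAll (L ++ M)) p with ⟨h, -⟩ | ⟨ρ, h, -⟩
    · rwa [h]
    · rw [h]
      exact ih.trans (List.prefix_append _ _)

theorem map_processAll_sublist (L : List (Request N × ℕ)) :
    ((processAll L).map fun a => (a.req, a.idx)).Sublist L := by
  induction L using List.reverseRecOn with
  | nil => simp [processAll]
  | append_singleton L p ih =>
    rw [processAll_concat]
    rcases processRequest_cases (processAll L) p with ⟨h, -⟩ | ⟨ρ, h, -⟩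
    · rw [h]
      exact ih.trans (List.sublist_append_left _ _)
    · rw [h, List.map_append]
      exact ih.append (List.Sublist.refl _)

theorem mem_of_mem_processAll {L : List (Request N × ℕ)} {a : Entry N} (h : a ∈ processAll L) :
    (a.req, a.idx) ∈ L :=
  (map_processAll_sublist L).subset (List.mem_map.2 ⟨a, h, rfl⟩)

/-- Every request is accepted or refused, even with respect to the final loads. -/
theorem accepted_or_refuses (hp : 0 ≤ N.pmax) {L : List (Request N × ℕ)} {p : Request N × ℕ}
    (h : p ∈ L) : (∃ a ∈ processAll L, a.req = p.1 ∧ a.idx = p.2) ∨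
      Refuses (processAll L) p.1 := by
  obtain ⟨L₁, L₂, rfl⟩ := List.append_of_mem h
  have h2 := processAll_isPrefix_append (L₁ ++ [p]) L₂
  rw [List.append_assoc, List.singleton_append] at h2
  rw [processAll_concat] at h2
  obtain ⟨ext, h2⟩ := h2
  rw [← h2]
  rcases processRequest_cases (processAll L₁) p with ⟨h, h'⟩ | ⟨ρ, h, -⟩
  · rw [h]
    exact .inr (h'.append hp ext)
  · rw [h]
    exact .inl ⟨⟨p.2, p.1, ρ⟩, by simp, rfl, rfl⟩

theorem Request.straight_eq (r : Request N) :
    r.straight = List.replicate ((r.dst : ℕ) - r.src) .forward := rfl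

theorem node_forward_iterate (i v : ℕ) : (fun v => Move.node v .forward)^[i] v = v + i := by
  induction i with
  | zero => rfl
  | succ i ih => rw [Function.iterate_succ_apply', ih]; rfl

theorem mem_pathEdges_straight {r : Request N} {e : STEdge} :
    e ∈ pathEdges r.src r.time r.straight ↔
      ∃ i < (r.dst : ℕ) - r.src, e = ((r.src + i, r.time + i), .forward) := by
  rw [Request.straight_eq, mem_pathEdges_replicate]
  simp only [node_forward_iterate]

/-- Near packets travel on diagonals. One that was input no later than `r` and uses a later edge of
the diagonal of `r` also uses the edge out of the source of `r`. Testing that single edge at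
admission is therefore enough. -/
theorem nearLoad_le_source {acc : List (Entry N)} {r : Request N}
    (ht : ∀ a ∈ acc, a.req.time ≤ r.time) {e : STEdge}
    (he : e ∈ pathEdges r.src r.time r.straight) :
    nearLoad acc e ≤ nearLoad acc ((r.src, r.time), .forward) := by
  obtain ⟨i, hi, rfl⟩ := mem_pathEdges_straight.1 he
  unfold nearLoad
  apply List.countP_mono_left
  intro a ha
  have := ht a ha
  cases hr : a.route with
  | far _ _ _ => simp
  | near =>
    simp only [decide_eq_true_eq, mem_pathEdges_straight, Prod.mk.injEq, and_true]
    rintro ⟨j, hj, h1, h2⟩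
    exact ⟨j - i, by omega, by omega, by omega⟩

/-- A shift by half a tile exchanges the two halves, so in each direction one of the two offsets
puts the vertex into the lower half. -/
theorem Network.exists_inSW (hN : ∀ m, 0 < N.half m) (v t : ℕ) : ∃ T, N.InSW T v t := by
  have key : ∀ (z : ℤ) (h : ℕ), 0 < h → ∃ b : Bool,
      (z - if b then -(h : ℤ) else 0) % (2 * h : ℕ) < h := by
    intro z h hh
    by_cases hz : z % (2 * h : ℕ) < h
    · exact ⟨false, by simpa using hz⟩
    · refine ⟨true, ?_⟩
      have h1 := Int.emod_lt_of_pos z (b := ((2 * h : ℕ) : ℤ)) (by positivity)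
      have h2 := Int.emod_add_mul_ediv z ((2 * h : ℕ) : ℤ)
      have : (z - if true = true then -(h : ℤ) else 0) =
          (z % (2 * h : ℕ) - h) + (2 * h : ℕ) * (z / (2 * h : ℕ) + 1) := by
        push_cast at *
        simp only [if_true]
        linarith
      rw [this, Int.add_mul_emod_self_left, Int.emod_eq_of_lt (by omega) (by omega)]
      push_cast at *
      omega
  obtain ⟨b, hb⟩ := key ((t : ℤ) - v) N.halfH (hN .store)
  obtain ⟨b', hb'⟩ := key v N.halfV (hN .forward)
  exact ⟨(b, b'), not_le.2 hb, not_le.2 hb'⟩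

theorem Network.inSW_swTiling (hN : ∀ m, 0 < N.half m) (v t : ℕ) :
    N.InSW (N.swTiling v t) v t := by
  classical
  unfold Network.swTiling
  set l : List Tiling := [(false, false), (false, true), (true, false), (true, true)]
  cases h : l.find? fun T => decide (N.InSW T v t) with
  | some T => simpa using List.find?_some h
  | none =>
    obtain ⟨T, hT⟩ := Network.exists_inSW hN v t
    have := List.find?_eq_none.1 h T (by obtain ⟨a, b⟩ := T; cases a <;> cases b <;> simp [l])
    simp [hT] at this

/-- A far request climbs more than one tile height, so its sketch path is nonempty, as the charging
to sketch edges requires. -/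
theorem tileRow_lt_of_not_isNear (hN : ∀ m, 0 < N.half m) {r : Request N} (hr : ¬ r.IsNear)
    (T : Tiling) : N.tileRow T r.src < N.tileRow T r.dst := by
  unfold Request.IsNear at hr
  have hV : (0 : ℤ) < N.tileV := by
    have := hN .forward
    simp only [Network.half] at this
    simp only [Network.tileV]
    positivity
  unfold Network.tileRow
  rw [Int.lt_iff_add_one_le, ← Int.add_mul_ediv_right _ _ hV.ne', one_mul]
  apply Int.ediv_le_ediv hV
  omega

/-- An edge of weight below 1 has `2 ^ l < 1 + pmax`, so after one more path `2 ^ (l + 1) < 2 + 2 *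
pmax ≤ 1 + 3 * pmax`. This explains the definition of `k`. -/
theorem add_one_le_k {l : ℕ} (hp : 1 ≤ N.pmax) (h : ((2 : ℝ) ^ l - 1) / N.pmax < 1) :
    ((l + 1 : ℕ) : ℝ) ≤ N.k := by
  rw [div_lt_one (by linarith)] at h
  unfold Network.k
  rw [Real.le_logb_iff_rpow_le (by norm_num) (by linarith), Real.rpow_natCast, pow_succ]
  linarith

theorem sketchWeight_term_nonneg (hp : 0 ≤ N.pmax) (l : ℕ) : 0 ≤ ((2 : ℝ) ^ l - 1) / N.pmax := by
  have : (1 : ℝ) ≤ 2 ^ l := one_le_pow₀ (by norm_num)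
  exact div_nonneg (by linarith) hp

theorem admissible_processAll (hp : 1 ≤ N.pmax) (hN : ∀ m, 0 < N.half m)
    {L : List (Request N × ℕ)} (hL : (L.map Prod.snd).Nodup) (hsd : ∀ p ∈ L, p.1.src < p.1.dst)
    (ht : L.Pairwise fun p q => p.1.time ≤ q.1.time) : Admissible (processAll L) := by
  induction L using List.reverseRecOn with
  | nil =>
    refine ⟨?_, ?_, ?_, ?_, ?_, ?_, ?_, ?_⟩ <;>
      simp [processAll, sketchLoad, initLoad, nearLoad]
    unfold Network.k
    exact fun _ => Real.logb_nonneg one_lt_two (by linarith)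
  | append_singleton L p ih =>
    have hnodup : ((processAll (L ++ [p])).map Entry.idx).Nodup := by
      have := (map_processAll_sublist (L ++ [p])).map Prod.snd
      rw [List.map_map] at this
      exact this.nodup hL
    have ht' := List.pairwise_append.1 ht
    have ih := ih (by rw [List.map_append] at hL; exact hL.of_append_left)
      (fun q hq => hsd q (List.mem_append_left _ hq)) ht'.1
    have hsdp := hsd p (by simp)
    have htime : ∀ a ∈ processAll L, a.req.time ≤ p.1.time := fun a ha =>
      ht'.2.2 _ (mem_of_mem_processAll ha) p (by simp)
    have hsw := Network.inSW_swTiling (N := N) hN p.1.src p.1.time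
    rw [processAll_concat] at hnodup ⊢
    rcases processRequest_cases (processAll L) p with ⟨h, -⟩ | ⟨ρ, h, hg⟩
    · rwa [h]
    rw [h] at hnodup ⊢
    have hmem : ∀ a, a ∈ processAll L ++ [⟨p.2, p.1, ρ⟩] →
        a ∈ processAll L ∨ a = ⟨p.2, p.1, ρ⟩ := by
      intro a ha
      simpa using ha
    refine ⟨hnodup, ?_, ?_, ?_, ?_, ?_, ?_, ?_⟩
    · intro a ha
      rcases hmem a ha with ha | rfl
      · exact ih.src_lt a ha
      · exact hsdp
    · intro a ha T q d hr
      rcases hmem a ha with ha | rfl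
      · exact ih.far_sw a ha T q d hr
      · simp only at hr
        subst hr
        rw [hg.2.1]
        exact hsw
    · intro a ha T q d hr
      rcases hmem a ha with ha | rfl
      · exact ih.far_sketch a ha T q d hr
      · simp only at hr
        subst hr
        exact hg.2.2.1.1
    · intro a ha T q d hr
      rcases hmem a ha with ha | rfl
      · exact ih.far_ne_nil a ha T q d hr
      · simp only at hr
        subst hr
        rintro rfl
        have h1 := tileRow_lt_of_not_isNear hN hg.1 T
        have h2 := hg.2.2.1.1
        simp only [List.count_nil] at h2
        omega
    · intro T e
      rw [sketchLoad_append]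
      cases ρ with
      | near =>
        rw [sketchLoad_singleton_near]
        exact ih.sketchLoad_le T e
      | far T' q d =>
        rw [sketchLoad_singleton_far]
        split_ifs with he
        · obtain ⟨rfl, he⟩ := he
          -- The weight of a single edge is at most that of the path, which was below 1 at
          -- acceptance.
          apply add_one_le_k hp
          refine lt_of_le_of_lt ?_ hg.2.2.2.1
          unfold sketchWeight
          refine List.single_le_sum ?_ _ (List.mem_map.2 ⟨e, he, rfl⟩)
          intro x hx
          obtain ⟨e', -, rfl⟩ := List.mem_map.1 hx
          exact sketchWeight_term_nonneg (by linarith) _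
        · exact ih.sketchLoad_le T e
    · intro T e
      rw [initLoad_append]
      cases ρ with
      | near =>
        rw [initLoad_singleton_near]
        exact ih.initLoad_le T e
      | far T' q d =>
        rw [initLoad_singleton_far]
        split_ifs with he
        · obtain ⟨rfl, he⟩ := he
          have h1 := hg.2.2.2.2 e he
          rw [Request.initPath_eq, mem_pathEdges_replicate] at he
          obtain ⟨i, -, rfl⟩ := he
          exact h1
        · exact ih.initLoad_le T e
    · intro e
      rw [nearLoad_append]
      cases ρ with
      | near =>
        rw [nearLoad_singleton_near]
        split_ifs with he
        · have := nearLoad_le_source htime he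
          have := hg.2
          omega
        · exact ih.nearLoad_le e
      | far T' q d =>
        rw [nearLoad_singleton_far]
        exact ih.nearLoad_le e

/-! ## The requests processed up to a given step -/

/-- The requests that are processed before step `τ`, in this order. -/
def requestsBefore (H : List (Request N)) (τ : ℕ) : List (Request N × ℕ) :=
  (List.range τ).flatMap (filteredRequests H)

theorem accepted_eq (H : List (Request N)) (τ : ℕ) :
    accepted H τ = processAll (requestsBefore H τ) := by
  induction τ with
  | zero => rfl
  | succ τ ih =>
    simp [accepted, ih, requestsBefore, processAll, List.range_succ, List.flatMap_append]

theorem mem_newRequests {H : List (Request N)} {t : ℕ} {p : Request N × ℕ} :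
    p ∈ newRequests H t ↔ H[p.2]? = some p.1 ∧ p.1.time = t := by
  unfold newRequests
  rw [List.mem_mergeSort, List.mem_filter, decide_eq_true_eq]
  obtain ⟨r, i⟩ := p
  rw [List.mk_mem_zipIdx_iff_getElem?]

theorem mem_newRequests_of_mem_filtered {H : List (Request N)} {t : ℕ} {p : Request N × ℕ}
    (h : p ∈ filteredRequests H t) : p ∈ newRequests H t := (List.mem_filter.1 h).1

theorem newRequests_nodup (H : List (Request N)) (t : ℕ) :
    ((newRequests H t).map Prod.snd).Nodup := by
  unfold newRequests
  rw [((List.mergeSort_perm _ _).map Prod.snd).nodup_iff]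
  refine ((List.filter_sublist (p := _) (l := H.zipIdx)).map Prod.snd).nodup ?_
  rw [List.zipIdx_map_snd]
  exact List.nodup_range'

theorem filteredRequests_nodup (H : List (Request N)) (t : ℕ) :
    ((filteredRequests H t).map Prod.snd).Nodup :=
  (List.filter_sublist.map Prod.snd).nodup (newRequests_nodup H t)

theorem mem_requestsBefore {H : List (Request N)} {τ : ℕ} {p : Request N × ℕ} :
    p ∈ requestsBefore H τ ↔ p.1.time < τ ∧ p ∈ filteredRequests H p.1.time := by
  simp only [requestsBefore, List.mem_flatMap, List.mem_range]
  constructor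
  · rintro ⟨s, hs, hp⟩
    have := (mem_newRequests.1 (mem_newRequests_of_mem_filtered hp)).2
    subst this
    exact ⟨hs, hp⟩
  · rintro ⟨hs, hp⟩
    exact ⟨_, hs, hp⟩

theorem requestsBefore_spec (H : List (Request N)) (τ : ℕ) :
    ((requestsBefore H τ).map Prod.snd).Nodup ∧
    (requestsBefore H τ).Pairwise fun p q => p.1.time ≤ q.1.time := by
  induction τ with
  | zero => simp [requestsBefore]
  | succ τ ih =>
    have e : requestsBefore H (τ + 1) = requestsBefore H τ ++ filteredRequests H τ := by
      simp [requestsBefore, List.range_succ, List.flatMap_append]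
    have htime : ∀ q ∈ filteredRequests H τ, q.1.time = τ := fun q hq =>
      (mem_newRequests.1 (mem_newRequests_of_mem_filtered hq)).2
    rw [e, List.map_append]
    refine ⟨List.nodup_append.2 ⟨ih.1, filteredRequests_nodup H τ, ?_⟩,
      List.pairwise_append.2 ⟨ih.2, ?_, ?_⟩⟩
    -- A packet number determines its request, hence its step, so different steps have disjoint sets
    -- of numbers.
    · rintro i hi j hj rfl
      obtain ⟨p, hp, rfl⟩ := List.mem_map.1 hi
      obtain ⟨q, hq, e⟩ := List.mem_map.1 hj
      have h1 := mem_requestsBefore.1 hp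
      have h2 := mem_newRequests.1 (mem_newRequests_of_mem_filtered h1.2)
      have h3 := mem_newRequests.1 (mem_newRequests_of_mem_filtered hq)
      rw [e, h2.1, Option.some.injEq] at h3
      have h4 := h3.2
      rw [← h3.1] at h4
      omega
    · exact List.pairwise_of_forall_mem_list fun p hp q hq => by rw [htime p hp, htime q hq]
    · intro p hp q hq
      rw [htime q hq]
      exact (mem_requestsBefore.1 hp).1.le

theorem mem_accepted {H : List (Request N)} {τ : ℕ} {a : Entry N} (h : a ∈ accepted H τ) :
    H[a.idx]? = some a.req ∧ a.req.time < τ := by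
  rw [accepted_eq] at h
  have := mem_requestsBefore.1 (mem_of_mem_processAll h)
  exact ⟨(mem_newRequests.1 (mem_newRequests_of_mem_filtered this.2)).1, this.1⟩

theorem admissible_accepted (hp : 1 ≤ N.pmax) (hN : ∀ m, 0 < N.half m) {R : List (Request N)}
    (hR : IsRequestSequence R) (τ : ℕ) : Admissible (accepted R τ) := by
  rw [accepted_eq]
  refine admissible_processAll hp hN (requestsBefore_spec R τ).1 (fun p hp => ?_)
    (requestsBefore_spec R τ).2
  have := mem_newRequests.1 (mem_newRequests_of_mem_filtered (mem_requestsBefore.1 hp).2)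
  exact hR.2 _ (List.mem_of_getElem? this.1)

/-- Later requests come at the end of the list of accepted requests. -/
theorem accepted_append (H : List (Request N)) {τ τ' : ℕ} (h : τ ≤ τ') :
    ∃ ext, accepted H τ' = accepted H τ ++ ext ∧ ∀ a ∈ ext, τ ≤ a.req.time := by
  induction τ', h using Nat.le_induction with
  | base => exact ⟨[], by simp⟩
  | succ τ' h ih =>
    obtain ⟨ext, e, hext⟩ := ih
    have key : ∀ (L : List (Request N × ℕ)) (acc ext : List (Entry N)),
        (∀ p ∈ L, τ ≤ p.1.time) → (∀ a ∈ ext, τ ≤ a.req.time) →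
        ∃ ext', L.foldl processRequest (acc ++ ext) = acc ++ ext' ∧
          ∀ a ∈ ext', τ ≤ a.req.time := by
      intro L
      induction L with
      | nil => exact fun acc ext _ h => ⟨ext, rfl, h⟩
      | cons p L ih =>
        intro acc ext hL hext
        rw [List.foldl_cons]
        rcases processRequest_cases (acc ++ ext) p with ⟨h, -⟩ | ⟨ρ, h, -⟩
        · rw [h]
          exact ih acc ext (fun q hq => hL q (List.mem_cons_of_mem _ hq)) hext
        · rw [h, List.append_assoc]
          refine ih acc _ (fun q hq => hL q (List.mem_cons_of_mem _ hq)) ?_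
          intro a ha
          rcases List.mem_append.1 ha with ha | ha
          · exact hext a ha
          · rw [List.mem_singleton] at ha
            subst ha
            exact hL p (List.mem_cons_self ..)
    rw [accepted, e]
    refine key _ _ _ (fun p hp => ?_) hext
    rw [(mem_newRequests.1 (mem_newRequests_of_mem_filtered hp)).2]
    exact h

/-! ### The algorithm is online: nothing depends on later requests. -/

theorem queue_append_of_none {acc ext : List (Entry N)} {loc : Entry N → Location}
    (h : ∀ b ∈ ext, loc b = none) (T : Tiling) (m : Move) (v t : ℕ) :
    queue (acc ++ ext) loc T m v t = queue acc loc T m v t := by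
  classical
  have : (ext.filter fun b =>
      decide (b.InTiling T ∧ (loc b).map Prod.fst = some v ∧ b.want v t = m)) = [] := by
    rw [List.filter_eq_nil_iff]
    intro b hb
    simp [h b hb]
  simp only [queue, List.filter_append, this, List.append_nil]

theorem crossbar_append {acc ext : List (Entry N)} {s : ℕ} (h : ∀ b ∈ ext, s < b.req.time) (v : ℕ)
    (a : Entry N) : crossbar (acc ++ ext) (location acc s) v s a =
      crossbar acc (location acc s) v s a := by
  unfold crossbar
  cases a.route with
  | near => rfl
  | far T p d =>
    have hn : ∀ b ∈ ext, location acc s b = none := fun b hb => location_eq_none_of_lt (h b hb)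
    simp only [queue_append_of_none hn]

/-- The locations in step `s` do not depend on the requests of later steps. -/
theorem location_append {acc ext : List (Entry N)} {s : ℕ} (h : ∀ b ∈ ext, s < b.req.time) :
    location (acc ++ ext) s = location acc s := by
  induction s with
  | zero => rfl
  | succ s ih =>
    have ih := ih fun b hb => by have := h b hb; omega
    funext a
    simp only [location, ih, crossbar_append (acc := acc) (ext := ext) (s := s)
      (fun b hb => by have := h b hb; omega)]

theorem exists_eq_received_append {R : List (Request N)} (hR : IsRequestSequence R) (t : ℕ) :
    ∃ rest, R = received R t ++ rest ∧ ∀ r ∈ rest, t < r.time := by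
  refine ⟨R.filter fun r => t < r.time, ?_, fun r hr => by simpa using (List.mem_filter.1 hr).2⟩
  unfold received
  have h := hR.1
  clear hR
  induction R with
  | nil => rfl
  | cons r R ih =>
    rw [List.pairwise_cons] at h
    by_cases hr : r.time ≤ t
    · simp only [List.filter_cons, hr, decide_true, if_true, not_lt.2 hr, decide_false,
        List.cons_append]
      simpa using ih h.2
    · have h1 : R.filter (fun r => decide (r.time ≤ t)) = [] := by
        rw [List.filter_eq_nil_iff]
        intro s hs
        have := h.1 s hs
        simp only [decide_eq_true_eq]
        omega
      have h2 : R.filter (fun r => decide (t < r.time)) = R := by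
        rw [List.filter_eq_self]
        intro s hs
        have := h.1 s hs
        simp only [decide_eq_true_eq]
        omega
      simp [hr, not_le.1 hr, h1, h2]

/-- The received requests form an initial segment of the sequence, so the packets keep their
numbers. -/
theorem newRequests_received {R : List (Request N)} (hR : IsRequestSequence R) {s t : ℕ}
    (h : s ≤ t) : newRequests (received R t) s = newRequests R s := by
  obtain ⟨rest, e, hrest⟩ := exists_eq_received_append hR t
  have : (R.zipIdx.filter fun p => p.1.time = s) =
      (received R t).zipIdx.filter fun p => p.1.time = s := by
    conv_lhs => rw [e]
    rw [List.zipIdx_append, List.filter_append]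
    convert List.append_nil _
    rw [List.filter_eq_nil_iff]
    intro p hp
    have := hrest p.1 (List.fst_mem_of_mem_zipIdx hp)
    simp only [decide_eq_true_eq]
    omega
  unfold newRequests
  rw [this]

theorem accepted_received {R : List (Request N)} (hR : IsRequestSequence R) {s t : ℕ}
    (h : s ≤ t + 1) : accepted (received R t) s = accepted R s := by
  induction s with
  | zero => rfl
  | succ s ih =>
    simp only [accepted, ih (by omega), filteredRequests, newRequests_received hR (show s ≤ t by omega)]

/-! ## The schedule -/

section

variable {R : List (Request N)} {τ : ℕ}

/-- The action that the algorithm takes on an accepted packet. -/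
theorem schedule_of_location (hR : IsRequestSequence R)
    (hnd : ((accepted R τ).map Entry.idx).Nodup)
    {a : Entry N} (ha : a ∈ accepted R τ) {t v : ℕ} {o : Option Move} (ht : t < τ)
    (hl : location (accepted R τ) t a = some (v, o)) :
    (routingAlgorithm N).schedule R t a.idx =
      (crossbar (accepted R τ) (location (accepted R τ) t) v t a).toAction := by
  obtain ⟨ext, e, hext⟩ := accepted_append R (show t + 1 ≤ τ from ht)
  have hext' : ∀ b ∈ ext, t < b.req.time := fun b hb => hext b hb
  have hloc := location_append (acc := accepted R (t + 1)) hext'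
  rw [← e] at hloc
  -- A packet that has a location in step `t` was input by then, so it is not among the later
  -- acceptances.
  have hmem : a ∈ accepted R (t + 1) := by
    rw [e] at ha
    rcases List.mem_append.1 ha with h | h
    · exact h
    · have := hext' a h
      have := time_le_of_location hl
      omega
  have hfind : (accepted R (t + 1)).find? (fun b => b.idx = a.idx) = some a := by
    cases hf : (accepted R (t + 1)).find? (fun b => b.idx = a.idx) with
    | none => simpa using List.find?_eq_none.1 hf a hmem
    | some b =>
      have h1 : b.idx = a.idx := by simpa using List.find?_some hf
      have h2 := List.mem_of_find?_eq_some hf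
      rw [eq_of_idx_eq hnd (e ▸ List.mem_append_left _ h2) ha h1]
  have hc := crossbar_append (acc := accepted R (t + 1)) hext' v a
  rw [← e] at hc
  rw [hloc] at hl
  rw [hloc, hc]
  simp only [OnlineAlgorithm.schedule, routingAlgorithm, accepted_received hR le_rfl, hfind, hl]

theorem schedule_of_not_accepted (hR : IsRequestSequence R) {t i : ℕ} (ht : t < τ)
    (h : ∀ a ∈ accepted R τ, a.idx ≠ i) : (routingAlgorithm N).schedule R t i = .drop := by
  obtain ⟨ext, e, hext⟩ := accepted_append R (show t + 1 ≤ τ from ht)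
  have hfind : (accepted R (t + 1)).find? (fun b => b.idx = i) = none := by
    rw [List.find?_eq_none]
    intro b hb
    simpa using h b (e ▸ List.mem_append_left _ hb)
  simp only [OnlineAlgorithm.schedule, routingAlgorithm, accepted_received hR le_rfl, hfind]

theorem Request.status_of_lt {r : Request N} (act : ℕ → Action) {t : ℕ} (h : t < r.time) :
    r.status act t = .waiting := by
  induction t with
  | zero => simp [Request.status, h.ne']
  | succ t ih => simp [Request.status, h.ne', ih (by omega)]

theorem Request.status_time {r : Request N} (hr : r.src < r.dst) (act : ℕ → Action) :
    r.status act r.time = .inNetwork r.src := by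
  have hne : (r.src : ℕ) ≠ r.dst := by
    intro h
    exact absurd hr (by rw [Fin.lt_def, h]; simp)
  cases ht : r.time with
  | zero => simp [Request.status, ht, Request.arrive, hne]
  | succ t =>
    simp [Request.status, Request.status_of_lt act (show t < r.time by omega), ht,
      Request.arrive, hne]

/-- The status of an accepted packet is given by its location. -/
theorem status_of_accepted (hR : IsRequestSequence R)
    (hacc : Admissible (accepted R τ)) {a : Entry N} (ha : a ∈ accepted R τ) {t : ℕ} (ht : t ≤ τ)
    (hta : a.req.time ≤ t) :
    a.req.status (fun s => (routingAlgorithm N).schedule R s a.idx) t =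
      match location (accepted R τ) t a with
      | none => .delivered
      | some (v, _) => .inNetwork v := by
  have hsd := hacc.src_lt a ha
  induction t, hta using Nat.le_induction with
  | base => rw [Request.status_time hsd, location_time]
  | succ t hta ih =>
    have ih := ih (by omega)
    cases hl : location (accepted R τ) t a with
    | none =>
      rw [hl] at ih
      have : location (accepted R τ) (t + 1) a = none := by
        simp [location, hl, show a.req.time ≠ t + 1 by omega]
      simp only at ih
      simp only [Request.status, ih, this]
    | some q =>
      obtain ⟨v, o⟩ := q
      rw [hl] at ih
      have hlt := lt_dst_of_location hsd hl
      simp only at ih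
      simp only [Request.status, ih, schedule_of_location hR hacc.nodup ha (show t < τ by omega) hl,
        location_succ hl]
      cases hc : crossbar (accepted R τ) (location (accepted R τ) t) v t a with
      | store => simp [Move.toAction, Move.node, Request.arrive, hlt.ne]
      | forward =>
        by_cases hd : v + 1 = (a.req.dst : ℕ) <;>
          simp [Move.toAction, Move.node, Request.arrive, hd]

/-- A step before which all requests are input. -/
def horizon (R : List (Request N)) : ℕ := (R.map Request.time).sum + 1

theorem time_lt_horizon {R : List (Request N)} {r : Request N} (h : r ∈ R) : r.time < horizon R :=
  Nat.lt_succ_of_le (List.le_sum_of_mem (List.mem_map_of_mem h))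

/-- All requests that are ever accepted. -/
def allAccepted (R : List (Request N)) : List (Entry N) := accepted R (horizon R)

theorem accepted_eq_allAccepted (R : List (Request N)) {τ : ℕ} (h : horizon R ≤ τ) :
    accepted R τ = allAccepted R := by
  obtain ⟨ext, e, hext⟩ := accepted_append R h
  have : ext = [] := by
    rw [List.eq_nil_iff_forall_not_mem]
    intro a ha
    have h1 := hext a ha
    have h2 : a ∈ accepted R τ := e ▸ List.mem_append_right _ ha
    have := time_lt_horizon (List.mem_of_getElem? (mem_accepted h2).1)
    omega
  rw [e, this, List.append_nil, allAccepted]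

theorem schedule_of_mem_allAccepted (hR : IsRequestSequence R)
    (hnd : ((allAccepted R).map Entry.idx).Nodup)
    {a : Entry N} (ha : a ∈ allAccepted R) {t v : ℕ} {o : Option Move}
    (hl : location (allAccepted R) t a = some (v, o)) :
    (routingAlgorithm N).schedule R t a.idx =
      (crossbar (allAccepted R) (location (allAccepted R) t) v t a).toAction := by
  rw [← accepted_eq_allAccepted R (le_max_left _ (t + 1))] at *
  exact schedule_of_location hR hnd ha (by omega) hl

theorem status_of_mem_allAccepted (hR : IsRequestSequence R) (hacc : Admissible (allAccepted R))
    {a : Entry N} (ha : a ∈ allAccepted R) {t : ℕ} (hta : a.req.time ≤ t) :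
    a.req.status (fun s => (routingAlgorithm N).schedule R s a.idx) t =
      match location (allAccepted R) t a with
      | none => .delivered
      | some (v, _) => .inNetwork v := by
  rw [← accepted_eq_allAccepted R (le_max_left _ t)] at *
  exact status_of_accepted hR hacc ha (by omega) hta

theorem schedule_of_not_mem_allAccepted (hR : IsRequestSequence R) {i : ℕ} (t : ℕ)
    (h : ∀ a ∈ allAccepted R, a.idx ≠ i) : (routingAlgorithm N).schedule R t i = .drop := by
  rw [← accepted_eq_allAccepted R (le_max_left _ (t + 1))] at h
  exact schedule_of_not_accepted hR (by omega) h

theorem req_of_mem_allAccepted {a : Entry N} (ha : a ∈ allAccepted R) :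
    ∃ h : a.idx < R.length, R.get ⟨a.idx, h⟩ = a.req := by
  obtain ⟨h, e⟩ := List.getElem?_eq_some_iff.1 (mem_accepted ha).1
  exact ⟨h, e⟩

theorem status_eq_dropped {r : Request N} (hr : r.src < r.dst) {act : ℕ → Action}
    (h : act r.time = .drop) {t : ℕ} (ht : r.time < t) : r.status act t = .dropped := by
  induction t, ht using Nat.le_induction with
  | base => simp [Request.status, Request.status_time hr, h]
  | succ t ht ih => simp [Request.status, ih]

theorem src_lt_dst_get (hR : IsRequestSequence R) (i : Fin R.length) :
    (R.get i).src < (R.get i).dst := hR.2 _ (List.get_mem _ _)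

theorem rejected_of_not_accepted (hR : IsRequestSequence R) (i : Fin R.length)
    (h : ∀ a ∈ allAccepted R, a.idx ≠ i) :
    Rejected R ((routingAlgorithm N).schedule R) i :=
  status_eq_dropped (act := fun s => (routingAlgorithm N).schedule R s i) (src_lt_dst_get hR i)
    (schedule_of_not_mem_allAccepted hR _ h) (Nat.lt_succ_self _)

theorem delivered_of_mem_allAccepted (hR : IsRequestSequence R)
    (hacc : Admissible (allAccepted R)) (hN : N.Roomy) {a : Entry N} (ha : a ∈ allAccepted R)
    {i : Fin R.length} (hi : a.idx = i) : Delivered R ((routingAlgorithm N).schedule R) i := by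
  obtain ⟨h, e⟩ := req_of_mem_allAccepted ha
  obtain rfl : i = ⟨a.idx, h⟩ := Fin.ext hi.symm
  obtain ⟨t, ht, hl⟩ := exists_location_eq_none hacc hN ha
  refine ⟨t, ?_⟩
  rw [e, status_of_mem_allAccepted hR hacc ha ht, hl]

theorem nonpreemptive_schedule (hR : IsRequestSequence R)
    (hacc : Admissible (allAccepted R)) (hN : N.Roomy) :
    Nonpreemptive R ((routingAlgorithm N).schedule R) := by
  intro i hi
  by_cases h : ∃ a ∈ allAccepted R, a.idx = i
  · obtain ⟨a, ha, hai⟩ := h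
    exact delivered_of_mem_allAccepted hR hacc hN ha hai
  · push Not at h
    exact absurd (rejected_of_not_accepted hR i h) hi

theorem length_le_throughput (hR : IsRequestSequence R)
    (hacc : Admissible (allAccepted R)) (hN : N.Roomy) :
    (allAccepted R).length ≤ throughput R ((routingAlgorithm N).schedule R) := by
  classical
  have : (allAccepted R).length = ((allAccepted R).map Entry.idx).toFinset.card := by
    rw [List.toFinset_card_of_nodup hacc.nodup, List.length_map]
  rw [this]
  refine (Finset.card_le_card (t := (Finset.univ.filter fun i : Fin R.length =>
    Delivered R ((routingAlgorithm N).schedule R) i).image Fin.val) fun j hj => ?_).trans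
    Finset.card_image_le
  rw [List.mem_toFinset, List.mem_map] at hj
  obtain ⟨a, ha, rfl⟩ := hj
  obtain ⟨h, -⟩ := req_of_mem_allAccepted ha
  exact Finset.mem_image.2 ⟨⟨a.idx, h⟩, by
    simpa using delivered_of_mem_allAccepted hR hacc hN ha rfl, rfl⟩

theorem Move.toAction_injective : Function.Injective Move.toAction := by
  intro a b h
  cases a <;> cases b <;> simp_all [Move.toAction]

/-- One track for near packets, which are never stored, and one for each of the four tilings. -/
theorem numActing_le (hR : IsRequestSequence R)
    (hacc : Admissible (allAccepted R)) (hN : N.Roomy) (m : Move) (v t : ℕ) :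
    numActing R ((routingAlgorithm N).schedule R) m.toAction v t ≤
      (if m = .forward then N.trackC else 0) + 4 * N.trackCap m := by
  classical
  set acc := allAccepted R with hacc'
  have hmem : ∀ i : Fin R.length,
      (R.get i).status (fun s => (routingAlgorithm N).schedule R s i) t = .inNetwork v →
      (routingAlgorithm N).schedule R t i = m.toAction →
      ∃ a ∈ acc, a.idx = i ∧ (∃ o, location acc t a = some (v, o)) ∧
        crossbar acc (location acc t) v t a = m := by
    intro i h1 h2
    by_cases h : ∃ a ∈ acc, a.idx = i
    · obtain ⟨a, ha, hai⟩ := h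
      obtain ⟨h, e⟩ := req_of_mem_allAccepted ha
      obtain rfl : i = ⟨a.idx, h⟩ := Fin.ext hai.symm
      have ht : a.req.time ≤ t := by
        by_contra hc
        rw [e, Request.status_of_lt _ (by omega)] at h1
        simp at h1
      rw [e, status_of_mem_allAccepted hR hacc ha ht] at h1
      cases hl : location acc t a with
      | none => rw [hl] at h1; simp at h1
      | some q =>
        obtain ⟨v', o⟩ := q
        rw [hl] at h1
        obtain rfl : v' = v := by simpa using h1
        refine ⟨a, ha, rfl, ⟨o, hl⟩, ?_⟩
        simp only at h2
        rw [schedule_of_mem_allAccepted hR hacc.nodup ha hl] at h2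
        exact Move.toAction_injective h2
    · push Not at h
      rw [schedule_of_not_mem_allAccepted hR t h] at h2
      cases m <;> simp [Move.toAction] at h2
  set near : Finset (Entry N) := acc.toFinset.filter fun a => a.route = .near ∧
    (∃ o, location acc t a = some (v, o)) ∧ m = .forward with hnear
  set S : Finset (Entry N) := near ∪
    ((Finset.univ : Finset Tiling).biUnion fun T => movers acc T m v t) with hS
  have h1 : numActing R ((routingAlgorithm N).schedule R) m.toAction v t ≤ S.card := by
    unfold numActing
    refine le_trans ?_ (Finset.card_image_le (s := S) (f := Entry.idx))
    rw [← Finset.card_image_of_injective _ Fin.val_injective]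
    refine Finset.card_le_card fun j hj => ?_
    obtain ⟨i, hi, rfl⟩ := Finset.mem_image.1 hj
    obtain ⟨hi1, hi2⟩ := (Finset.mem_filter.1 hi).2
    obtain ⟨a, ha, hai, hl, hc⟩ := hmem i hi1 hi2
    refine Finset.mem_image.2 ⟨a, ?_, hai⟩
    cases hr : a.route with
    | near =>
      refine Finset.mem_union_left _ (Finset.mem_filter.2 ⟨List.mem_toFinset.2 ha, hr, hl, ?_⟩)
      rw [← hc]
      simp [crossbar, hr]
    | far T p d =>
      exact Finset.mem_union_right _ (Finset.mem_biUnion.2 ⟨T, Finset.mem_univ _,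
        mem_movers.2 ⟨⟨ha, Entry.inTiling_iff.2 ⟨p, d, hr⟩, hl⟩, hc⟩⟩)
  have h2 : near.card ≤ if m = .forward then N.trackC else 0 := by
    split_ifs with hm
    · refine le_trans ?_ (hacc.nearLoad_le ((v, t), .forward))
      unfold nearLoad
      rw [countP_eq_card_filter (nodup_of_idx hacc.nodup) _ (fun b => b.route = .near ∧
        ((v, t), .forward) ∈ pathEdges b.req.src b.req.time b.req.straight)]
      · refine Finset.card_le_card fun b hb => ?_
        obtain ⟨hb, hr, ⟨o, hl⟩, -⟩ := Finset.mem_filter.1 hb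
        have hba := List.mem_toFinset.1 hb
        refine Finset.mem_filter.2 ⟨hb, hr, mem_pathEdges_straight.2 ⟨t - b.req.time, ?_, ?_⟩⟩
        all_goals
          have h1 := location_near hr hl
          have h2 := lt_dst_of_location (hacc.src_lt b hba) hl
          have h3 := time_le_of_location hl
        · omega
        · simp only [Prod.mk.injEq, and_true]
          omega
      · intro b
        cases h : b.route <;> simp
    · rw [hnear]
      simp [hm]
  have h3 : ((Finset.univ : Finset Tiling).biUnion fun T => movers acc T m v t).card ≤
      4 * N.trackCap m := by
    refine (Finset.card_biUnion_le_card_mul _ _ (N.trackCap m) fun T _ =>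
      (capRespected_and_allOnTrack hacc hN t).1 T m v).trans ?_
    simp
  exact h1.trans ((Finset.card_union_le _ _).trans (add_le_add h2 h3))

theorem feasible_schedule (hR : IsRequestSequence R)
    (hacc : Admissible (allAccepted R)) (hN : N.Roomy) :
    Feasible R ((routingAlgorithm N).schedule R) := by
  intro v t
  constructor
  · split_ifs with hv
    · refine (numActing_le hR hacc hN .forward v t).trans ?_
      simp only [if_true, Network.trackCap, Network.trackC]
      omega
    · unfold numActing
      -- There is no link here, but a packet in the network is strictly below its destination and so
      -- never at the last node.
      rw [Nat.le_zero, Finset.card_eq_zero, Finset.filter_eq_empty_iff]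
      rintro i - ⟨h1, h2⟩
      have hlt := (R.get i).dst.2
      by_cases h : ∃ a ∈ allAccepted R, a.idx = i
      · obtain ⟨a, ha, hai⟩ := h
        obtain ⟨h, e⟩ := req_of_mem_allAccepted ha
        obtain rfl : i = ⟨a.idx, h⟩ := Fin.ext hai.symm
        rw [e] at h1 hlt
        have ht : a.req.time ≤ t := by
          by_contra hc
          rw [Request.status_of_lt _ (by omega)] at h1
          simp at h1
        rw [status_of_mem_allAccepted hR hacc ha ht] at h1
        cases hl : location (allAccepted R) t a with
        | none => rw [hl] at h1; simp at h1
        | some q =>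
          rw [hl] at h1
          have h3 := lt_dst_of_location (hacc.src_lt a ha) hl
          have : q.1 = v := by simpa using h1
          omega
      · push Not at h
        rw [schedule_of_not_mem_allAccepted hR t h] at h2
        simp at h2
  · refine (numActing_le hR hacc hN .store v t).trans ?_
    simp only [reduceCtorEq, if_false, Network.trackCap, Network.trackB]
    omega

end

/-! ## Edge weights of the sketch graphs -/

/-- The weight of an edge of the sketch graph of `T`. -/
def edgeWeight (acc : List (Entry N)) (T : Tiling) (e : SketchEdge) : ℝ :=
  ((2 : ℝ) ^ sketchLoad acc T e - 1) / N.pmax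

theorem edgeWeight_nonneg (hp : 0 ≤ N.pmax) (acc : List (Entry N)) (T : Tiling) (e : SketchEdge) :
    0 ≤ edgeWeight acc T e := sketchWeight_term_nonneg hp _

theorem sketchWeight_eq (acc : List (Entry N)) (T : Tiling) (r : Request N) (p : List Move) :
    sketchWeight acc T r p = ((sketchEdges (r.sourceTile T) p).map (edgeWeight acc T)).sum := rfl

/-! ### Paths in the sketch graph and in the grid. -/

theorem length_sketchEdges (s : ℤ × ℤ) (p : List Move) : (sketchEdges s p).length = p.length := by
  induction p generalizing s with
  | nil => rfl
  | cons m p ih => simp [sketchEdges, ih]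

theorem le_of_mem_sketchEdges {s : ℤ × ℤ} {p : List Move} {e : SketchEdge}
    (h : e ∈ sketchEdges s p) : s.1 + s.2 ≤ e.1.1 + e.1.2 := by
  induction p generalizing s with
  | nil => simp [sketchEdges] at h
  | cons m p ih =>
    rcases List.mem_cons.1 h with rfl | h
    · exact le_rfl
    · have := ih h
      cases m <;> simp only [Move.nextTile] at this <;> omega

theorem sketchEdges_nodup (s : ℤ × ℤ) (p : List Move) : (sketchEdges s p).Nodup := by
  induction p generalizing s with
  | nil => simp [sketchEdges]
  | cons m p ih =>
    refine List.nodup_cons.2 ⟨fun h => ?_, ih _⟩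
    have := le_of_mem_sketchEdges h
    cases m <;> simp only [Move.nextTile] at this <;> omega

theorem le_of_mem_pathEdges {v t : ℕ} {w : List Move} {e : STEdge} (h : e ∈ pathEdges v t w) :
    t ≤ e.1.2 := by
  induction w generalizing v t with
  | nil => simp [pathEdges] at h
  | cons m w ih =>
    rcases List.mem_cons.1 h with rfl | h
    · exact le_rfl
    · have := ih h
      omega

theorem pathEdges_nodup (v t : ℕ) (w : List Move) : (pathEdges v t w).Nodup := by
  induction w generalizing v t with
  | nil => simp [pathEdges]
  | cons m w ih =>
    refine List.nodup_cons.2 ⟨fun h => ?_, ih _ _⟩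
    have := le_of_mem_pathEdges h
    simp only at this
    omega

theorem node_le_of_mem_pathEdges {v t : ℕ} {w : List Move} {e : STEdge} (h : e ∈ pathEdges v t w) :
    e.1.1 ≤ v + w.count .forward := by
  induction w generalizing v t with
  | nil => simp [pathEdges] at h
  | cons m w ih =>
    rcases List.mem_cons.1 h with rfl | h
    · exact Nat.le_add_right _ _
    · have := ih h
      cases m <;> simp [Move.node] at this ⊢ <;> omega

theorem pathEdges_append (v t : ℕ) (w w' : List Move) :
    pathEdges v t (w ++ w') =
      pathEdges v t w ++ pathEdges (v + w.count .forward) (t + w.length) w' := by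
  induction w generalizing v t with
  | nil => simp [pathEdges]
  | cons m w ih =>
    simp only [List.cons_append, pathEdges, ih, List.length_cons]
    congr 3
    · cases m <;> simp [Move.node]; omega
    · omega

/-- The total weight of the sketch edges is at most twice the number of accepted requests. -/
theorem sum_edgeWeight_le (hp : 0 < N.pmax) (L : List (Request N × ℕ)) (T : Tiling)
    (F : Finset SketchEdge) :
    ∑ e ∈ F, edgeWeight (processAll L) T e ≤ 2 * (processAll L).length := by
  classical
  induction L using List.reverseRecOn with
  | nil => simp [processAll, edgeWeight, sketchLoad]
  | append_singleton L p ih =>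
    rw [processAll_concat]
    rcases processRequest_cases (processAll L) p with ⟨h, -⟩ | ⟨ρ, h, hg⟩
    · rwa [h]
    rw [h, List.length_append, List.length_singleton]
    push_cast
    set acc := processAll L
    have hsame : (∀ e, sketchLoad (acc ++ [⟨p.2, p.1, ρ⟩]) T e = sketchLoad acc T e) →
        ∑ e ∈ F, edgeWeight (acc ++ [⟨p.2, p.1, ρ⟩]) T e ≤ 2 * ((acc.length : ℝ) + 1) := by
      intro h
      simp only [edgeWeight, h]
      simp only [edgeWeight] at ih
      linarith
    cases ρ with
    | near => exact hsame fun e => by rw [sketchLoad_append, sketchLoad_singleton_near, add_zero]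
    | far T' q d =>
      by_cases hT : T' = T
      · subst hT
        set E := (sketchEdges (p.1.sourceTile T') q) with hE
        -- Adding one to the load turns the weight `x` into `2 * x + 1 / pmax`.
        have hstep : ∀ e, edgeWeight (acc ++ [⟨p.2, p.1, .far T' q d⟩]) T' e =
            edgeWeight acc T' e + if e ∈ E then edgeWeight acc T' e + 1 / N.pmax else 0 := by
          intro e
          simp only [edgeWeight, sketchLoad_append, sketchLoad_singleton_far, true_and, ← hE]
          split_ifs
          · field_simp
            ring
          · simp
        have hw : (E.map (edgeWeight acc T')).sum < 1 := hg.2.2.2.1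
        have hlen : (E.length : ℝ) ≤ N.pmax := by
          rw [hE, length_sketchEdges]
          exact hg.2.2.1.2
        -- The old weights along the path sum to less than 1, and its at most `pmax` edges
        -- contribute `1 / pmax` each.
        have hsum : ∑ e ∈ F, (if e ∈ E then edgeWeight acc T' e + 1 / N.pmax else 0) ≤ 2 := by
          calc _ ≤ ∑ e ∈ E.toFinset, (edgeWeight acc T' e + 1 / N.pmax) := by
                rw [← Finset.sum_filter]
                refine Finset.sum_le_sum_of_subset_of_nonneg (fun e he => ?_) fun e _ _ => ?_
                · simpa using (Finset.mem_filter.1 he).2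
                · have := edgeWeight_nonneg hp.le acc T' e
                  positivity
            _ = (E.map (edgeWeight acc T')).sum + E.length / N.pmax := by
                rw [Finset.sum_add_distrib, List.sum_toFinset _ (sketchEdges_nodup _ _),
                  Finset.sum_const, List.toFinset_card_of_nodup (sketchEdges_nodup _ _)]
                simp [div_eq_mul_inv, E]
            _ ≤ 1 + 1 := add_le_add hw.le ((div_le_one hp).2 hlen)
            _ = 2 := by norm_num
        simp only [hstep, Finset.sum_add_distrib]
        linarith
      · exact hsame fun e => by rw [sketchLoad_append, sketchLoad_singleton_far]; simp [hT]

/-! ## Sketches of paths -/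

open scoped Classical in
/-- The moves of a path of the grid that lead to another tile. -/
def sketchOf (N : Network) (T : Tiling) : ℕ → ℕ → List Move → List Move
  | _, _, [] => []
  | v, t, m :: w =>
    if N.tile T (m.node v) (t + 1) ≠ N.tile T v t then m :: sketchOf N T (m.node v) (t + 1) w
    else sketchOf N T (m.node v) (t + 1) w

theorem Network.tile_node (hN : ∀ m, 0 < N.half m) (T : Tiling) (m : Move) (v t : ℕ)
    (h : N.tile T (m.node v) (t + 1) ≠ N.tile T v t) :
    N.tile T (m.node v) (t + 1) = m.nextTile (N.tile T v t) ∧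
      N.posIn T m v t = 2 * N.half m - 1 := by
  rcases Network.move_cases hN T m v t with ⟨hq, -⟩ | ⟨h1, h2, ⟨-, -, h3⟩ | ⟨h3, h4, h5⟩⟩
  · exact absurd hq.tile.symm h
  · exact absurd h3 h
  · have h6 := Network.quadPos_cases hN T m v t
    simp only [h3, true_and, not_true, false_and, or_false] at h6
    exact ⟨h5, by omega⟩

theorem walk_sketchOf (hN : ∀ m, 0 < N.half m) (T : Tiling) (v t : ℕ) (w : List Move) :
    walk (N.tile T v t) (sketchOf N T v t w) =
      N.tile T (v + w.count .forward) (t + w.length) := by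
  induction w generalizing v t with
  | nil => rfl
  | cons m w ih =>
    have e : N.tile T (m.node v + w.count .forward) (t + 1 + w.length) =
        N.tile T (v + (m :: w).count .forward) (t + (m :: w).length) := by
      congr 1
      · cases m <;> simp [Move.node]; omega
      · simp; omega
    unfold sketchOf
    split_ifs with h
    · rw [walk_cons, ← (Network.tile_node hN T m v t h).1, ih, e]
    · rw [not_not] at h
      rw [← h, ih, e]

/-- This turns a bound on the moves of a grid path into a length bound for its sketch, making it a
legal sketch path. -/
theorem count_sketchOf_le (T : Tiling) (m : Move) (v t : ℕ) (w : List Move) :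
    (sketchOf N T v t w).count m ≤ w.count m := by
  induction w generalizing v t with
  | nil => rfl
  | cons d w ih =>
    unfold sketchOf
    have := ih (d.node v) (t + 1)
    split_ifs
    · rw [List.count_cons, List.count_cons]
      omega
    · rw [List.count_cons]
      omega

theorem tileRow_add_count_sketchOf (hN : ∀ m, 0 < N.half m) (T : Tiling) (v t : ℕ)
    (w : List Move) : N.tileRow T v + (sketchOf N T v t w).count .forward =
      N.tileRow T (v + w.count .forward) := by
  have := walk_sketchOf hN T v t w
  rw [walk_eq] at this
  exact congrArg Prod.snd this

/-- The column `X` of tiles is heavy if its edges to the north have large total weight. -/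
def HeavyColumn (acc : List (Entry N)) (T : Tiling) (X : ℤ) : Prop :=
  1 / 2 ≤ ∑ Y ∈ Finset.Ico (N.tileRow T 0) (N.tileRow T N.n), edgeWeight acc T ((X, Y), .forward)

open scoped Classical in
/-- The weight of a grid edge that leads to another tile. -/
def crossWeight (acc : List (Entry N)) (T : Tiling) (e : STEdge) : ℝ :=
  if N.tile T (e.2.node e.1.1) (e.1.2 + 1) ≠ N.tile T e.1.1 e.1.2 then
    edgeWeight acc T (N.tile T e.1.1 e.1.2, e.2)
  else 0

open scoped Classical in
/-- The weight of a store edge in a heavy column. -/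
def heavyWeight (acc : List (Entry N)) (T : Tiling) (e : STEdge) : ℝ :=
  if e.2 = .store ∧ HeavyColumn acc T (N.tile T e.1.1 e.1.2).1 then N.c / (N.n * N.B) else 0

/-- A dual solution: the prices of the edges of the grid. -/
def price (acc : List (Entry N)) (T : Tiling) (e : STEdge) : ℝ :=
  2 * crossWeight acc T e + heavyWeight acc T e

theorem crossWeight_nonneg (hp : 0 ≤ N.pmax) (acc : List (Entry N)) (T : Tiling) (e : STEdge) :
    0 ≤ crossWeight acc T e := by
  unfold crossWeight
  split_ifs
  · exact edgeWeight_nonneg hp _ _ _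
  · exact le_rfl

theorem heavyWeight_nonneg (acc : List (Entry N)) (T : Tiling) (e : STEdge) :
    0 ≤ heavyWeight acc T e := by
  unfold heavyWeight
  split_ifs <;> positivity

theorem sum_crossWeight (hN : ∀ m, 0 < N.half m) (acc : List (Entry N)) (T : Tiling) (v t : ℕ)
    (w : List Move) : ((pathEdges v t w).map (crossWeight acc T)).sum =
      ((sketchEdges (N.tile T v t) (sketchOf N T v t w)).map (edgeWeight acc T)).sum := by
  induction w generalizing v t with
  | nil => rfl
  | cons m w ih =>
    rw [pathEdges, List.map_cons, List.sum_cons, ih, sketchOf]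
    simp only [crossWeight]
    split_ifs with h
    · rw [sketchEdges, List.map_cons, List.sum_cons, ← (Network.tile_node hN T m v t h).1]
    · rw [not_not] at h
      rw [zero_add, h]

theorem sum_heavyWeight (acc : List (Entry N)) (T : Tiling) (v t : ℕ) (u : List Move)
    (h : ∀ u₁ u₂, u = u₁ ++ .store :: u₂ →
      HeavyColumn acc T (N.tile T (v + u₁.count .forward) (t + u₁.length)).1) :
    ((pathEdges v t u).map (heavyWeight acc T)).sum = u.count .store * (N.c / (N.n * N.B)) := by
  induction u generalizing v t with
  | nil => simp [pathEdges]
  | cons m u ih =>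
    rw [pathEdges, List.map_cons, List.sum_cons, ih]
    · cases m with
      | forward => simp [heavyWeight]
      | store =>
        have := h [] u rfl
        simp only [List.count_nil, List.length_nil, add_zero] at this
        simp only [heavyWeight, this, true_and, if_true, List.count_cons_self]
        push_cast
        ring
    · intro u₁ u₂ e
      have := h (m :: u₁) u₂ (by simp [e])
      convert this using 3
      · cases m <;> simp [Move.node]; omega
      · simp; omega

theorem exists_prefix_count (m : Move) (w : List Move) {k : ℕ} (h : k ≤ w.count m) :
    ∃ u u', w = u ++ u' ∧ u.count m = k := by
  induction w generalizing k with
  | nil => exact ⟨[], [], rfl, by simp at h; simp [h]⟩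
  | cons d w ih =>
    cases k with
    | zero => exact ⟨[], d :: w, rfl, rfl⟩
    | succ k =>
      by_cases hd : d = m
      · subst hd
        rw [List.count_cons_self] at h
        obtain ⟨u, u', e, hu⟩ := ih (Nat.le_of_succ_le_succ h)
        exact ⟨d :: u, u', by simp [e], by simp [hu]⟩
      · rw [List.count_cons_of_ne hd] at h
        obtain ⟨u, u', e, hu⟩ := ih h
        exact ⟨d :: u, u', by simp [e], by rw [List.count_cons_of_ne hd, hu]⟩

theorem sum_map_pathEdges_append_ge {W : STEdge → ℝ} (hW : ∀ e, 0 ≤ W e) (v t : ℕ)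
    (u u' : List Move) :
    ((pathEdges v t u).map W).sum ≤ ((pathEdges v t (u ++ u')).map W).sum := by
  rw [pathEdges_append, List.map_append, List.sum_append]
  have : 0 ≤ ((pathEdges (v + u.count .forward) (t + u.length) u').map W).sum := by
    apply List.sum_nonneg
    intro x hx
    obtain ⟨e, -, rfl⟩ := List.mem_map.1 hx
    exact hW e
  linarith

theorem tileRow_mono (T : Tiling) : Monotone (N.tileRow T) := by
  intro v v' h
  unfold Network.tileRow
  rcases Nat.eq_zero_or_pos N.tileV with h0 | h0
  · simp [h0]
  · exact Int.ediv_le_ediv (by exact_mod_cast h0) (by omega)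

/-- The edges of a straight sketch path to the north. -/
theorem mem_sketchEdges_replicate_forward {s : ℤ × ℤ} {k : ℕ} {e : SketchEdge}
    (h : e ∈ sketchEdges s (List.replicate k .forward)) :
    ∃ Y, s.2 ≤ Y ∧ Y < s.2 + k ∧ e = ((s.1, Y), .forward) := by
  induction k generalizing s with
  | zero => simp [sketchEdges] at h
  | succ k ih =>
    rw [List.replicate_succ] at h
    rcases List.mem_cons.1 h with rfl | h
    · exact ⟨s.2, le_rfl, by push_cast; omega, rfl⟩
    · obtain ⟨Y, h1, h2, rfl⟩ := ih h
      simp only [Move.nextTile] at h1 h2 ⊢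
      exact ⟨Y, by omega, by push_cast; omega, rfl⟩

/-- If path packing rejects a request, then every path to its destination row is expensive,
however long it is. -/
theorem one_le_sum_price (hN : ∀ m, 0 < N.half m) (hB : 0 < N.B) (hc : 0 < N.c)
    {acc : List (Entry N)} {T : Tiling} {r : Request N} (hsd : r.src < r.dst)
    (hr : ∀ p, r.IsSketchPath T p → 1 ≤ sketchWeight acc T r p) {w : List Move}
    (hw : (r.dst : ℕ) ≤ r.src + w.count .forward) :
    1 ≤ ((pathEdges r.src r.time w).map (price acc T)).sum := by
  have hn : 0 < N.n := r.dst.pos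
  have hn' : (0 : ℝ) < N.n := by exact_mod_cast hn
  have hB' : (0 : ℝ) < N.B := by exact_mod_cast hB
  have hc' : (0 : ℝ) < N.c := by exact_mod_cast hc
  have hp : 0 ≤ N.pmax := by unfold Network.pmax; positivity
  have hdst := r.dst.2
  -- `M` stores at the heavy price `c/(nB)` cost at least 1, yet a sketch with at most `M` stores
  -- and `n` forward moves is still within `pmax`.
  set M : ℕ := ⌈(N.n * N.B / N.c : ℝ)⌉₊ with hM
  have hM1 : (1 : ℝ) ≤ M * (N.c / (N.n * N.B)) := by
    have : (N.n * N.B / N.c : ℝ) ≤ M := Nat.le_ceil _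
    rw [div_le_iff₀ hc'] at this
    rw [← mul_div_assoc, le_div_iff₀ (by positivity)]
    linarith
  have hM2 : (M : ℝ) + N.n ≤ N.pmax := by
    have h1 : (M : ℝ) < N.n * N.B / N.c + 1 := Nat.ceil_lt_add_one (by positivity)
    have h2 : (1 : ℝ) ≤ N.n := by exact_mod_cast hn
    have h3 : N.pmax = 2 * N.n + 2 * (N.n * N.B / N.c) := by unfold Network.pmax; ring
    have h4 : (0 : ℝ) ≤ N.n * N.B / N.c := by positivity
    linarith
  have hW : ∀ e, 0 ≤ price acc T e := fun e => by
    unfold price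
    have := crossWeight_nonneg hp acc T e
    have := heavyWeight_nonneg acc T e
    positivity
  have hcross : ∀ u, 2 * ((pathEdges r.src r.time u).map (crossWeight acc T)).sum +
      ((pathEdges r.src r.time u).map (heavyWeight acc T)).sum =
      ((pathEdges r.src r.time u).map (price acc T)).sum := by
    intro u
    unfold price
    rw [List.sum_map_add, List.sum_map_mul_left]
  have hheavy0 : ∀ u, 0 ≤ ((pathEdges r.src r.time u).map (heavyWeight acc T)).sum := by
    intro u
    apply List.sum_nonneg
    intro x hx
    obtain ⟨e, -, rfl⟩ := List.mem_map.1 hx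
    exact heavyWeight_nonneg acc T e
  have hcross0 : ∀ u, 0 ≤ ((pathEdges r.src r.time u).map (crossWeight acc T)).sum := by
    intro u
    apply List.sum_nonneg
    intro x hx
    obtain ⟨e, -, rfl⟩ := List.mem_map.1 hx
    exact crossWeight_nonneg hp acc T e
  -- The path may lead beyond the row of the destination of `r`; it is cut off there, which only
  -- lowers its price.
  obtain ⟨w', w₂, rfl, hw'⟩ := exists_prefix_count .forward w
    (show (r.dst : ℕ) - r.src ≤ w.count .forward by omega)
  have hend : (r.src : ℕ) + w'.count .forward = r.dst := by
    have : (r.src : ℕ) < r.dst := hsd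
    omega
  refine le_trans ?_ (sum_map_pathEdges_append_ge hW _ _ w' w₂)
  have hrow' := tileRow_add_count_sketchOf hN T r.src r.time w'
  rw [hend] at hrow'
  have hfle := count_sketchOf_le (N := N) T .forward r.src r.time w'
  -- With few stores the sketch of the path is itself legal, so it has weight at least 1. Otherwise
  -- the prefix `u` with exactly `M` stores is already expensive.
  by_cases hs : w'.count .store ≤ M
  · have h1 := hr (sketchOf N T r.src r.time w') ⟨hrow', by
      have h1 := count_sketchOf_le (N := N) T .store r.src r.time w'
      have h2 := count_store_add_forward (sketchOf N T r.src r.time w')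
      have h3 : (sketchOf N T r.src r.time w').length ≤ M + N.n := by omega
      have h4 : ((sketchOf N T r.src r.time w').length : ℝ) ≤ M + N.n := by exact_mod_cast h3
      linarith⟩
    rw [sketchWeight_eq, Request.sourceTile, ← sum_crossWeight hN] at h1
    have := hheavy0 w'
    rw [← hcross]
    linarith
  · obtain ⟨u, u', rfl, hu⟩ := exists_prefix_count .store w' (show M ≤ w'.count .store by omega)
    refine le_trans ?_ (sum_map_pathEdges_append_ge hW _ _ u u')
    rw [← hcross]
    by_cases hhalf : 1 / 2 ≤ ((pathEdges r.src r.time u).map (crossWeight acc T)).sum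
    · have := hheavy0 u
      linarith
    · rw [sum_heavyWeight, hu]
      · have := hcross0 u
        linarith
      · rintro u₁ u₂ rfl
        set v := (r.src : ℕ) + u₁.count .forward with hv
        have hvd : v ≤ r.dst := by
          rw [← hend, List.count_append, List.count_append]
          omega
        have hrow := tileRow_add_count_sketchOf hN T r.src r.time u₁
        rw [← hv] at hrow
        have hle := tileRow_mono (N := N) T hvd
        set k := (N.tileRow T r.dst - N.tileRow T v).toNat with hk
        -- The shortcut: follow the sketch up to the current store, then go straight north to the
        -- row of the destination. It is legal, so its weight is at least 1.
        have hlt := hr (sketchOf N T r.src r.time u₁ ++ List.replicate k .forward) ⟨by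
          rw [List.count_append, List.count_replicate_self]
          push_cast
          omega, by
          have h1 := count_sketchOf_le (N := N) T .store r.src r.time u₁
          have h2 := count_store_add_forward (sketchOf N T r.src r.time u₁)
          have h3 : u₁.count .store ≤ M := by
            rw [← hu, List.count_append]
            omega
          have h4 : (sketchOf N T r.src r.time u₁ ++ List.replicate k Move.forward).length ≤
              M + N.n := by
            rw [List.length_append, List.length_replicate]
            omega
          have h5 : ((sketchOf N T r.src r.time u₁ ++ List.replicate k Move.forward).length : ℝ) ≤
              M + N.n := by exact_mod_cast h4
          linarith⟩
        rw [sketchWeight_eq, Request.sourceTile, sketchEdges_append, List.map_append,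
          List.sum_append, ← sum_crossWeight hN, walk_sketchOf hN, ← hv] at hlt
        have hmono := sum_map_pathEdges_append_ge (crossWeight_nonneg hp acc T) r.src r.time u₁
          (.store :: u₂)
        -- The part before the store weighs less than 1/2, so the straight part, which stays in the
        -- current column, weighs at least 1/2.
        have hcol : 1 / 2 ≤ ((sketchEdges (N.tile T v (r.time + u₁.length))
            (List.replicate k .forward)).map (edgeWeight acc T)).sum := by linarith
        refine hcol.trans ?_
        classical
        rw [← List.sum_toFinset _ (sketchEdges_nodup _ _)]
        have hinj : Function.Injective fun Y : ℤ =>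
            (((N.tile T v (r.time + u₁.length)).1, Y), Move.forward) := by
          intro Y Y' h
          simpa using h
        refine le_of_le_of_eq ?_ (Finset.sum_map (Finset.Ico (N.tileRow T 0) (N.tileRow T N.n))
          ⟨_, hinj⟩ (edgeWeight acc T))
        refine Finset.sum_le_sum_of_subset_of_nonneg (fun e he => ?_)
          fun e _ _ => edgeWeight_nonneg hp _ _ _
        obtain ⟨Y, h1, h2, rfl⟩ := mem_sketchEdges_replicate_forward (List.mem_toFinset.1 he)
        refine Finset.mem_map.2 ⟨Y, Finset.mem_Ico.2 ?_, rfl⟩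
        have h3 : (N.tile T v (r.time + u₁.length)).2 = N.tileRow T v := rfl
        have h4 := tileRow_mono (N := N) T (Nat.zero_le v)
        have h5 := tileRow_mono (N := N) T hdst.le
        omega

/-! ## The total price of the edges -/

theorem vertex_eq_of_coord_eq {v t v' t' : ℕ} (h : ∀ m, coord m v t = coord m v' t') :
    v = v' ∧ t = t' := by
  have h1 := h .store
  have h2 := h .forward
  simp only [coord] at h1 h2
  omega

theorem coord_eq_of_tileIdx_posIn_eq {T : Tiling} {m : Move} {v t v' t' : ℕ}
    (h : N.tileIdx T m v t = N.tileIdx T m v' t') (h' : N.posIn T m v t = N.posIn T m v' t') :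
    coord m v t = coord m v' t' := by
  have h1 := Network.posIn_add_mul_tileIdx (N := N) T m v t
  have h2 := Network.posIn_add_mul_tileIdx (N := N) T m v' t'
  rw [h, h'] at h1
  omega

theorem tileIdx_eq_of_tile_eq {T : Tiling} {v t v' t' : ℕ} (h : N.tile T v t = N.tile T v' t')
    (m : Move) : N.tileIdx T m v t = N.tileIdx T m v' t' := by
  rw [Network.tile_eq, Network.tile_eq, Prod.mk.injEq] at h
  cases m
  exacts [h.1, h.2]

/-- The number of grid edges between two adjacent tiles. -/
theorem card_crossing_le (hN : ∀ m, 0 < N.half m) (T : Tiling) (s : SketchEdge) (E : Finset STEdge)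
    (hE : ∀ e ∈ E, N.tile T (e.2.node e.1.1) (e.1.2 + 1) ≠ N.tile T e.1.1 e.1.2 ∧
      (N.tile T e.1.1 e.1.2, e.2) = s) : E.card ≤ 2 * N.half s.2.other := by
  have : E.card ≤ (Finset.Ico (0 : ℤ) (2 * N.half s.2.other : ℕ)).card := by
    -- A crossing edge starts at the last position of its tile in its own direction, so the
    -- transversal position determines it.
    refine Finset.card_le_card_of_injOn (fun e => N.posIn T s.2.other e.1.1 e.1.2) ?_ ?_
    · intro e _
      have h1 := Network.posIn_nonneg hN T s.2.other e.1.1 e.1.2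
      have h2 := Network.posIn_lt hN T s.2.other e.1.1 e.1.2
      simp only [Finset.coe_Ico, Set.mem_Ico]
      push_cast
      exact ⟨h1, h2⟩
    · intro e he e' he' hee
      obtain ⟨h1, h2⟩ := hE e he
      obtain ⟨h1', h2'⟩ := hE e' he'
      have hm : e.2 = s.2 := congrArg Prod.snd h2
      have hm' : e'.2 = s.2 := congrArg Prod.snd h2'
      have ht : N.tile T e.1.1 e.1.2 = N.tile T e'.1.1 e'.1.2 :=
        (congrArg Prod.fst h2).trans (congrArg Prod.fst h2').symm
      have h3 := (Network.tile_node hN T e.2 _ _ h1).2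
      have h3' := (Network.tile_node hN T e'.2 _ _ h1').2
      rw [hm] at h3
      rw [hm'] at h3'
      have hv := vertex_eq_of_coord_eq (v := e.1.1) (t := e.1.2) (v' := e'.1.1) (t' := e'.1.2) (by
        intro m
        rcases Move.eq_or_eq_other m s.2 with rfl | rfl
        · exact coord_eq_of_tileIdx_posIn_eq (tileIdx_eq_of_tile_eq ht _) (h3.trans h3'.symm)
        · exact coord_eq_of_tileIdx_posIn_eq (tileIdx_eq_of_tile_eq ht _) hee)
      exact Prod.ext (Prod.ext hv.1 hv.2) (hm.trans hm'.symm)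
  rwa [Int.card_Ico, sub_zero, Int.toNat_natCast] at this

theorem capacity_eq (e : STEdge) : N.capacity e = N.capacity ((0, 0), e.2) := rfl

/-- Grouping the crossing edges by sketch edge, the capacity between two adjacent tiles is at most
`D`, and the total sketch weight is at most twice the number of acceptances. -/
theorem sum_crossWeight_mul_capacity_le (hN : ∀ m, 0 < N.half m) (hp : 0 < N.pmax)
    (L : List (Request N × ℕ)) (T : Tiling) {D : ℝ}
    (hD : ∀ m, (2 * N.half m.other * N.capacity ((0, 0), m) : ℝ) ≤ D) (E : Finset STEdge) :
    ∑ e ∈ E, crossWeight (processAll L) T e * N.capacity e ≤ 2 * D * (processAll L).length := by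
  classical
  set acc := processAll L
  set E' := E.filter fun e => N.tile T (e.2.node e.1.1) (e.1.2 + 1) ≠ N.tile T e.1.1 e.1.2 with hE'
  set sk : STEdge → SketchEdge := fun e => (N.tile T e.1.1 e.1.2, e.2)
  have hD0 : 0 ≤ D := le_trans (by positivity) (hD .store)
  calc ∑ e ∈ E, crossWeight acc T e * N.capacity e
      = ∑ e ∈ E', edgeWeight acc T (sk e) * N.capacity e := by
        rw [hE', Finset.sum_filter]
        refine Finset.sum_congr rfl fun e _ => ?_
        unfold crossWeight
        split_ifs <;> simp [sk]
    _ = ∑ s ∈ E'.image sk, ∑ e ∈ E'.filter (fun e => sk e = s),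
          edgeWeight acc T (sk e) * N.capacity e :=
        (Finset.sum_fiberwise_of_maps_to (fun e he => Finset.mem_image_of_mem _ he) _).symm
    _ ≤ ∑ s ∈ E'.image sk, edgeWeight acc T s * D := by
        refine Finset.sum_le_sum fun s _ => ?_
        have h0 := edgeWeight_nonneg hp.le acc T s
        have hc : ((E'.filter fun e => sk e = s).card : ℝ) ≤ 2 * N.half s.2.other := by
          have := card_crossing_le hN T s (E'.filter fun e => sk e = s) (fun e he =>
            ⟨(Finset.mem_filter.1 (Finset.mem_filter.1 he).1).2, (Finset.mem_filter.1 he).2⟩)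
          exact_mod_cast this
        calc ∑ e ∈ E'.filter (fun e => sk e = s), edgeWeight acc T (sk e) * N.capacity e
            = ∑ e ∈ E'.filter (fun e => sk e = s),
                edgeWeight acc T s * N.capacity ((0, 0), s.2) := by
              refine Finset.sum_congr rfl fun e he => ?_
              have := (Finset.mem_filter.1 he).2
              rw [capacity_eq e, this, show e.2 = s.2 from congrArg Prod.snd this]
          _ = edgeWeight acc T s * ((E'.filter fun e => sk e = s).card *
                N.capacity ((0, 0), s.2)) := by
              rw [Finset.sum_const, nsmul_eq_mul]
              ring
          _ ≤ edgeWeight acc T s * (2 * N.half s.2.other * N.capacity ((0, 0), s.2)) := by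
              gcongr
          _ ≤ edgeWeight acc T s * D := by
              gcongr
              exact hD s.2
    _ = (∑ s ∈ E'.image sk, edgeWeight acc T s) * D := by rw [Finset.sum_mul]
    _ ≤ (2 * acc.length) * D := by
        gcongr
        exact sum_edgeWeight_le hp L T _
    _ = 2 * D * acc.length := by ring

/-- Each heavy column holds weight at least 1/2, columns have disjoint edge sets, and the total
weight is at most twice the number of acceptances. -/
theorem card_heavyColumns_le (hp : 0 < N.pmax) (L : List (Request N × ℕ)) (T : Tiling)
    (S : Finset ℤ) (hS : ∀ X ∈ S, HeavyColumn (processAll L) T X) :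
    (S.card : ℝ) ≤ 4 * (processAll L).length := by
  classical
  set acc := processAll L
  set I := Finset.Ico (N.tileRow T 0) (N.tileRow T N.n)
  have hinj : Function.Injective fun q : ℤ × ℤ => (q, Move.forward) :=
    fun q q' h => congrArg Prod.fst h
  have h1 : (S.card : ℝ) * (1 / 2) ≤ ∑ X ∈ S, ∑ Y ∈ I, edgeWeight acc T ((X, Y), .forward) := by
    rw [← nsmul_eq_mul]
    exact Finset.card_nsmul_le_sum _ _ _ hS
  have h2 : ∑ X ∈ S, ∑ Y ∈ I, edgeWeight acc T ((X, Y), .forward) =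
      ∑ e ∈ (S ×ˢ I).map ⟨_, hinj⟩, edgeWeight acc T e := by
    rw [Finset.sum_map, Finset.sum_product]
    rfl
  have h3 := sum_edgeWeight_le hp L T ((S ×ˢ I).map ⟨_, hinj⟩)
  rw [← h2] at h3
  linarith

/-- A column of tiles contains at most `n * (2 * half .store)` store edges below row `n`, each
contributing `B * c/(nB) = c/n`. The factor `n` cancels, which is why the heavy price is chosen as
it is. -/
theorem sum_heavyWeight_mul_capacity_le (hN : ∀ m, 0 < N.half m) (hp : 0 < N.pmax) (hn : 0 < N.n)
    (hB : 0 < N.B)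
    (L : List (Request N × ℕ)) (T : Tiling) (E : Finset STEdge) (hE : ∀ e ∈ E, e.1.1 < N.n) :
    ∑ e ∈ E, heavyWeight (processAll L) T e * N.capacity e ≤
      4 * (2 * N.half .store * N.c) * (processAll L).length := by
  classical
  set acc := processAll L
  set E' := E.filter fun e => e.2 = .store ∧ HeavyColumn acc T (N.tile T e.1.1 e.1.2).1 with hE'
  set col : STEdge → ℤ := fun e => (N.tile T e.1.1 e.1.2).1
  have hn' : (0 : ℝ) < N.n := by exact_mod_cast hn
  have hB' : (0 : ℝ) < N.B := by exact_mod_cast hB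
  have h1 : ∑ e ∈ E, heavyWeight acc T e * N.capacity e = E'.card * (N.c / N.n) := by
    rw [← nsmul_eq_mul, ← Finset.sum_const, hE', Finset.sum_filter]
    refine Finset.sum_congr rfl fun e _ => ?_
    unfold heavyWeight
    split_ifs with h
    · simp only [Network.capacity, h.1]
      field_simp
    · simp
  have h2 : E'.card ≤ N.n * (2 * N.half .store) * (E'.image col).card := by
    refine Finset.card_le_mul_card_image _ _ fun X _ => ?_
    have : (E'.filter fun e => col e = X).card ≤
        (Finset.range N.n ×ˢ Finset.Ico (0 : ℤ) (2 * N.half .store : ℕ)).card := by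
      refine Finset.card_le_card_of_injOn
        (fun e => (e.1.1, N.posIn T .store e.1.1 e.1.2)) ?_ ?_
      · intro e he
        have he := Finset.mem_filter.1 (Finset.mem_filter.1 (Finset.mem_coe.1 he)).1
        have h1 := Network.posIn_nonneg hN T .store e.1.1 e.1.2
        have h2 := Network.posIn_lt hN T .store e.1.1 e.1.2
        simp only [Finset.coe_product, Set.mem_prod, Finset.mem_coe, Finset.mem_range,
          Finset.mem_Ico]
        push_cast
        exact ⟨hE e he.1, h1, h2⟩
      · intro e he e' he' hee
        have he := Finset.mem_filter.1 (Finset.mem_coe.1 he)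
        have he' := Finset.mem_filter.1 (Finset.mem_coe.1 he')
        have hm := (Finset.mem_filter.1 he.1).2.1
        have hm' := (Finset.mem_filter.1 he'.1).2.1
        rw [Prod.mk.injEq] at hee
        have hc : coord .store e.1.1 e.1.2 = coord .store e'.1.1 e'.1.2 :=
          coord_eq_of_tileIdx_posIn_eq (he.2.trans he'.2.symm) hee.2
        simp only [coord] at hc
        exact Prod.ext (Prod.ext hee.1 (by omega)) (hm.trans hm'.symm)
    rwa [Finset.card_product, Finset.card_range, Int.card_Ico, sub_zero,
      Int.toNat_natCast] at this
  have h3 := card_heavyColumns_le hp L T (E'.image col) (by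
    intro X hX
    obtain ⟨e, he, rfl⟩ := Finset.mem_image.1 hX
    exact (Finset.mem_filter.1 he).2.2)
  have h4 : (E'.card : ℝ) ≤ N.n * (2 * N.half .store) * (E'.image col).card := by
    exact_mod_cast h2
  rw [h1]
  calc (E'.card : ℝ) * (N.c / N.n)
      ≤ (N.n * (2 * N.half .store) * (4 * acc.length)) * (N.c / N.n) := by
        gcongr
        exact h4.trans (by gcongr)
    _ = 4 * (2 * N.half .store * N.c) * acc.length := by
        field_simp

theorem sum_price_mul_capacity_le (hN : ∀ m, 0 < N.half m) (hp : 0 < N.pmax) (hn : 0 < N.n)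
    (hB : 0 < N.B) (L : List (Request N × ℕ)) (T : Tiling) {D : ℝ}
    (hD : ∀ m, (2 * N.half m.other * N.capacity ((0, 0), m) : ℝ) ≤ D)
    (E : Finset STEdge) (hE : ∀ e ∈ E, e.1.1 < N.n) :
    ∑ e ∈ E, price (processAll L) T e * N.capacity e ≤ 8 * D * (processAll L).length := by
  have h1 := sum_crossWeight_mul_capacity_le hN hp L T hD E
  have h2 := sum_heavyWeight_mul_capacity_le hN hp hn hB L T E hE
  have h3 : 4 * (2 * N.half .store * N.c : ℝ) * (processAll L).length ≤
      4 * D * (processAll L).length := by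
    gcongr
    exact hD .forward
  have h4 : ∑ e ∈ E, price (processAll L) T e * N.capacity e =
      2 * ∑ e ∈ E, crossWeight (processAll L) T e * N.capacity e +
        ∑ e ∈ E, heavyWeight (processAll L) T e * N.capacity e := by
    rw [Finset.mul_sum, ← Finset.sum_add_distrib]
    refine Finset.sum_congr rfl fun e _ => ?_
    unfold price
    ring
  rw [h4]
  linarith

/-! ## Fractional routings and prices -/

section

variable {R : List (Request N)} (f : FractionalRouting R)

/-- The flow amount of a request. -/
def FractionalRouting.amount (i : Fin R.length) : ℝ := (f.flow i).sum fun _ x => x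

/-- The amount of flow of a request on an edge. -/
def FractionalRouting.flowOn (e : STEdge) (i : Fin R.length) : ℝ :=
  (f.flow i).sum fun w x => if e ∈ pathEdges (R.get i).src (R.get i).time w then x else 0

theorem FractionalRouting.flowOn_nonneg (e : STEdge) (i : Fin R.length) : 0 ≤ f.flowOn e i :=
  Finset.sum_nonneg fun w _ => by
    simp only
    split_ifs
    · exact f.nonneg i w
    · exact le_rfl

theorem FractionalRouting.sum_flowOn_le (hB : 0 < N.B) (hc : 0 < N.c) (hf : f.IsPacking 1)
    (e : STEdge) : ∑ i, f.flowOn e i ≤ N.capacity e := by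
  have hcap : (0 : ℝ) < N.capacity e := by
    have : 0 < N.capacity e := by
      unfold Network.capacity
      split <;> assumption
    exact_mod_cast this
  have := hf e
  unfold FractionalRouting.load at this
  rw [div_le_one hcap] at this
  exact this

/-- Weak duality: if all paths of some requests are expensive, then the throughput of these requests
is at most the total price of the capacities. -/
theorem FractionalRouting.exists_sum_amount_le (hB : 0 < N.B) (hc : 0 < N.c)
    (hf : f.IsPacking 1) : ∃ E : Finset STEdge, (∀ e ∈ E, e.1.1 < N.n) ∧
      ∀ (W : STEdge → ℝ) (I : Finset (Fin R.length)), (∀ e, 0 ≤ W e) →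
        (∀ i ∈ I, ∀ w, (R.get i).IsRoute w →
          1 ≤ ((pathEdges (R.get i).src (R.get i).time w).map W).sum) →
        ∑ i ∈ I, f.amount i ≤ ∑ e ∈ E, W e * N.capacity e := by
  classical
  -- Only edges used by the flow matter. They are finitely many and lie in rows below `n`, as the
  -- count of heavy edges requires.
  set E : Finset STEdge := Finset.univ.biUnion fun i : Fin R.length =>
    (f.flow i).support.biUnion fun w => (pathEdges (R.get i).src (R.get i).time w).toFinset with hE
  refine ⟨E, ?_, ?_⟩
  · intro e he
    simp only [hE, Finset.mem_biUnion, Finset.mem_univ, true_and, List.mem_toFinset,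
      Finsupp.mem_support_iff] at he
    obtain ⟨i, w, hw, he⟩ := he
    have h1 := node_le_of_mem_pathEdges he
    have h2 := f.isRoute i w hw
    unfold Request.IsRoute at h2
    have h3 := (R.get i).dst.2
    omega
  · intro W I hW hI
    have key : ∀ i ∈ I, f.amount i ≤ ∑ e ∈ E, W e * f.flowOn e i := by
      intro i hi
      have : ∑ e ∈ E, W e * f.flowOn e i = ∑ w ∈ (f.flow i).support,
          f.flow i w * ∑ e ∈ E,
            if e ∈ pathEdges (R.get i).src (R.get i).time w then W e else 0 := by
        simp only [FractionalRouting.flowOn, Finsupp.sum, Finset.mul_sum]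
        rw [Finset.sum_comm]
        refine Finset.sum_congr rfl fun w _ => Finset.sum_congr rfl fun e _ => ?_
        split_ifs <;> ring
      rw [this]
      refine Finset.sum_le_sum fun w hw => ?_
      have hsum : ∑ e ∈ E, (if e ∈ pathEdges (R.get i).src (R.get i).time w then W e else 0) =
          ((pathEdges (R.get i).src (R.get i).time w).map W).sum := by
        rw [← List.sum_toFinset _ (pathEdges_nodup _ _ _), ← Finset.sum_filter]
        refine Finset.sum_congr ?_ fun _ _ => rfl
        ext e
        simp only [Finset.mem_filter, List.mem_toFinset, and_iff_right_iff_imp]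
        intro he
        simp only [hE, Finset.mem_biUnion, Finset.mem_univ, true_and, List.mem_toFinset]
        exact ⟨i, w, hw, he⟩
      rw [hsum]
      exact le_mul_of_one_le_right (f.nonneg i w)
        (hI i hi w (f.isRoute i w (Finsupp.mem_support_iff.1 hw)))
    calc ∑ i ∈ I, f.amount i ≤ ∑ i ∈ I, ∑ e ∈ E, W e * f.flowOn e i := Finset.sum_le_sum key
      _ = ∑ e ∈ E, W e * ∑ i ∈ I, f.flowOn e i := by
          rw [Finset.sum_comm]
          simp only [Finset.mul_sum]
      _ ≤ ∑ e ∈ E, W e * N.capacity e := by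
          refine Finset.sum_le_sum fun e _ => mul_le_mul_of_nonneg_left ?_ (hW e)
          exact (Finset.sum_le_univ_sum_of_nonneg fun i => f.flowOn_nonneg e i).trans
            (f.sum_flowOn_le hB hc hf e)

/-- The flow out of a set of vertices is at most the capacity of the edges out of them. -/
theorem FractionalRouting.sum_amount_le_of_source (hR : IsRequestSequence R) (hB : 0 < N.B)
    (hc : 0 < N.c) (hf : f.IsPacking 1) (S : Finset (ℕ × ℕ)) (I : Finset (Fin R.length))
    (hI : ∀ i ∈ I, (((R.get i).src : ℕ), (R.get i).time) ∈ S) :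
    ∑ i ∈ I, f.amount i ≤ S.card * (N.B + N.c) := by
  classical
  have key : ∀ i ∈ I, f.amount i ≤
      ∑ s ∈ S, (f.flowOn (s, .store) i + f.flowOn (s, .forward) i) := by
    intro i hi
    refine le_trans ?_ (Finset.single_le_sum (f := fun s =>
      f.flowOn (s, .store) i + f.flowOn (s, .forward) i) (fun s _ =>
      add_nonneg (f.flowOn_nonneg _ i) (f.flowOn_nonneg _ i)) (hI i hi))
    simp only [FractionalRouting.flowOn, FractionalRouting.amount, Finsupp.sum,
      ← Finset.sum_add_distrib]
    refine Finset.sum_le_sum fun w hw => ?_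
    have hr := f.isRoute i w (Finsupp.mem_support_iff.1 hw)
    have h0 := f.nonneg i w
    have hsd : ((R.get i).src : ℕ) < (R.get i).dst := src_lt_dst_get hR i
    unfold Request.IsRoute at hr
    cases w with
    -- Source and destination differ, so every route has a first edge, and it leaves the source
    -- vertex.
    | nil => rw [List.count_nil] at hr; omega
    | cons m w => cases m <;> simp only [pathEdges, List.mem_cons, true_or, if_true] <;>
        split_ifs <;> linarith
  calc ∑ i ∈ I, f.amount i
      ≤ ∑ i ∈ I, ∑ s ∈ S, (f.flowOn (s, .store) i + f.flowOn (s, .forward) i) :=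
        Finset.sum_le_sum key
    _ = ∑ s ∈ S, (∑ i ∈ I, f.flowOn (s, .store) i + ∑ i ∈ I, f.flowOn (s, .forward) i) := by
        rw [Finset.sum_comm]
        simp only [Finset.sum_add_distrib]
    _ ≤ ∑ s ∈ S, ((N.B : ℝ) + N.c) := by
        refine Finset.sum_le_sum fun s _ => add_le_add ?_ ?_
        · exact (Finset.sum_le_univ_sum_of_nonneg fun i => f.flowOn_nonneg _ i).trans
            (f.sum_flowOn_le hB hc hf _)
        · exact (Finset.sum_le_univ_sum_of_nonneg fun i => f.flowOn_nonneg _ i).trans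
            (f.sum_flowOn_le hB hc hf _)
    _ = S.card * (N.B + N.c) := by rw [Finset.sum_const, nsmul_eq_mul]

end

/-! ## Sources at which requests are rejected -/

theorem isNear_of_mem_processAll {L : List (Request N × ℕ)} {a : Entry N} (h : a ∈ processAll L)
    (hr : a.route = .near) : a.req.IsNear := by
  induction L using List.reverseRecOn with
  | nil => simp [processAll] at h
  | append_singleton L p ih =>
    rw [processAll_concat] at h
    rcases processRequest_cases (processAll L) p with ⟨h', -⟩ | ⟨ρ, h', hg⟩
    · rw [h'] at h
      exact ih h
    · rw [h'] at h
      rcases List.mem_append.1 h with h | h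
      · exact ih h
      · rw [List.mem_singleton] at h
        subst h
        simp only at hr
        subst hr
        exact hg.1

/-- The number of vertices whose forward edge is used up by near requests. -/
theorem card_nearFull_mul_le {acc : List (Entry N)} (hnd : (acc.map Entry.idx).Nodup)
    (hnear : ∀ a ∈ acc, a.route = .near → a.req.IsNear) (S : Finset (ℕ × ℕ))
    (hS : ∀ s ∈ S, N.trackC ≤ nearLoad acc (s, .forward)) :
    S.card * N.trackC ≤ acc.length * N.tileV := by
  classical
  rw [← List.toFinset_card_of_nodup (nodup_of_idx hnd)]
  -- Double counting: each such vertex lies on at least `trackC` accepted near paths, and each near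
  -- path has at most `tileV` vertices with a forward edge.
  refine Finset.card_mul_le_card_mul (fun (s : ℕ × ℕ) (a : Entry N) => a.route = .near ∧
    (s, .forward) ∈ pathEdges a.req.src a.req.time a.req.straight) (fun s hs => ?_) fun a ha => ?_
  · refine (hS s hs).trans (le_of_eq ?_)
    unfold nearLoad
    rw [countP_eq_card_filter (nodup_of_idx hnd) _ (fun b => b.route = .near ∧
        (s, .forward) ∈ pathEdges b.req.src b.req.time b.req.straight)]
    · rfl
    · intro b
      cases h : b.route <;> simp
  · by_cases hr : a.route = .near
    · have h1 := hnear a (List.mem_toFinset.1 ha) hr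
      unfold Request.IsNear at h1
      refine le_trans ?_ h1
      refine (Finset.card_le_card (t := (Finset.range ((a.req.dst : ℕ) - a.req.src)).image
        fun i => ((a.req.src : ℕ) + i, a.req.time + i)) fun s hs => ?_).trans
        (Finset.card_image_le.trans (by simp))
      obtain ⟨-, -, h2⟩ := Finset.mem_filter.1 hs
      obtain ⟨i, hi, e⟩ := mem_pathEdges_straight.1 h2
      exact Finset.mem_image.2 ⟨i, Finset.mem_range.2 hi, (congrArg Prod.fst e).symm⟩
    · rw [Finset.bipartiteBelow, Finset.card_eq_zero.2]
      · exact Nat.zero_le _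
      · rw [Finset.filter_eq_empty_iff]
        exact fun s _ h => hr h.1

/-- The number of vertices from which many requests are accepted. -/
theorem card_exhausted_mul_le (acc : List (Entry N)) (S : Finset (ℕ × ℕ)) {K : ℕ}
    (hS : ∀ s ∈ S, ∃ D : Finset (Entry N), K ≤ D.card ∧
      ∀ a ∈ D, a ∈ acc ∧ ((a.req.src : ℕ), a.req.time) = s) :
    S.card * K ≤ acc.length := by
  classical
  refine le_trans ?_ acc.toFinset_card_le
  rw [← mul_one acc.toFinset.card]
  refine Finset.card_mul_le_card_mul (fun (s : ℕ × ℕ) (a : Entry N) =>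
    ((a.req.src : ℕ), a.req.time) = s) (fun s hs => ?_) fun a ha => ?_
  · obtain ⟨D, hD, h⟩ := hS s hs
    refine hD.trans (Finset.card_le_card fun a ha => ?_)
    exact Finset.mem_filter.2 ⟨List.mem_toFinset.2 (h a ha).1, (h a ha).2⟩
  · rw [Finset.card_le_one]
    intro s hs s' hs'
    exact (Finset.mem_filter.1 hs).2.symm.trans (Finset.mem_filter.1 hs').2

theorem coord_iterate_self (d : Move) (i v t : ℕ) :
    coord d (d.node^[i] v) (t + i) = coord d v t + i := by
  induction i with
  | zero => simp
  | succ i ih =>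
    rw [Function.iterate_succ_apply', ← add_assoc, coord_node_self, ih]
    push_cast
    ring

theorem coord_iterate_other (d : Move) (i v t : ℕ) :
    coord d.other (d.node^[i] v) (t + i) = coord d.other v t := by
  induction i with
  | zero => simp
  | succ i ih => rw [Function.iterate_succ_apply', ← add_assoc, coord_node_other, ih]

/-- The number of vertices at which initial routing in direction `d` fails. -/
theorem card_initFull_mul_le (hN : ∀ m, 0 < N.half m) {acc : List (Entry N)}
    (hnd : (acc.map Entry.idx).Nodup) (d : Move) (S : Finset (ℕ × ℕ))
    (hS : ∀ s ∈ S, ∃ (r : Request N) (T : Tiling), ((r.src : ℕ), r.time) = s ∧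
      ¬ InitFree acc T r d) :
    S.card * N.trackCap d ≤ acc.length * (2 * N.half d) := by
  classical
  have hlen : ∀ (r : Request N) T d,
      (N.half d - N.posIn T d r.src r.time).toNat ≤ N.half d := by
    intro r T d
    have := Network.posIn_nonneg hN T d r.src r.time
    omega
  rw [← List.toFinset_card_of_nodup (nodup_of_idx hnd)]
  -- The relation says that straight runs of fewer than `half d` moves from the two sources meet. It
  -- does not mention the tiling, so all four are counted together; the source of `a` is on the same
  -- line, at distance less than `half d`.
  refine Finset.card_mul_le_card_mul (fun (s : ℕ × ℕ) (a : Entry N) =>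
    ∃ i < N.half d, ∃ j < N.half d, (d.node^[i] s.1, s.2 + i) =
      (d.node^[j] a.req.src, a.req.time + j)) (fun s hs => ?_) fun a ha => ?_
  · obtain ⟨r, T, rfl, hfree⟩ := hS s hs
    unfold InitFree at hfree
    push Not at hfree
    obtain ⟨e, he, hload⟩ := hfree
    refine hload.trans ?_
    unfold initLoad
    rw [countP_eq_card_filter (nodup_of_idx hnd) _ (fun b => ∃ p d', b.route = .far T p d' ∧
      e ∈ pathEdges b.req.src b.req.time (b.req.initPath T d'))]
    · refine Finset.card_le_card fun a ha => ?_
      obtain ⟨hacc, p, d', hr, hea⟩ := Finset.mem_filter.1 ha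
      rw [Request.initPath_eq, mem_pathEdges_replicate] at he hea
      obtain ⟨i, hi, rfl⟩ := he
      obtain ⟨j, hj, e⟩ := hea
      obtain ⟨e1, rfl⟩ := Prod.mk.injEq .. ▸ e
      exact Finset.mem_filter.2
        ⟨hacc, i, hi.trans_le (hlen _ _ _), j, hj.trans_le (hlen _ _ _), e1⟩
    · intro b
      cases h : b.route with
      | near => simp
      | far T' p d => grind
  · have : (S.bipartiteBelow (fun (s : ℕ × ℕ) (a : Entry N) =>
        ∃ i < N.half d, ∃ j < N.half d, (d.node^[i] s.1, s.2 + i) =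
          (d.node^[j] a.req.src, a.req.time + j)) a).card ≤
        (Finset.Ico (coord d a.req.src a.req.time - N.half d)
          (coord d a.req.src a.req.time + N.half d)).card := by
      have hrel : ∀ s : ℕ × ℕ, (∃ i < N.half d, ∃ j < N.half d, (d.node^[i] s.1, s.2 + i) =
          (d.node^[j] (a.req.src : ℕ), a.req.time + j)) →
          coord d.other s.1 s.2 = coord d.other a.req.src a.req.time ∧
          coord d a.req.src a.req.time - N.half d ≤ coord d s.1 s.2 ∧
          coord d s.1 s.2 < coord d a.req.src a.req.time + N.half d := by
        rintro s ⟨i, hi, j, hj, e⟩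
        rw [Prod.mk.injEq] at e
        have h1 := coord_iterate_self d i s.1 s.2
        have h2 := coord_iterate_self d j a.req.src a.req.time
        have h3 := coord_iterate_other d i s.1 s.2
        have h4 := coord_iterate_other d j a.req.src a.req.time
        rw [e.1, e.2] at h1 h3
        refine ⟨h3.symm.trans h4, ?_, ?_⟩ <;> omega
      refine Finset.card_le_card_of_injOn (fun s => coord d s.1 s.2) ?_ ?_
      · intro s hs
        have := hrel s (Finset.mem_filter.1 (Finset.mem_coe.1 hs)).2
        exact Finset.mem_coe.2 (Finset.mem_Ico.2 this.2)
      · intro s hs s' hs' hss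
        have h1 := (hrel s (Finset.mem_filter.1 (Finset.mem_coe.1 hs)).2).1
        have h2 := (hrel s' (Finset.mem_filter.1 (Finset.mem_coe.1 hs')).2).1
        have := vertex_eq_of_coord_eq (v := s.1) (t := s.2) (v' := s'.1) (t' := s'.2) (by
          intro m
          rcases Move.eq_or_eq_other m d with rfl | rfl
          · exact hss
          · exact h1.trans h2.symm)
        exact Prod.ext this.1 this.2
    refine this.trans ?_
    rw [Int.card_Ico]
    omega

theorem newRequests_sorted (H : List (Request N)) (t : ℕ) :
    (newRequests H t).Pairwise fun p q =>
      (p.1.dst : ℕ) - p.1.src ≤ (q.1.dst : ℕ) - q.1.src := by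
  have := List.pairwise_mergeSort (le := fun p q : Request N × ℕ =>
    decide ((p.1.dst : ℕ) - p.1.src ≤ (q.1.dst : ℕ) - q.1.src))
    (fun a b c h1 h2 => by simp only [decide_eq_true_eq] at *; omega)
    (fun a b => by simp only [Bool.or_eq_true, decide_eq_true_eq]; omega)
    (H.zipIdx.filter fun p => p.1.time = t)
  exact this.imp (by simp)

/-- The reasons why a request may not be accepted. -/
theorem refuses_or_exhausted_of_not_accepted (hp : 0 ≤ N.pmax) {R : List (Request N)}
    (hR : IsRequestSequence R) (i : Fin R.length) (hi : ∀ a ∈ allAccepted R, a.idx ≠ i) :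
    (∃ r : Request N, r.src = (R.get i).src ∧ r.time = (R.get i).time ∧ r.src < r.dst ∧
      r.dst ≤ (R.get i).dst ∧ Refuses (allAccepted R) r) ∨
    ∃ D : Finset (Entry N), N.trackB + N.trackC ≤ D.card ∧
      ∀ a ∈ D, a ∈ allAccepted R ∧
        ((a.req.src : ℕ), a.req.time) = (((R.get i).src : ℕ), (R.get i).time) := by
  classical
  set r := R.get i with hr
  set t := r.time with ht
  set K := N.trackB + N.trackC
  have hsd : r.src < r.dst := src_lt_dst_get hR i
  have hnew : (r, (i : ℕ)) ∈ newRequests R t := mem_newRequests.2 ⟨by simp [hr], rfl⟩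
  have hproc : ∀ q ∈ filteredRequests R t, (∃ a ∈ allAccepted R, a.req = q.1 ∧ a.idx = q.2) ∨
      Refuses (allAccepted R) q.1 := by
    intro q hq
    rw [allAccepted, accepted_eq]
    refine accepted_or_refuses hp (mem_requestsBefore.2 ?_)
    have h1 := mem_newRequests.1 (mem_newRequests_of_mem_filtered hq)
    refine ⟨time_lt_horizon (List.mem_of_getElem? h1.1), ?_⟩
    rw [h1.2]
    exact hq
  by_cases hfil : (r, (i : ℕ)) ∈ filteredRequests R t
  · rcases hproc _ hfil with ⟨a, ha, -, h2⟩ | h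
    · exact absurd h2 (hi a ha)
    · exact .inl ⟨r, rfl, rfl, hsd, le_rfl, h⟩
  · set Q := (newRequests R t).filter fun q => q.1.src = r.src with hQ
    have hpQ : (r, (i : ℕ)) ∈ Q := List.mem_filter.2 ⟨hnew, by simp⟩
    have hnt : (r, (i : ℕ)) ∉ Q.take K := by
      intro h
      exact hfil (List.mem_filter.2 ⟨hnew, by
        simp only [decide_eq_true_eq]
        exact List.mem_map.2 ⟨_, h, rfl⟩⟩)
    have hdrop : (r, (i : ℕ)) ∈ Q.drop K := by
      rw [← List.take_append_drop K Q] at hpQ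
      exact (List.mem_append.1 hpQ).resolve_left hnt
    have hlen : K ≤ Q.length := by
      by_contra hc
      rw [List.drop_of_length_le (by omega)] at hdrop
      simp at hdrop
    have hfiltered : ∀ q ∈ Q.take K, q ∈ filteredRequests R t := by
      intro q hq
      obtain ⟨h1, h2⟩ := List.mem_filter.1 (List.mem_of_mem_take hq)
      simp only [decide_eq_true_eq] at h2
      refine List.mem_filter.2 ⟨h1, ?_⟩
      simp only [decide_eq_true_eq, h2]
      exact List.mem_map.2 ⟨q, hq, rfl⟩
    have hspec : ∀ q ∈ Q.take K, q.1.src = r.src ∧ q.1.time = t ∧ q.1.src < q.1.dst := by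
      intro q hq
      obtain ⟨h1, h2⟩ := List.mem_filter.1 (List.mem_of_mem_take hq)
      have h3 := mem_newRequests.1 h1
      exact ⟨by simpa using h2, h3.2, hR.2 _ (List.mem_of_getElem? h3.1)⟩
    by_cases hrefuse : ∃ q ∈ Q.take K, Refuses (allAccepted R) q.1
    · obtain ⟨q, hq, href⟩ := hrefuse
      obtain ⟨h1, h2, h3⟩ := hspec q hq
      -- New requests are sorted by distance, so the refused request `q` has the same source and no
      -- farther destination: every route of the discarded request also reaches the row of `q`.
      refine .inl ⟨q.1, h1, h2, h3, ?_, href⟩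
      have hsorted : Q.Pairwise fun p q =>
          (p.1.dst : ℕ) - p.1.src ≤ (q.1.dst : ℕ) - q.1.src :=
        (newRequests_sorted R t).filter _
      rw [← List.take_append_drop K Q] at hsorted
      have h4 := (List.pairwise_append.1 hsorted).2.2 q hq _ hdrop
      simp only [h1] at h4
      rw [h1] at h3
      have h5 : (r.src : ℕ) < q.1.dst := h3
      have h6 : (r.src : ℕ) < r.dst := hsd
      rw [Fin.le_def]
      omega
    -- No kept request from this source is refused, so all `B' + c'` of them were accepted.
    · right
      push Not at hrefuse
      have hacc : ∀ q ∈ Q.take K, ∃ a ∈ allAccepted R, a.req = q.1 ∧ a.idx = q.2 :=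
        fun q hq => (hproc q (hfiltered q hq)).resolve_right (hrefuse q hq)
      have hnodup : ((Q.take K).map Prod.snd).Nodup :=
        (((List.take_sublist K Q).trans List.filter_sublist).map Prod.snd).nodup
          (newRequests_nodup R t)
      refine ⟨(allAccepted R).toFinset.filter fun a =>
        ((a.req.src : ℕ), a.req.time) = ((r.src : ℕ), t), ?_, fun a ha => ?_⟩
      · have h1 : K = ((Q.take K).map Prod.snd).toFinset.card := by
          rw [List.toFinset_card_of_nodup hnodup, List.length_map, List.length_take,
            min_eq_left hlen]
        rw [h1]
        refine le_trans (Finset.card_le_card fun j hj => ?_)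
          (Finset.card_image_le (f := Entry.idx))
        obtain ⟨q, hq, rfl⟩ := List.mem_map.1 (List.mem_toFinset.1 hj)
        obtain ⟨a, ha, h2, h3⟩ := hacc q hq
        obtain ⟨h4, h5, -⟩ := hspec q hq
        refine Finset.mem_image.2 ⟨a, Finset.mem_filter.2 ⟨List.mem_toFinset.2 ha, ?_⟩, h3⟩
        rw [h2, h4, h5]
      · obtain ⟨h1, h2⟩ := Finset.mem_filter.1 ha
        exact ⟨List.mem_toFinset.1 h1, h2⟩

/-! ## Schedules as fractional routings -/

/-- The grid path of a packet is read off from its actions. Each of its edges is witnessed by the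
status and action in that step, so the capacity constraints of the schedule bound the load of the
routing. -/
theorem exists_moves_of_status {r : Request N} {act : ℕ → Action} {t v : ℕ} (hr : r.src < r.dst)
    (h : r.status act t = .inNetwork v) :
    ∃ w : List Move, (r.src : ℕ) + w.count .forward = v ∧ r.time + w.length = t ∧
      ∀ e ∈ pathEdges r.src r.time w,
        r.status act e.1.2 = .inNetwork e.1.1 ∧ act e.1.2 = e.2.toAction := by
  have hstart : ∀ {t v}, t = r.time → r.status act t = .inNetwork v →
      ∃ w : List Move, (r.src : ℕ) + w.count .forward = v ∧ r.time + w.length = t ∧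
      ∀ e ∈ pathEdges r.src r.time w,
        r.status act e.1.2 = .inNetwork e.1.1 ∧ act e.1.2 = e.2.toAction := by
    rintro _ v rfl h
    rw [Request.status_time hr] at h
    exact ⟨[], by simpa using h, by simp, by simp [pathEdges]⟩
  induction t generalizing v with
  | zero =>
    by_cases ht : r.time = 0
    · exact hstart ht.symm h
    · rw [Request.status_of_lt act (by omega)] at h
      simp at h
  | succ t ih =>
    by_cases ht : r.time = t + 1
    · exact hstart ht.symm h
    · have hext : ∀ (v' : ℕ) (m : Move), r.status act t = .inNetwork v' → act t = m.toAction →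
          m.node v' = v → ∃ w : List Move, (r.src : ℕ) + w.count .forward = v ∧
          r.time + w.length = t + 1 ∧ ∀ e ∈ pathEdges r.src r.time w,
            r.status act e.1.2 = .inNetwork e.1.1 ∧ act e.1.2 = e.2.toAction := by
        intro v' m h1 h2 h3
        obtain ⟨w, hw1, hw2, hw3⟩ := ih h1
        refine ⟨w ++ [m], ?_, by simp; omega, ?_⟩
        · rw [List.count_append, ← h3, ← hw1]
          cases m <;> simp [Move.node]; omega
        · rw [pathEdges_append, hw1, hw2]
          intro e he
          rcases List.mem_append.1 he with he | he
          · exact hw3 e he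
          · simp only [pathEdges, List.mem_singleton] at he
            subst he
            exact ⟨h1, h2⟩
      cases hs : r.status act t with
      | waiting => simp [Request.status, hs, ht] at h
      | delivered => simp [Request.status, hs] at h
      | dropped => simp [Request.status, hs] at h
      | inNetwork v' =>
        cases ha : act t with
        | drop => simp [Request.status, hs, ha] at h
        | store =>
          simp only [Request.status, hs, ha, Request.arrive] at h
          split_ifs at h
          exact hext v' .store hs ha (by simpa [Move.node] using h)
        | forward =>
          simp only [Request.status, hs, ha, Request.arrive] at h
          split_ifs at h
          exact hext v' .forward hs ha (by simpa [Move.node] using h)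

theorem exists_route_of_delivered {r : Request N} {act : ℕ → Action} {t : ℕ} (hr : r.src < r.dst)
    (h : r.status act t = .delivered) :
    ∃ w : List Move, r.IsRoute w ∧ ∀ e ∈ pathEdges r.src r.time w,
      r.status act e.1.2 = .inNetwork e.1.1 ∧ act e.1.2 = e.2.toAction := by
  induction t with
  | zero =>
    by_cases ht : r.time = 0
    · rw [← ht, Request.status_time hr] at h
      simp at h
    · rw [Request.status_of_lt act (by omega)] at h
      simp at h
  | succ t ih =>
    by_cases ht : r.time = t + 1
    · rw [← ht, Request.status_time hr] at h
      simp at h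
    · have hext : ∀ (v' : ℕ) (m : Move), r.status act t = .inNetwork v' → act t = m.toAction →
          m.node v' = r.dst → ∃ w : List Move, r.IsRoute w ∧ ∀ e ∈ pathEdges r.src r.time w,
            r.status act e.1.2 = .inNetwork e.1.1 ∧ act e.1.2 = e.2.toAction := by
        intro v' m h1 h2 h3
        obtain ⟨w, hw1, hw2, hw3⟩ := exists_moves_of_status hr h1
        refine ⟨w ++ [m], ?_, ?_⟩
        · unfold Request.IsRoute
          rw [List.count_append, ← h3, ← hw1]
          cases m <;> simp [Move.node]; omega
        · rw [pathEdges_append, hw1, hw2]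
          intro e he
          rcases List.mem_append.1 he with he | he
          · exact hw3 e he
          · simp only [pathEdges, List.mem_singleton] at he
            subst he
            exact ⟨h1, h2⟩
      cases hs : r.status act t with
      | waiting => simp [Request.status, hs, ht] at h
      | delivered => exact ih hs
      | dropped => simp [Request.status, hs] at h
      | inNetwork v' =>
        cases ha : act t with
        | drop => simp [Request.status, hs, ha] at h
        | store =>
          simp only [Request.status, hs, ha, Request.arrive] at h
          split_ifs at h with hd
          exact hext v' .store hs ha hd
        | forward =>
          simp only [Request.status, hs, ha, Request.arrive] at h
          split_ifs at h with hd
          exact hext v' .forward hs ha hd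

/-- A feasible schedule is an integral routing. -/
theorem exists_fractionalRouting {R : List (Request N)} (hR : IsRequestSequence R) {S : Schedule}
    (hS : Feasible R S) :
    ∃ f : FractionalRouting R, f.IsPacking 1 ∧ f.throughput = throughput R S := by
  classical
  have hroute : ∀ i : Fin R.length, ∃ w : List Move, Delivered R S i →
      (R.get i).IsRoute w ∧ ∀ e ∈ pathEdges (R.get i).src (R.get i).time w,
        (R.get i).status (fun s => S s i) e.1.2 = .inNetwork e.1.1 ∧
        S e.1.2 i = e.2.toAction := by
    intro i
    by_cases hi : Delivered R S i
    · obtain ⟨t, ht⟩ := hi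
      obtain ⟨w, hw⟩ := exists_route_of_delivered (src_lt_dst_get hR i) ht
      exact ⟨w, fun _ => hw⟩
    · exact ⟨[], fun h => absurd h hi⟩
  choose w hw using hroute
  let f : FractionalRouting R :=
    { flow := fun i => if Delivered R S i then Finsupp.single (w i) 1 else 0
      nonneg := by
        intro i u
        split_ifs
        · rw [Finsupp.single_apply]
          split_ifs <;> norm_num
        · simp
      isRoute := by
        intro i u hu
        split_ifs at hu with hi
        · rw [Finsupp.single_apply] at hu
          split_ifs at hu with h
          · exact h ▸ (hw i hi).1
          · exact absurd rfl hu
        · simp at hu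
      amount_le_one := by
        intro i
        split_ifs <;> simp }
  refine ⟨f, fun e => ?_, ?_⟩
  · unfold FractionalRouting.load
    refine div_le_one_of_le₀ ?_ (by positivity)
    have h1 : ∑ i, ((f.flow i).sum fun u x =>
        if e ∈ pathEdges (R.get i).src (R.get i).time u then x else 0) ≤
        ∑ i : Fin R.length, if (R.get i).status (fun s => S s i) e.1.2 = .inNetwork e.1.1 ∧
          S e.1.2 i = e.2.toAction then (1 : ℝ) else 0 := by
      refine Finset.sum_le_sum fun i _ => ?_
      simp only [f]
      by_cases hi : Delivered R S i
      · rw [if_pos hi, Finsupp.sum_single_index (by simp)]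
        by_cases he : e ∈ pathEdges (R.get i).src (R.get i).time (w i)
        · rw [if_pos he, if_pos ((hw i hi).2 e he)]
        · rw [if_neg he]
          split_ifs <;> norm_num
      · rw [if_neg hi, Finsupp.sum_zero_index]
        split_ifs <;> norm_num
    refine h1.trans ?_
    rw [Finset.sum_boole]
    have h2 := hS e.1.1 e.1.2
    have h3 : numActing R S e.2.toAction e.1.1 e.1.2 ≤ N.capacity e := by
      obtain ⟨⟨v, t⟩, m⟩ := e
      cases m
      · exact h2.2
      · refine h2.1.trans ?_
        simp only [Network.capacity]
        split_ifs <;> omega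
    unfold numActing at h3
    exact_mod_cast h3
  · unfold FractionalRouting.throughput throughput
    rw [← Finset.sum_boole]
    refine Finset.sum_congr rfl fun i _ => ?_
    simp only [f]
    split_ifs <;> simp

/-! ## The parameters -/

/-- The bounds on the parameters of the algorithm that hold for `5 ≤ B, c ≤ log n`. -/
structure Network.Bounds (N : Network) (L : ℝ) : Prop where
  one_le_log : 1 ≤ L
  n_pos : 0 < N.n
  one_le_pmax : 1 ≤ N.pmax
  half_pos : ∀ m, 0 < N.half m
  one_le_trackCap : ∀ m, 1 ≤ N.trackCap m
  capacity_le : ∀ m, N.capacity ((0, 0), m) ≤ 9 * N.trackCap m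
  room : ∀ m, 3 * N.k ≤ (N.half m.other * N.trackCap m : ℕ)
  half_mul_le : ∀ m, (N.half m.other * N.trackCap m : ℝ) ≤ 10 * L

/-- As `B ≤ log n`, the bound `pmax` is polynomial in `n` and `k` is `O(log n)`; rounding up half a
tile side costs at most one track capacity, which is again at most `log n`. -/
theorem Network.bounds (hB : 5 ≤ N.B) (hB' : (N.B : ℝ) ≤ Real.logb 2 N.n) (hc : 5 ≤ N.c)
    (hc' : (N.c : ℝ) ≤ Real.logb 2 N.n) : N.Bounds (Real.logb 2 N.n) := by
  set L := Real.logb 2 N.n with hL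
  have hB5 : (5 : ℝ) ≤ N.B := by exact_mod_cast hB
  have hc5 : (5 : ℝ) ≤ N.c := by exact_mod_cast hc
  have hL5 : 5 ≤ L := hB5.trans hB'
  have hn : 0 < N.n := by
    rcases Nat.eq_zero_or_pos N.n with h | h
    · rw [hL, h] at hL5
      norm_num at hL5
    · exact h
  have hnR : (0 : ℝ) < N.n := by exact_mod_cast hn
  have hn32 : (32 : ℝ) ≤ N.n := by
    have := (Real.le_logb_iff_rpow_le (b := 2) (by norm_num) hnR).1 hL5
    norm_num at this
    exact_mod_cast this
  have hLn : L ≤ N.n := by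
    rw [hL, Real.logb_le_iff_le_rpow (by norm_num) hnR, Real.rpow_natCast]
    exact_mod_cast (Nat.lt_two_pow_self (n := N.n)).le
  have hpmax : N.pmax ≤ 2 * N.n * (1 + N.n) := by
    unfold Network.pmax
    have : (N.B : ℝ) / N.c ≤ N.n := by
      rw [div_le_iff₀ (by linarith)]
      nlinarith
    gcongr
  have hp1 : 1 ≤ N.pmax := by
    unfold Network.pmax
    have : (0 : ℝ) ≤ (N.B : ℝ) / N.c := by positivity
    nlinarith
  have hk0 : 0 < N.k := Real.logb_pos one_lt_two (by linarith)
  have hk : N.k ≤ 3 * L := by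
    -- This needs `n ≥ 32`, which follows from `5 ≤ B ≤ log n`.
    have h1 : 1 + 3 * N.pmax ≤ (N.n : ℝ) ^ 3 := by nlinarith
    have h2 := Real.logb_le_logb_of_le (b := 2) one_lt_two (by linarith) h1
    rw [Real.logb_pow] at h2
    exact_mod_cast h2
  have hcap : ∀ m, 1 ≤ N.trackCap m := by
    intro m
    cases m <;> simp only [Network.trackCap, Network.trackB, Network.trackC] <;> omega
  have hcapL : ∀ m, (N.trackCap m : ℝ) ≤ L := by
    intro m
    cases m
    · exact (Nat.cast_le.2 (Nat.div_le_self _ _)).trans hB'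
    · exact (Nat.cast_le.2 (Nat.div_le_self _ _)).trans hc'
  have hhalf : ∀ m, N.half m.other = ⌈3 * N.k / N.trackCap m⌉₊ := by
    intro m
    cases m <;> rfl
  have hcapR : ∀ m, (0 : ℝ) < N.trackCap m := fun m => by exact_mod_cast hcap m
  refine ⟨by linarith, hn, hp1, ?_, hcap, ?_, ?_, ?_⟩
  · intro m
    rw [← m.other_other, hhalf, Nat.ceil_pos]
    have := hcapR m.other
    positivity
  -- For `x ≥ 5` one has `x ≤ 9 * (x / 5)`, with equality at `x = 9`.
  · intro m
    cases m <;> simp only [Network.capacity, Network.trackCap, Network.trackB, Network.trackC] <;>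
      omega
  · intro m
    push_cast
    rw [hhalf, ← div_le_iff₀ (hcapR m)]
    exact Nat.le_ceil _
  · intro m
    have h1 : (N.half m.other : ℝ) ≤ 3 * N.k / N.trackCap m + 1 := by
      rw [hhalf]
      exact (Nat.ceil_lt_add_one (div_nonneg (by linarith) (hcapR m).le)).le
    calc (N.half m.other * N.trackCap m : ℝ)
        ≤ (3 * N.k / N.trackCap m + 1) * N.trackCap m := by
          gcongr
      _ = 3 * N.k + N.trackCap m := by
          have := (hcapR m).ne'
          field_simp
      _ ≤ 10 * L := by linarith [hcapL m]

/-! ## The competitive ratio -/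

/-- The number of sources at which requests are rejected for lack of local capacity. -/
theorem card_mul_le_of_locally_blocked {L : ℝ} (hN : N.Bounds L) {acc : List (Entry N)}
    (hnd : (acc.map Entry.idx).Nodup) (hnear : ∀ a ∈ acc, a.route = .near → a.req.IsNear)
    (S : Finset (ℕ × ℕ))
    (hS : ∀ s ∈ S, N.trackC ≤ nearLoad acc (s, .forward) ∨
      (∃ D : Finset (Entry N), N.trackB + N.trackC ≤ D.card ∧
        ∀ a ∈ D, a ∈ acc ∧ ((a.req.src : ℕ), a.req.time) = s) ∨
      ∃ (r : Request N) (T : Tiling), ((r.src : ℕ), r.time) = s ∧ ∀ d, ¬ InitFree acc T r d) :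
    (S.card : ℝ) * (N.B + N.c) ≤ 729 * L * acc.length := by
  classical
  set S₁ := S.filter fun s => N.trackC ≤ nearLoad acc (s, .forward)
  set S₂ := S.filter fun s => ∃ D : Finset (Entry N), N.trackB + N.trackC ≤ D.card ∧
        ∀ a ∈ D, a ∈ acc ∧ ((a.req.src : ℕ), a.req.time) = s
  set S₃ := S.filter fun s => ∃ (r : Request N) (T : Tiling), ((r.src : ℕ), r.time) = s ∧
    ∀ d, ¬ InitFree acc T r d
  have hcard : S.card ≤ S₁.card + S₂.card + S₃.card := by
    refine (Finset.card_le_card (t := S₁ ∪ S₂ ∪ S₃) fun s hs => ?_).trans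
      ((Finset.card_union_le _ _).trans (Nat.add_le_add_right (Finset.card_union_le _ _) _))
    rcases hS s hs with h | h | h
    · exact Finset.mem_union_left _ (Finset.mem_union_left _ (Finset.mem_filter.2 ⟨hs, h⟩))
    · exact Finset.mem_union_left _ (Finset.mem_union_right _ (Finset.mem_filter.2 ⟨hs, h⟩))
    · exact Finset.mem_union_right _ (Finset.mem_filter.2 ⟨hs, h⟩)
  have h1 := card_nearFull_mul_le hnd hnear S₁ fun s hs => (Finset.mem_filter.1 hs).2
  have h2 := card_exhausted_mul_le acc S₂ fun s hs => (Finset.mem_filter.1 hs).2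
  have h3 : ∀ d, S₃.card * N.trackCap d ≤ acc.length * (2 * N.half d) := fun d =>
    card_initFull_mul_le hN.half_pos hnd d S₃ fun s hs => by
      obtain ⟨r, T, e, h⟩ := (Finset.mem_filter.1 hs).2
      exact ⟨r, T, e, h d⟩
  have h3s := h3 .store
  have h3f := h3 .forward
  have hb := hN.half_mul_le .store
  have hc := hN.half_mul_le .forward
  have hB1 := hN.one_le_trackCap .store
  have hC1 := hN.one_le_trackCap .forward
  have hcs := hN.capacity_le .store
  have hcf := hN.capacity_le .forward
  have hL := hN.one_le_log
  simp only [Move.other, Network.trackCap, Network.capacity, Network.half] at *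
  have hV : N.tileV = 2 * N.halfV := rfl
  rw [hV] at h1
  have hcard' : (S.card : ℝ) ≤ S₁.card + S₂.card + S₃.card := by exact_mod_cast hcard
  have h1' : (S₁.card * N.trackC : ℝ) ≤ acc.length * (2 * N.halfV) := by exact_mod_cast h1
  have h2' : (S₂.card * (N.trackB + N.trackC) : ℝ) ≤ acc.length := by exact_mod_cast h2
  have h3s' : (S₃.card * N.trackB : ℝ) ≤ acc.length * (2 * N.halfH) := by exact_mod_cast h3s
  have h3f' : (S₃.card * N.trackC : ℝ) ≤ acc.length * (2 * N.halfV) := by exact_mod_cast h3f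
  have hB1' : (1 : ℝ) ≤ N.trackB := by exact_mod_cast hB1
  have hC1' : (1 : ℝ) ≤ N.trackC := by exact_mod_cast hC1
  have hcs' : (N.B : ℝ) ≤ 9 * N.trackB := by exact_mod_cast hcs
  have hcf' : (N.c : ℝ) ≤ 9 * N.trackC := by exact_mod_cast hcf
  have hVL : (N.halfV : ℝ) ≤ 10 * L := by
    refine le_trans ?_ hb
    exact le_mul_of_one_le_right (by positivity) hB1'
  have hHL : (N.halfH : ℝ) ≤ 10 * L := by
    refine le_trans ?_ hc
    exact le_mul_of_one_le_right (by positivity) hC1'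
  set A : ℝ := (acc.length : ℝ)
  have hA : 0 ≤ A := by positivity
  -- The double count controls only `card * trackC`. Since `trackC ≥ 1`, it also bounds the
  -- cardinality itself, and multiplying by `trackB` is affordable because `halfV * trackB ≤ 10 *
  -- L`.
  have e1 : (S₁.card * (N.trackB + N.trackC) : ℝ) ≤ 40 * L * A := by
    have g1 : (S₁.card : ℝ) ≤ A * (2 * N.halfV) :=
      le_trans (le_mul_of_one_le_right (by positivity) hC1') h1'
    have g2 : (S₁.card * N.trackB : ℝ) ≤ A * (2 * N.halfV) * N.trackB := by gcongr
    have g3 : A * (2 * N.halfV) * N.trackB = 2 * A * (N.halfV * N.trackB) := by ring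
    have g4 : 2 * A * (N.halfV * N.trackB) ≤ 2 * A * (10 * L) := by gcongr
    have g5 : A * (2 * N.halfV) ≤ A * (2 * (10 * L)) := by gcongr
    linarith
  have e2 : (S₂.card * (N.trackB + N.trackC) : ℝ) ≤ L * A :=
    h2'.trans (le_mul_of_one_le_left hA hL)
  have e3 : (S₃.card * (N.trackB + N.trackC) : ℝ) ≤ 40 * L * A := by
    -- Both directions are blocked at these sources, so the horizontal and the vertical count can be
    -- added.
    have g4 : A * (2 * N.halfH) ≤ A * (2 * (10 * L)) := by gcongr
    have g5 : A * (2 * N.halfV) ≤ A * (2 * (10 * L)) := by gcongr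
    linarith
  calc (S.card : ℝ) * (N.B + N.c)
      ≤ (S₁.card + S₂.card + S₃.card) * (9 * N.trackB + 9 * N.trackC) := by gcongr
    _ = 9 * (S₁.card * (N.trackB + N.trackC) + S₂.card * (N.trackB + N.trackC) +
          S₃.card * (N.trackB + N.trackC)) := by ring
    _ ≤ 9 * (40 * L * A + L * A + 40 * L * A) := by gcongr
    _ = 729 * L * A := by ring

/-- The throughput of a fractional routing is `O(log n)` times the number of accepted requests. -/
theorem throughput_le {L : ℝ} (hN : N.Bounds L) (hB : 0 < N.B) (hc : 0 < N.c)
    {R : List (Request N)} (hR : IsRequestSequence R) (f : FractionalRouting R)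
    (hf : f.IsPacking 1) : f.throughput ≤ 7000 * L * (allAccepted R).length := by
  classical
  have hL := hN.one_le_log
  have hp : 0 ≤ N.pmax := by linarith [hN.one_le_pmax]
  have hadm := admissible_accepted hN.one_le_pmax hN.half_pos hR (horizon R)
  rw [← allAccepted] at hadm
  set acc := allAccepted R with hacc
  have haccL : acc = processAll (requestsBefore R (horizon R)) := accepted_eq R _
  set A : ℝ := (acc.length : ℝ) with hA
  set σ : Fin R.length → ℕ × ℕ := fun i => (((R.get i).src : ℕ), (R.get i).time)
  set Blocked : ℕ × ℕ → Prop := fun s => N.trackC ≤ nearLoad acc (s, .forward) ∨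
      (∃ D : Finset (Entry N), N.trackB + N.trackC ≤ D.card ∧
        ∀ a ∈ D, a ∈ acc ∧ ((a.req.src : ℕ), a.req.time) = s) ∨
      ∃ (r : Request N) (T : Tiling), ((r.src : ℕ), r.time) = s ∧ ∀ d, ¬ InitFree acc T r d
  set I₀ : Finset (Fin R.length) := Finset.univ.filter fun i => ∃ a ∈ acc, a.idx = i
  set I₁ : Finset (Fin R.length) := Finset.univ.filter fun i => Blocked (σ i)
  -- The refused request `r` need not be the request `i` itself: if `i` was discarded by the filter,
  -- `r` is a closer one from the same source.
  set J : Tiling → Finset (Fin R.length) := fun T => Finset.univ.filter fun i =>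
    ∃ r : Request N, r.src = (R.get i).src ∧ r.time = (R.get i).time ∧ r.src < r.dst ∧
      r.dst ≤ (R.get i).dst ∧ ∀ p, r.IsSketchPath T p → 1 ≤ sketchWeight acc T r p
  have hamount : ∀ i, 0 ≤ f.amount i := fun i => Finset.sum_nonneg fun w _ => f.nonneg i w
  have hcover : (Finset.univ : Finset (Fin R.length)) ⊆
      I₀ ∪ I₁ ∪ Finset.univ.biUnion J := by
    intro i _
    by_cases hi : ∃ a ∈ acc, a.idx = i
    · exact Finset.mem_union_left _ (Finset.mem_union_left _ (by simpa [I₀] using hi))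
    · push Not at hi
      rcases refuses_or_exhausted_of_not_accepted hp hR i hi with
        ⟨r, h1, h2, h3, h4, h⟩ | h
      · have hs : (((r.src : ℕ)), r.time) = σ i := by simp only [σ, h1, h2]
        rcases h with h | ⟨-, h⟩ | h
        · rw [hs] at h
          exact Finset.mem_union_left _ (Finset.mem_union_right _
            (Finset.mem_filter.2 ⟨Finset.mem_univ _, .inl h⟩))
        · exact Finset.mem_union_right _ (Finset.mem_biUnion.2 ⟨_, Finset.mem_univ _,
            Finset.mem_filter.2 ⟨Finset.mem_univ _, r, h1, h2, h3, h4, h⟩⟩)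
        · exact Finset.mem_union_left _ (Finset.mem_union_right _
            (Finset.mem_filter.2 ⟨Finset.mem_univ _, .inr (.inr ⟨r, _, hs, h⟩)⟩))
      · exact Finset.mem_union_left _ (Finset.mem_union_right _
          (Finset.mem_filter.2 ⟨Finset.mem_univ _, .inr (.inl h)⟩))
  have hsplit : f.throughput ≤ ∑ i ∈ I₀, f.amount i + ∑ i ∈ I₁, f.amount i +
      ∑ T, ∑ i ∈ J T, f.amount i := by
    have hunion : ∀ X Y : Finset (Fin R.length),
        ∑ i ∈ X ∪ Y, f.amount i ≤ ∑ i ∈ X, f.amount i + ∑ i ∈ Y, f.amount i := by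
      intro X Y
      rw [← Finset.sum_union_inter]
      linarith [Finset.sum_nonneg (s := X ∩ Y) fun i _ => hamount i]
    have hbi : ∀ Q : Finset Tiling,
        ∑ i ∈ Q.biUnion J, f.amount i ≤ ∑ T ∈ Q, ∑ i ∈ J T, f.amount i := by
      intro Q
      induction Q using Finset.induction_on with
      | empty => simp
      | insert T Q hT ih =>
        rw [Finset.biUnion_insert, Finset.sum_insert hT]
        exact (hunion _ _).trans (by gcongr)
    calc f.throughput = ∑ i, f.amount i := rfl
      _ ≤ ∑ i ∈ I₀ ∪ I₁ ∪ Finset.univ.biUnion J, f.amount i :=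
        Finset.sum_le_sum_of_subset_of_nonneg hcover fun i _ _ => hamount i
      _ ≤ ∑ i ∈ I₀ ∪ I₁, f.amount i + ∑ i ∈ Finset.univ.biUnion J, f.amount i := hunion _ _
      _ ≤ _ := add_le_add (hunion _ _) (hbi _)
  have hI₀ : ∑ i ∈ I₀, f.amount i ≤ L * A := by
    have h1 : ∑ i ∈ I₀, f.amount i ≤ I₀.card := by
      refine (Finset.sum_le_card_nsmul _ _ 1 fun i _ => f.amount_le_one i).trans (by simp)
    have h2 : I₀.card ≤ acc.length := by
      rw [← List.toFinset_card_of_nodup (nodup_of_idx hadm.nodup),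
        ← Finset.card_image_of_injective _ Fin.val_injective]
      refine le_trans (Finset.card_le_card fun j hj => ?_)
        (Finset.card_image_le (f := Entry.idx))
      obtain ⟨i, hi, rfl⟩ := Finset.mem_image.1 hj
      obtain ⟨a, ha, e⟩ := (Finset.mem_filter.1 hi).2
      exact Finset.mem_image.2 ⟨a, List.mem_toFinset.2 ha, e⟩
    have h3 : (I₀.card : ℝ) ≤ A := Nat.cast_le.2 h2
    have h4 : A ≤ L * A := le_mul_of_one_le_left (by positivity) hL
    linarith
  have hI₁ : ∑ i ∈ I₁, f.amount i ≤ 729 * L * A := by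
    refine (f.sum_amount_le_of_source hR hB hc hf (I₁.image σ) I₁ fun i hi =>
      Finset.mem_image_of_mem σ hi).trans ?_
    refine card_mul_le_of_locally_blocked hN hadm.nodup (fun a ha => ?_) _ fun s hs => ?_
    · rw [haccL] at ha
      exact isNear_of_mem_processAll ha
    · obtain ⟨i, hi, rfl⟩ := Finset.mem_image.1 hs
      exact (Finset.mem_filter.1 hi).2
  have hJ : ∀ T, ∑ i ∈ J T, f.amount i ≤ 1440 * L * A := by
    intro T
    obtain ⟨E, hE, hdual⟩ := f.exists_sum_amount_le hB hc hf
    refine (hdual (price acc T) (J T) (fun e => ?_) fun i hi w hw => ?_).trans ?_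
    · unfold price
      have := crossWeight_nonneg hp acc T e
      have := heavyWeight_nonneg acc T e
      positivity
    · obtain ⟨r, h1, h2, h3, h4, h5⟩ := (Finset.mem_filter.1 hi).2
      rw [← h1, ← h2]
      refine one_le_sum_price hN.half_pos hB hc h3 h5 ?_
      unfold Request.IsRoute at hw
      rw [h1, hw]
      exact h4
    · have hD : ∀ m, (2 * N.half m.other * N.capacity ((0, 0), m) : ℝ) ≤ 180 * L := by
        intro m
        have h1 : (N.capacity ((0, 0), m) : ℝ) ≤ 9 * N.trackCap m := by
          exact_mod_cast hN.capacity_le m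
        calc (2 * N.half m.other * N.capacity ((0, 0), m) : ℝ)
            ≤ 2 * N.half m.other * (9 * N.trackCap m) := by gcongr
          _ = 18 * (N.half m.other * N.trackCap m) := by ring
          _ ≤ 18 * (10 * L) := mul_le_mul_of_nonneg_left (hN.half_mul_le m) (by norm_num)
          _ = 180 * L := by ring
      have := sum_price_mul_capacity_le hN.half_pos (by linarith [hN.one_le_pmax]) hN.n_pos hB
        (requestsBefore R (horizon R)) T hD E hE
      rw [← haccL] at this
      linarith
  have hJsum : ∑ T, ∑ i ∈ J T, f.amount i ≤ 4 * (1440 * L * A) := by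
    refine (Finset.sum_le_card_nsmul _ _ _ fun T _ => hJ T).trans (le_of_eq ?_)
    simp
  have : 0 ≤ L * A := by positivity
  linarith

end PacketRouting

end

theorem mainTheorem1 :
    ∃ C : ℝ, 0 < C ∧
      ∀ N : PacketRouting.Network,
        5 ≤ N.B → (N.B : ℝ) ≤ Real.logb 2 N.n →
        5 ≤ N.c → (N.c : ℝ) ≤ Real.logb 2 N.n →
        ∀ R : List (PacketRouting.Request N), PacketRouting.IsRequestSequence R →
          PacketRouting.Feasible R ((PacketRouting.routingAlgorithm N).schedule R) ∧
          PacketRouting.Nonpreemptive R ((PacketRouting.routingAlgorithm N).schedule R) ∧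
          (∀ f : PacketRouting.FractionalRouting R, f.IsPacking 1 →
            f.throughput ≤ C * Real.logb 2 N.n *
              PacketRouting.throughput R ((PacketRouting.routingAlgorithm N).schedule R)) ∧
          (∀ S : PacketRouting.Schedule, PacketRouting.Feasible R S →
            (PacketRouting.throughput R S : ℝ) ≤ C * Real.logb 2 N.n *
              PacketRouting.throughput R ((PacketRouting.routingAlgorithm N).schedule R)) := by
  -- The contributions are 1 for accepted requests, 729 for blocked sources and `4 * 1440` for path
  -- packing in the four tilings, 6490 in all.
  refine ⟨7000, by norm_num, fun N hB hB' hc hc' R hR => ?_⟩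
  have hN := PacketRouting.Network.bounds hB hB' hc hc'
  have hroomy : N.Roomy := ⟨hN.half_pos, hN.room⟩
  have hadm : PacketRouting.Admissible (PacketRouting.allAccepted R) :=
    PacketRouting.admissible_accepted hN.one_le_pmax hN.half_pos hR _
  have hfrac : ∀ f : PacketRouting.FractionalRouting R, f.IsPacking 1 →
      f.throughput ≤ 7000 * Real.logb 2 N.n *
        PacketRouting.throughput R ((PacketRouting.routingAlgorithm N).schedule R) := by
    intro f hf
    refine (PacketRouting.throughput_le hN (by omega) (by omega) hR f hf).trans ?_
    have h1 := PacketRouting.length_le_throughput hR hadm hroomy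
    have h2 := hN.one_le_log
    gcongr
  refine ⟨PacketRouting.feasible_schedule hR hadm hroomy,
    PacketRouting.nonpreemptive_schedule hR hadm hroomy, hfrac, fun S hS => ?_⟩
  obtain ⟨f, hf, e⟩ := PacketRouting.exists_fractionalRouting hR hS
  rw [← e]
  exact hfrac f hf
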